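/- Let $X$ be a $\sigma$-finite measure space; scalars are real. Let $\mathcal D$ be a weak*-dense unital subalgebra of $L^\infty(X)$ and let $\Gamma:\mathcal D\times\mathcal D\to L^\infty(X)$ be an $L^\infty$-diffusion form, i.e. $\Gamma$ is bilinear, symmetric, $\Gamma(f,f)\ge 0$, $\Gamma(fg,h)=f\Gamma(g,h)+g\Gamma(f,h)$, and $\Gamma$ is closed: if $(f_i)$ is a net in $\mathcal D$ with $\sup_i\|\Gamma(f_i,f_i)\|<\infty$ and $f_i\to f$ weak* in $L^\infty(X)$, then $f\in\mathcal D$ and $\Gamma(f_i,g)\to\Gamma(f,g)$ weak* for all $g\in\mathcal D$. For measurable sets $A,B$ of positive measure let $\rho_f(A,B)$ be the distance between the essential ranges of $f|_A$ and $f|_B$, and let $\rho(A,B)=\sup\{\rho_f(A,B): f\in\mathcal D,\ \|\Gamma(f,f)\|\le 1\}$. Put $M=(X,\rho)$, $L(f)=\sup\{\rho_f(A,B)/\rho(A,B):\rho(A,B)>0\}$, $\mathrm{Lip}(M)=\{f\in L^\infty(X):L(f)<\infty\}$, normed by $\max(L(f),\|f\|_\infty)$. Let $E_0=\mathcal D\otimes\mathcal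 D$ with $\langle f_1\otimes g_1,f_2\otimes g_2\rangle=f_1f_2\Gamma(g_1,g_2)$ and bimodule structure $f\cdot(g\otimes h)\cdot k=fg\otimes hk$, let $I=\{\phi\in E_0:\langle\phi,\phi\rangle=0\}$, and let $E_1$ be the image in $E_0/I$ of the sub-bimodule of $E_0$ generated by the elements $f\otimes1-1\otimes f$. Let $E$ be the $L^\infty(X)$-module of all $\mathcal D$-module homomorphisms $\Phi:E_1\to L^\infty(X)$ for which there is a constant $C\ge 0$ with $|\Phi(\phi)|\le C\langle\phi,\phi\rangle^{1/2}$ almost everywhere for every $\phi\in E_1$; $\|\Phi\|$ is the least such $C$. Embed $E_1$ in $E$ by $\phi\mapsto\langle\cdot,\phi\rangle$ and let $\delta:\mathcal D\to E$, $\delta f=1\otimes f-f\otimes1$. Then $\rho$ is a measurable metric on $X$ and $\mathcal D=\mathrm{Lip}(M)$; $E$ is an abelian W*-module over $L^\infty(X)$ (its predual is the closed linear span of the functionals $\Phi\mapsto\int\Phi(\phi)h$, $\phi\in E_1$, $h\in L^1(X)$) and a self-dual Hilbert module for an $L^\infty(X)$-valued inner product satisfying $\langle\phi,\Phi\rangle=\Phi(\phi)$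 for $\phi\in E_1$, $\Phi\in E$ (in particular it extends the inner product of $E_1$). Moreover: (1) $\Gamma(f,g)=\langle\delta f,\delta g\rangle$ for all $f,g\in\mathcal D$; (2) $\delta$ is a metric derivation, i.e. a bounded, weak*-continuous linear map $\mathrm{Lip}(M)\to E$ with $\delta(fg)=f\,\delta g+g\,\delta f$; (3) $\|\delta f\|=L(f)$ for all $f\in\mathcal D=\mathrm{Lip}(M)$; (4) let $\mathcal X(M)$ be the $L^\infty(X)$-module of metric derivations $\mathrm{Lip}(M)\to L^\infty(X)$ with the operator norm, $\Omega(M)=\mathcal X(M)'$ the module of bounded $L^\infty(X)$-module homomorphisms $\mathcal X(M)\to L^\infty(X)$, and $d:\mathrm{Lip}(M)\to\Omega(M)$, $(df)(\phi)=\phi(f)$. There is a nonexpansive $L^\infty(X)$-module homomorphism $T:E\to\mathcal X(M)$ whose adjoint $T^*:\Omega(M)\to E$, given by $\langle T^*\omega,\Phi\rangle=\omega(T\Phi)$, satisfies $\delta=T^*\circ d$. -/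

import Mathlib

open MeasureTheory Set Filter Topology
open scoped ENNReal TensorProduct

namespace Weaver
noncomputable section

variable {X : Type*} [MeasurableSpace X]

/-- The real algebra `L^∞(X)`, with the pointwise product defined below. -/
abbrev LInf (μ : Measure X) : Type _ := Lp ℝ ∞ μ

variable {μ : Measure X}

namespace LInf

instance instMul : Mul (LInf μ) :=
  ⟨fun f g => ((Lp.memLp g).mul (r := ∞) (Lp.memLp f)).toLp (⇑f * ⇑g)⟩

instance instOne : One (LInf μ) := ⟨(memLp_top_const (1 : ℝ)).toLp (fun _ => 1)⟩

theorem coeFn_mul (f g : LInf μ) : ⇑(f * g) =ᵐ[μ] fun x => f x * g x :=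
  MemLp.coeFn_toLp _

theorem coeFn_one : ⇑(1 : LInf μ) =ᵐ[μ] fun _ => (1 : ℝ) :=
  MemLp.coeFn_toLp _

instance instCommRing : CommRing (LInf μ) :=
  { (inferInstance : AddCommGroup (LInf μ)) with
    mul := (· * ·)
    one := 1
    mul_assoc := fun f g h => by
      apply Lp.ext
      filter_upwards [coeFn_mul (f * g) h, coeFn_mul f g, coeFn_mul f (g * h), coeFn_mul g h]
        with x h1 h2 h3 h4
      rw [h1, h2, h3, h4, mul_assoc]
    mul_comm := fun f g => by
      apply Lp.ext
      filter_upwards [coeFn_mul f g, coeFn_mul g f] with x h1 h2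
      rw [h1, h2, mul_comm]
    one_mul := fun f => by
      apply Lp.ext
      filter_upwards [coeFn_mul 1 f, coeFn_one (μ := μ)] with x h1 h2
      rw [h1, h2, one_mul]
    mul_one := fun f => by
      apply Lp.ext
      filter_upwards [coeFn_mul f 1, coeFn_one (μ := μ)] with x h1 h2
      rw [h1, h2, mul_one]
    zero_mul := fun f => by
      apply Lp.ext
      filter_upwards [coeFn_mul 0 f, Lp.coeFn_zero ℝ ∞ μ] with x h1 h2
      rw [h1, h2]; simp
    mul_zero := fun f => by
      apply Lp.ext
      filter_upwards [coeFn_mul f 0, Lp.coeFn_zero ℝ ∞ μ] with x h1 h2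
      rw [h1, h2]; simp
    left_distrib := fun f g h => by
      apply Lp.ext
      filter_upwards [coeFn_mul f (g + h), Lp.coeFn_add g h, coeFn_mul f g, coeFn_mul f h,
        Lp.coeFn_add (f * g) (f * h)] with x h1 h2 h3 h4 h5
      rw [h1, h5, Pi.add_apply, h2, h3, h4, Pi.add_apply, mul_add]
    right_distrib := fun f g h => by
      apply Lp.ext
      filter_upwards [coeFn_mul (f + g) h, Lp.coeFn_add f g, coeFn_mul f h, coeFn_mul g h,
        Lp.coeFn_add (f * h) (g * h)] with x h1 h2 h3 h4 h5
      rw [h1, h5, Pi.add_apply, h2, h3, h4, Pi.add_apply, add_mul] }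

theorem smul_mul' (c : ℝ) (f g : LInf μ) : (c • f) * g = c • (f * g) := by
  apply Lp.ext
  filter_upwards [coeFn_mul (c • f) g, Lp.coeFn_smul c f, coeFn_mul f g,
    Lp.coeFn_smul c (f * g)] with x h1 h2 h3 h4
  rw [h1, h4, h2, Pi.smul_apply, Pi.smul_apply, h3, smul_eq_mul, smul_eq_mul, mul_assoc]

instance instAlgebra : Algebra ℝ (LInf μ) :=
  Algebra.ofModule smul_mul' (fun c f g => by
    rw [mul_comm, smul_mul', mul_comm])

theorem norm_mul_le (f g : LInf μ) : ‖f * g‖ ≤ ‖f‖ * ‖g‖ := by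
  have h : f * g = f • g := by
    apply Lp.ext
    filter_upwards [coeFn_mul f g, Lp.coeFn_lpSMul (r := ∞) f g] with x h1 h2
    rw [h1, h2]; rfl
  rw [h]
  exact Lp.norm_smul_le f g

theorem le_iff {f g : LInf μ} : f ≤ g ↔ ∀ᵐ x ∂μ, f x ≤ g x := (Lp.coeFn_le f g).symm

theorem nonneg_iff {f : LInf μ} : 0 ≤ f ↔ ∀ᵐ x ∂μ, 0 ≤ f x := by
  rw [le_iff]
  constructor <;> intro h <;> filter_upwards [h, Lp.coeFn_zero ℝ ∞ μ] with x h1 h2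
  · rwa [h2] at h1
  · rwa [h2]

theorem ae_norm_le (f : LInf μ) : ∀ᵐ x ∂μ, |f x| ≤ ‖f‖ := by
  have := ae_le_eLpNormEssSup (f := (f : X → ℝ)) (μ := μ)
  filter_upwards [this] with x hx
  rw [Lp.norm_def, eLpNorm_exponent_top]
  have h := ENNReal.toReal_mono (by
    rw [← eLpNorm_exponent_top]; exact Lp.eLpNorm_ne_top f) hx
  simpa using h

theorem norm_le_of_ae {f : LInf μ} {C : ℝ} (hC : 0 ≤ C) (h : ∀ᵐ x ∂μ, |f x| ≤ C) : ‖f‖ ≤ C := by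
  rw [Lp.norm_def, eLpNorm_exponent_top]
  refine ENNReal.toReal_le_of_le_ofReal hC ?_
  refine eLpNormEssSup_le_of_ae_bound ?_
  filter_upwards [h] with x hx
  exact hx

theorem coeFn_sum {ι : Type*} (s : Finset ι) (f : ι → LInf μ) :
    ⇑(∑ i ∈ s, f i) =ᵐ[μ] fun x => ∑ i ∈ s, f i x := by
  classical
  induction s using Finset.induction with
  | empty =>
    filter_upwards [Lp.coeFn_zero ℝ ∞ μ] with x hx
    simpa using hx
  | insert a s ha ih =>
    rw [Finset.sum_insert ha]
    filter_upwards [Lp.coeFn_add (f a) (∑ i ∈ s, f i), ih] with x h1 h2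
    rw [h1, Finset.sum_insert ha, Pi.add_apply, h2]

/-- The pairing `∫ f h dμ` of `L^∞` with `L^1`. -/
def pairing (f : LInf μ) (h : Lp ℝ 1 μ) : ℝ := ∫ x, f x * h x ∂μ

theorem integrable_pairing (f : LInf μ) (h : Lp ℝ 1 μ) : Integrable (fun x => f x * h x) μ := by
  rw [← memLp_one_iff_integrable]
  exact (Lp.memLp h).mul (r := 1) (Lp.memLp f)

theorem pairing_add (f g : LInf μ) (h : Lp ℝ 1 μ) :
    pairing (f + g) h = pairing f h + pairing g h := by
  unfold pairing
  rw [← integral_add (integrable_pairing f h) (integrable_pairing g h)]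
  apply integral_congr_ae
  filter_upwards [Lp.coeFn_add f g] with x hx
  rw [hx, Pi.add_apply, add_mul]

theorem pairing_smul (c : ℝ) (f : LInf μ) (h : Lp ℝ 1 μ) :
    pairing (c • f) h = c * pairing f h := by
  unfold pairing
  rw [← integral_const_mul]
  apply integral_congr_ae
  filter_upwards [Lp.coeFn_smul c f] with x hx
  rw [hx, Pi.smul_apply, smul_eq_mul, mul_assoc]

theorem pairing_mul (g f : LInf μ) (h : Lp ℝ 1 μ) :
    pairing (g * f) h = pairing f (g • h : Lp ℝ 1 μ) := by
  unfold pairing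
  apply integral_congr_ae
  filter_upwards [coeFn_mul g f, Lp.coeFn_lpSMul (r := 1) g h] with x h1 h2
  rw [h1, h2, Pi.smul_apply', smul_eq_mul]; ring

theorem abs_pairing_le (f : LInf μ) (h : Lp ℝ 1 μ) : |pairing f h| ≤ ‖f‖ * ‖h‖ := by
  unfold pairing
  rw [L1.norm_eq_integral_norm, ← integral_const_mul]
  refine abs_integral_le_integral_abs.trans ?_
  refine integral_mono_ae (integrable_pairing f h).abs
    ((L1.integrable_coeFn h).norm.const_mul _) ?_
  filter_upwards [ae_norm_le f] with x hx
  rw [abs_mul, Real.norm_eq_abs]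
  exact mul_le_mul_of_nonneg_right hx (abs_nonneg _)

end LInf

/-- The weak* topology of `L^∞(X)` as the dual of `L^1(X)`. -/
@[reducible] def weakStar (μ : Measure X) : TopologicalSpace (LInf μ) :=
  TopologicalSpace.induced (fun f (h : Lp ℝ 1 μ) => LInf.pairing f h) Pi.topologicalSpace

/-! ### Norms defined as a least constant -/

/-- If `S v` is the closed set of admissible constants `C ≥ 0` in an estimate for `v`, then
`v ↦ inf S v` is a norm. -/
theorem leastConst_core {V : Type*} [AddCommGroup V] [Module ℝ V] [Norm V] (S : V → Set ℝ)
    (hnorm : ∀ v : V, ‖v‖ = sInf (S v))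
    (h0 : ∀ v, ∀ C ∈ S v, 0 ≤ C) (hne : ∀ v, (S v).Nonempty) (hcl : ∀ v, IsClosed (S v))
    (hadd : ∀ v w, ∀ C ∈ S v, ∀ C' ∈ S w, C + C' ∈ S (v + w))
    (hsmul : ∀ (c : ℝ) (v), ∀ C ∈ S v, |c| * C ∈ S (c • v))
    (hdef : ∀ v, (0 : ℝ) ∈ S v → v = 0) : NormedSpace.Core ℝ V := by
  have hbdd : ∀ v, BddBelow (S v) := fun v => ⟨0, fun C hC => h0 v C hC⟩
  have hmem : ∀ v, ‖v‖ ∈ S v := fun v => by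
    rw [hnorm]; exact (hcl v).csInf_mem (hne v) (hbdd v)
  have hle : ∀ v, ∀ C ∈ S v, ‖v‖ ≤ C := fun v C hC => by
    rw [hnorm]; exact csInf_le (hbdd v) hC
  have hsm : ∀ (c : ℝ) (v : V), ‖c • v‖ ≤ |c| * ‖v‖ := fun c v =>
    hle _ _ (hsmul c v _ (hmem v))
  have hz : ‖(0 : V)‖ = 0 := by
    have := hsm 0 (0 : V)
    rw [zero_smul, abs_zero, zero_mul] at this
    exact le_antisymm this (h0 _ _ (hmem _))
  refine ⟨⟨fun v => h0 _ _ (hmem v), fun c v => ?_, fun v w => ?_⟩, fun v => ?_⟩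
  · rw [Real.norm_eq_abs]
    refine le_antisymm (hsm c v) ?_
    by_cases hc : c = 0
    · subst hc; rw [abs_zero, zero_mul]; exact h0 _ _ (hmem _)
    · have := hsm c⁻¹ (c • v)
      rw [smul_smul, inv_mul_cancel₀ hc, one_smul, abs_inv] at this
      have hc' : 0 < |c| := abs_pos.mpr hc
      calc |c| * ‖v‖ ≤ |c| * (|c|⁻¹ * ‖c • v‖) := by gcongr
        _ = ‖c • v‖ := by field_simp
  · exact hle _ _ (hadd v w _ (hmem v) _ (hmem w))
  · constructor
    · intro h
      apply hdef
      rw [← h]; exact hmem v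
    · rintro rfl; exact hz

/-! ### Modules over `L^∞(X)` -/

/-- The weak* topology determined on `V` by a space `P` of bounded functionals. -/
@[reducible] def predualTopology {V : Type*} [NormedAddCommGroup V] [NormedSpace ℝ V]
    (P : Submodule ℝ (StrongDual ℝ V)) : TopologicalSpace V :=
  TopologicalSpace.induced (fun v (p : P) => (p : StrongDual ℝ V) v) Pi.topologicalSpace

/-- `V` is an abelian W*-module over `L^∞(X)` with predual `P`: a Banach module in which
`‖v‖ = max (‖p v‖, ‖(1 - p) v‖)` for every projection `p`, which is canonically the dual of the
Banach space `P` and whose product is separately weak*-continuous. -/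
structure IsAbelianWStarModule (μ : Measure X) {V : Type*} [NormedAddCommGroup V] [NormedSpace ℝ V]
    [Module (LInf μ) V] (P : Submodule ℝ (StrongDual ℝ V)) : Prop where
  complete : CompleteSpace V
  norm_smul_le : ∀ (f : LInf μ) (v : V), ‖f • v‖ ≤ ‖f‖ * ‖v‖
  norm_projection : ∀ p : LInf μ, p * p = p → ∀ v : V, ‖v‖ = max ‖p • v‖ ‖(1 - p) • v‖
  predual_closed : IsClosed (P : Set (StrongDual ℝ V))
  predual_norm : ∀ v : V, IsLUB {r : ℝ | ∃ p ∈ P, ‖p‖ ≤ 1 ∧ r = p v} ‖v‖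
  predual_surjective : ∀ ξ : P →ₗ[ℝ] ℝ, (∃ C : ℝ, ∀ p : P, |ξ p| ≤ C * ‖(p : StrongDual ℝ V)‖) →
    ∃ v : V, ∀ p : P, ξ p = (p : StrongDual ℝ V) v
  continuous_smul_left : ∀ v : V,
    @Continuous _ _ (weakStar μ) (predualTopology P) (fun f : LInf μ => f • v)
  continuous_smul_right : ∀ f : LInf μ,
    @Continuous _ _ (predualTopology P) (predualTopology P) (fun v : V => f • v)

/-- The dual module `V'`: bounded `L^∞(X)`-module homomorphisms from `V` to `L^∞(X)`. -/
def dualModule (μ : Measure X) (V : Type*) [NormedAddCommGroup V] [Module (LInf μ) V] :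
    Submodule (LInf μ) (V →ₗ[LInf μ] LInf μ) where
  carrier := {F | ∃ C : ℝ, ∀ v, ‖F v‖ ≤ C * ‖v‖}
  zero_mem' := ⟨0, fun v => by simp⟩
  add_mem' := by
    rintro F G ⟨C, hC⟩ ⟨C', hC'⟩
    refine ⟨C + C', fun v => ?_⟩
    rw [LinearMap.add_apply, add_mul]
    exact (norm_add_le _ _).trans (add_le_add (hC v) (hC' v))
  smul_mem' := by
    rintro f F ⟨C, hC⟩
    refine ⟨‖f‖ * C, fun v => ?_⟩
    rw [LinearMap.smul_apply, smul_eq_mul, mul_assoc]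
    exact (LInf.norm_mul_le _ _).trans (mul_le_mul_of_nonneg_left (hC v) (norm_nonneg _))

/-- `B` makes the Banach module `V` a self-dual Hilbert module over `L^∞(X)`. -/
structure IsSelfDualHilbertModule {V : Type*} [NormedAddCommGroup V] [Module (LInf μ) V]
    (B : V →ₗ[LInf μ] V →ₗ[LInf μ] LInf μ) : Prop where
  symm : ∀ v w, B v w = B w v
  nonneg : ∀ v, 0 ≤ B v v
  definite : ∀ v, B v v = 0 → v = 0
  norm_sq : ∀ v, ‖v‖ ^ 2 = ‖B v v‖
  complete : CompleteSpace V
  self_dual : ∀ F ∈ dualModule μ V, ∃ w, ∀ v, F v = B v w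

/-! ### Measurable metrics -/

/-- Measurable sets of positive measure. -/
def PosSet (μ : Measure X) : Type _ := {A : Set X // MeasurableSet A ∧ μ A ≠ 0}

/-- A measurable pseudometric; the first condition says that `ρ` is defined modulo null sets. -/
structure IsMeasurablePseudometric (ρ : PosSet μ → PosSet μ → ℝ≥0∞) : Prop where
  congr : ∀ A A' B B' : PosSet μ, A.1 =ᵐ[μ] A'.1 → B.1 =ᵐ[μ] B'.1 → ρ A B = ρ A' B'
  self : ∀ A, ρ A A = 0
  symm : ∀ A B, ρ A B = ρ B A
  iUnion : ∀ (A : ℕ → PosSet μ) (U B : PosSet μ), U.1 = ⋃ n, (A n).1 → ρ U B = ⨅ n, ρ (A n) B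
  triangle : ∀ A B C : PosSet μ, ρ A C ≤ ⨆ (B' : PosSet μ) (_ : B'.1 ⊆ B.1), (ρ A B' + ρ B' C)

/-- The essential range of `f|_A`. -/
def essRange (f : LInf μ) (A : Set X) : Set ℝ := {a | ∀ U ∈ 𝓝 a, μ (A ∩ f ⁻¹' U) ≠ 0}

/-- `ρ_f(A, B)`, the distance between the essential ranges of `f|_A` and `f|_B`. -/
def essDist (f : LInf μ) (A B : PosSet μ) : ℝ≥0∞ :=
  ⨅ (a ∈ essRange f A.1) (b ∈ essRange f B.1), edist a b

/-- The Lipschitz number `L(f)`. -/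
def lipNumber (ρ : PosSet μ → PosSet μ → ℝ≥0∞) (f : LInf μ) : ℝ≥0∞ :=
  ⨆ (A : PosSet μ) (B : PosSet μ) (_ : 0 < ρ A B), essDist f A B / ρ A B

/-- `Lip(M)`. -/
def lip (ρ : PosSet μ → PosSet μ → ℝ≥0∞) : Set (LInf μ) := {f | lipNumber ρ f ≠ ∞}

/-- A measurable metric: a measurable pseudometric for which `Lip(M)` is weak*-dense. -/
structure IsMeasurableMetric (ρ : PosSet μ → PosSet μ → ℝ≥0∞) : Prop
    extends IsMeasurablePseudometric ρ where
  dense_lip : @Dense _ (weakStar μ) (lip ρ)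

/-- The norm `max (L(f), ‖f‖_∞)` of `Lip(M)`. -/
def lipNorm (ρ : PosSet μ → PosSet μ → ℝ≥0∞) (f : LInf μ) : ℝ := max (lipNumber ρ f).toReal ‖f‖

variable (ρ : PosSet μ → PosSet μ → ℝ≥0∞)

theorem lipNorm_nonneg (f : LInf μ) : 0 ≤ lipNorm ρ f := le_max_of_le_right (norm_nonneg _)

/-- The predual of `Lip(M)`: linear functionals whose restriction to the unit ball is continuous
for the weak* topology of `L^∞`. -/
structure IsLipPredual (F : lip ρ → ℝ) : Prop where
  add : ∀ f g h : lip ρ, (h : LInf μ) = f + g → F h = F f + F g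
  smul : ∀ (c : ℝ) (f h : lip ρ), (h : LInf μ) = c • (f : LInf μ) → F h = c * F f
  continuousOn_ball : @ContinuousOn _ _ (TopologicalSpace.induced Subtype.val (weakStar μ)) _ F
    {f | lipNorm ρ f ≤ 1}

/-- The weak* topology of `Lip(M)`. It is the dual space topology whose restriction to the unit
ball is that of the weak* topology of `L^∞`. -/
@[reducible] def lipWeakStar : TopologicalSpace (lip ρ) :=
  TopologicalSpace.induced (fun f (F : {F // IsLipPredual ρ F}) => F.1 f) Pi.topologicalSpace

/-- `δ : Lip(M) → V` is a metric derivation, where `τ` is the weak* topology of the abelian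
W*-module `V`. -/
structure IsMetricDerivation {V : Type*} [NormedAddCommGroup V] [NormedSpace ℝ V]
    [Module (LInf μ) V] (τ : TopologicalSpace V) (δ : lip ρ → V) : Prop where
  add : ∀ f g h : lip ρ, (h : LInf μ) = f + g → δ h = δ f + δ g
  smul : ∀ (c : ℝ) (f h : lip ρ), (h : LInf μ) = c • (f : LInf μ) → δ h = c • δ f
  leibniz : ∀ f g h : lip ρ, (h : LInf μ) = f * g →
    δ h = (f : LInf μ) • δ g + (g : LInf μ) • δ f
  bounded : ∃ C : ℝ, 0 ≤ C ∧ ∀ f, ‖δ f‖ ≤ C * lipNorm ρ f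
  continuous : @Continuous _ _ (lipWeakStar ρ) τ δ

/-- The metric derivations `Lip(M) → L^∞(M)`, as an `L^∞(M)`-module. -/
def vectorFieldSubmodule : Submodule (LInf μ) (lip ρ → LInf μ) where
  carrier := {φ | IsMetricDerivation ρ (weakStar μ) φ}
  zero_mem' := by
    refine ⟨fun f g h _ => ?_, fun c f h _ => ?_, fun f g h _ => ?_, ⟨0, le_rfl, fun f => ?_⟩, ?_⟩
    · simp
    · simp
    · simp
    · simp
    · exact @continuous_const _ _ (lipWeakStar ρ) (weakStar μ) 0
  add_mem' := by
    rintro φ ψ hφ hψ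
    refine ⟨fun f g h e => ?_, fun c f h e => ?_, fun f g h e => ?_, ?_, ?_⟩
    · simp only [Pi.add_apply]; rw [hφ.add f g h e, hψ.add f g h e]; abel
    · simp only [Pi.add_apply]; rw [hφ.smul c f h e, hψ.smul c f h e, smul_add]
    · simp only [Pi.add_apply]
      rw [hφ.leibniz f g h e, hψ.leibniz f g h e, smul_add, smul_add]; abel
    · obtain ⟨C, h0, hC⟩ := hφ.bounded
      obtain ⟨C', h0', hC'⟩ := hψ.bounded
      refine ⟨C + C', add_nonneg h0 h0', fun f => ?_⟩
      rw [Pi.add_apply, add_mul]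
      exact (norm_add_le _ _).trans (add_le_add (hC f) (hC' f))
    · have h1 := hφ.continuous
      have h2 := hψ.continuous
      let _ := lipWeakStar ρ
      rw [continuous_induced_rng, continuous_pi_iff] at h1 h2 ⊢
      intro k
      refine ((h1 k).add (h2 k)).congr fun f => ?_
      exact (LInf.pairing_add _ _ k).symm
  smul_mem' := by
    rintro a φ hφ
    refine ⟨fun f g h e => ?_, fun c f h e => ?_, fun f g h e => ?_, ?_, ?_⟩
    · simp only [Pi.smul_apply]; rw [hφ.add f g h e, smul_add]
    · simp only [Pi.smul_apply]; rw [hφ.smul c f h e, smul_eq_mul, smul_eq_mul, mul_smul_comm]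
    · simp only [Pi.smul_apply]; rw [hφ.leibniz f g h e]
      simp only [smul_eq_mul]; ring
    · obtain ⟨C, h0, hC⟩ := hφ.bounded
      refine ⟨‖a‖ * C, mul_nonneg (norm_nonneg _) h0, fun f => ?_⟩
      rw [Pi.smul_apply, smul_eq_mul, mul_assoc]
      exact (LInf.norm_mul_le _ _).trans (mul_le_mul_of_nonneg_left (hC f) (norm_nonneg _))
    · have h1 := hφ.continuous
      let _ := lipWeakStar ρ
      rw [continuous_induced_rng, continuous_pi_iff] at h1 ⊢
      intro k
      refine (h1 (a • k : Lp ℝ 1 μ)).congr fun f => ?_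
      exact (LInf.pairing_mul a _ k).symm

/-- The module `𝒳(M)` of measurable vector fields. -/
def VectorField : Type _ := vectorFieldSubmodule ρ

namespace VectorField

instance : AddCommGroup (VectorField ρ) := inferInstanceAs (AddCommGroup (vectorFieldSubmodule ρ))

instance : Module (LInf μ) (VectorField ρ) :=
  inferInstanceAs (Module (LInf μ) (vectorFieldSubmodule ρ))

instance : Module ℝ (VectorField ρ) := inferInstanceAs (Module ℝ (vectorFieldSubmodule ρ))

instance : CoeFun (VectorField ρ) (fun _ => lip ρ → LInf μ) := ⟨fun φ => φ.1⟩

/-- The constants `C` with `‖φ f‖ ≤ C ‖f‖_L` for all `f`. -/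
def bounds (φ : VectorField ρ) : Set ℝ := {C | 0 ≤ C ∧ ∀ f, ‖φ f‖ ≤ C * lipNorm ρ f}

/-- The operator norm. -/
instance : Norm (VectorField ρ) := ⟨fun φ => sInf (bounds ρ φ)⟩

theorem isClosed_bounds (φ : VectorField ρ) : IsClosed (bounds ρ φ) := by
  refine isClosed_Ici.inter ?_
  have h : {C : ℝ | ∀ f, ‖φ f‖ ≤ C * lipNorm ρ f} = ⋂ f, {C : ℝ | ‖φ f‖ ≤ C * lipNorm ρ f} := by
    ext C; simp
  change IsClosed {C : ℝ | ∀ f, ‖φ f‖ ≤ C * lipNorm ρ f}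
  rw [h]
  exact isClosed_iInter fun f => isClosed_le continuous_const (continuous_id.mul continuous_const)

theorem norm_mem (φ : VectorField ρ) : ‖φ‖ ∈ bounds ρ φ :=
  (isClosed_bounds ρ φ).csInf_mem φ.2.bounded ⟨0, fun _ h => h.1⟩

theorem core : NormedSpace.Core ℝ (VectorField ρ) := by
  refine leastConst_core (bounds ρ) (fun _ => rfl) (fun _ _ h => h.1) (fun φ => φ.2.bounded)
    (isClosed_bounds ρ) ?_ ?_ ?_
  · rintro φ ψ C ⟨h0, hC⟩ C' ⟨h0', hC'⟩
    refine ⟨add_nonneg h0 h0', fun f => ?_⟩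
    rw [add_mul]
    exact (norm_add_le _ _).trans (add_le_add (hC f) (hC' f))
  · rintro c φ C ⟨h0, hC⟩
    refine ⟨mul_nonneg (abs_nonneg _) h0, fun f => ?_⟩
    have : ‖c • φ f‖ = |c| * ‖φ f‖ := by rw [norm_smul, Real.norm_eq_abs]
    rw [mul_assoc]
    exact this.le.trans (mul_le_mul_of_nonneg_left (hC f) (abs_nonneg _))
  · rintro φ ⟨-, h⟩
    apply Subtype.ext
    funext f
    have := h f
    rw [zero_mul] at this
    exact norm_le_zero_iff.mp this

instance : NormedAddCommGroup (VectorField ρ) := NormedAddCommGroup.ofCore (core ρ)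

instance : NormedSpace ℝ (VectorField ρ) := NormedSpace.ofCore (core ρ)

end VectorField

/-- The module `Ω(M) = 𝒳(M)'` of measurable 1-forms. -/
abbrev OneForm : Type _ := dualModule μ (VectorField ρ)

/-- The exterior derivative `d : Lip(M) → Ω(M)`, `(df)(φ) = φ(f)`. -/
def extDeriv (f : lip ρ) : OneForm ρ :=
  ⟨{ toFun := fun φ => φ f
     map_add' := fun _ _ => rfl
     map_smul' := fun _ _ => rfl },
   ⟨lipNorm ρ f, fun φ => by
      rw [mul_comm]; exact (VectorField.norm_mem ρ φ).2 f⟩⟩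

/-! ### Diffusion forms -/

/-- An `L^∞`-diffusion form. Convergence of nets is expressed by filters. -/
structure DiffusionForm (μ : Measure X) where
  /-- The domain `𝒟`, a unital subalgebra of `L^∞(X)`. -/
  domain : Subalgebra ℝ (LInf μ)
  dense_domain : @Dense _ (weakStar μ) (domain : Set (LInf μ))
  /-- The bilinear map `Γ`. -/
  form : domain →ₗ[ℝ] domain →ₗ[ℝ] LInf μ
  symm : ∀ f g, form f g = form g f
  nonneg : ∀ f, 0 ≤ form f f
  leibniz : ∀ f g h, form (f * g) h = (f : LInf μ) * form g h + (g : LInf μ) * form f h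
  closed : ∀ (l : Filter domain) [l.NeBot] (C : ℝ) (f : LInf μ),
    (∀ᶠ u in l, ‖form u u‖ ≤ C) →
    Tendsto (fun u : domain => (u : LInf μ)) l (@nhds _ (weakStar μ) f) →
    ∃ hf : f ∈ domain, ∀ g : domain,
      Tendsto (fun u => form u g) l (@nhds _ (weakStar μ) (form ⟨f, hf⟩ g))

namespace DiffusionForm

variable (Γ : DiffusionForm μ)

/-- The intrinsic measurable metric
`ρ(A, B) = sup {ρ_f(A, B) : f ∈ 𝒟, ‖Γ(f, f)‖ ≤ 1}`. -/
def metric (A B : PosSet μ) : ℝ≥0∞ :=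
  ⨆ (f : Γ.domain) (_ : ‖Γ.form f f‖ ≤ 1), essDist (f : LInf μ) A B

/-- `E₀ = 𝒟 ⊗ 𝒟`. As a ring it acts on itself, `f · φ · k = (f ⊗ k) φ`, so that its
sub-bimodules are its ideals. -/
abbrev E₀ : Type _ := Γ.domain ⊗[ℝ] Γ.domain

/-- The form `⟨f₁ ⊗ g₁, f₂ ⊗ g₂⟩ = f₁ f₂ Γ(g₁, g₂)` on `E₀`. -/
def inner₀ : Γ.E₀ →ₗ[ℝ] Γ.E₀ →ₗ[ℝ] LInf μ :=
  (TensorProduct.map₂ ((LinearMap.mul ℝ (LInf μ)).compl₁₂ Γ.domain.val.toLinearMap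
    Γ.domain.val.toLinearMap) Γ.form).compr₂ (LinearMap.mul' ℝ (LInf μ))

theorem inner₀_tmul (f₁ g₁ f₂ g₂ : Γ.domain) :
    Γ.inner₀ (f₁ ⊗ₜ g₁) (f₂ ⊗ₜ g₂) = ((f₁ : LInf μ) * f₂) * Γ.form g₁ g₂ := by
  simp [inner₀]

theorem inner₀_symm (φ ψ : Γ.E₀) : Γ.inner₀ φ ψ = Γ.inner₀ ψ φ := by
  induction φ using TensorProduct.induction_on with
  | zero => simp
  | add a b ha hb => rw [map_add, map_add, LinearMap.add_apply, ha, hb]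
  | tmul f g =>
    induction ψ using TensorProduct.induction_on with
    | zero => simp
    | add a b ha hb => rw [map_add, map_add, LinearMap.add_apply, ha, hb]
    | tmul f' g' => rw [inner₀_tmul, inner₀_tmul, Γ.symm g g', mul_comm (f : LInf μ)]

theorem inner₀_smul_left (a : Γ.domain) (φ ψ : Γ.E₀) :
    Γ.inner₀ (a • φ) ψ = a • Γ.inner₀ φ ψ := by
  induction φ using TensorProduct.induction_on with
  | zero => simp
  | add x y hx hy => rw [smul_add, map_add, map_add, LinearMap.add_apply, LinearMap.add_apply,
      hx, hy, smul_add]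
  | tmul f g =>
    induction ψ using TensorProduct.induction_on with
    | zero => simp
    | add x y hx hy => rw [map_add, map_add, hx, hy, smul_add]
    | tmul f' g' =>
      rw [TensorProduct.smul_tmul', inner₀_tmul, inner₀_tmul]
      simp only [smul_eq_mul, MulMemClass.coe_mul, Subalgebra.smul_def]
      ring

/-- The form of `E₀` is positive. -/
theorem inner₀_self_nonneg (φ : Γ.E₀) : 0 ≤ Γ.inner₀ φ φ := by
  classical
  obtain ⟨S, rfl⟩ := TensorProduct.exists_finset φ
  rw [LInf.nonneg_iff]
  have hexp : ∀ c : S → S → LInf μ, ∀ᵐ x ∂μ,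
      (∑ i : S, ∑ j : S, c i j : LInf μ) x = ∑ i : S, ∑ j : S, c i j x := by
    intro c
    filter_upwards [LInf.coeFn_sum Finset.univ fun i : S => ∑ j : S, c i j,
      ae_all_iff.mpr fun i : S => LInf.coeFn_sum Finset.univ fun j : S => c i j] with x h1 h2
    rw [h1]
    exact Finset.sum_congr rfl fun i _ => h2 i
  have hq : ∀ q : S → ℚ, ∀ᵐ x ∂μ,
      0 ≤ ∑ i : S, ∑ j : S, (q i : ℝ) * (q j : ℝ) * Γ.form j.1.2 i.1.2 x := by
    intro q
    have h := Γ.nonneg (∑ i : S, (q i : ℝ) • i.1.2)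
    have e : Γ.form (∑ i : S, (q i : ℝ) • i.1.2) (∑ i : S, (q i : ℝ) • i.1.2) =
        ∑ i : S, ∑ j : S, (q i : ℝ) • (q j : ℝ) • Γ.form j.1.2 i.1.2 := by
      simp only [LinearMap.sum_apply, map_sum, map_smul, LinearMap.smul_apply, Finset.smul_sum]
    rw [e, LInf.nonneg_iff] at h
    have h2 : ∀ᵐ x ∂μ, ∀ i j : S, ((q i : ℝ) • (q j : ℝ) • Γ.form j.1.2 i.1.2 : LInf μ) x
        = (q i : ℝ) * (q j : ℝ) * Γ.form j.1.2 i.1.2 x := by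
      rw [ae_all_iff]; intro i
      rw [ae_all_iff]; intro j
      filter_upwards [Lp.coeFn_smul (q i : ℝ) ((q j : ℝ) • Γ.form j.1.2 i.1.2),
        Lp.coeFn_smul (q j : ℝ) (Γ.form j.1.2 i.1.2)] with x h1 h2
      rw [h1, Pi.smul_apply, h2, Pi.smul_apply, smul_eq_mul, smul_eq_mul, mul_assoc]
    filter_upwards [h, h2, hexp fun i j => (q i : ℝ) • (q j : ℝ) • Γ.form j.1.2 i.1.2]
      with x a b c
    rw [c] at a
    simpa only [b] using a
  have hE : ∀ᵐ x ∂μ, ∀ i j : S,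
      (((j.1.1 : LInf μ) * (i.1.1 : LInf μ)) * Γ.form j.1.2 i.1.2 : LInf μ) x
      = (i.1.1 : LInf μ) x * (j.1.1 : LInf μ) x * Γ.form j.1.2 i.1.2 x := by
    rw [ae_all_iff]; intro i
    rw [ae_all_iff]; intro j
    filter_upwards [LInf.coeFn_mul ((j.1.1 : LInf μ) * (i.1.1 : LInf μ)) (Γ.form j.1.2 i.1.2),
      LInf.coeFn_mul (j.1.1 : LInf μ) (i.1.1 : LInf μ)] with x h1 h2
    rw [h1, h2, mul_comm ((j.1.1 : LInf μ) x)]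
  have hsum : Γ.inner₀ (∑ i ∈ S, i.1 ⊗ₜ[ℝ] i.2) (∑ i ∈ S, i.1 ⊗ₜ[ℝ] i.2) =
      ∑ i : S, ∑ j : S,
        (((j.1.1 : LInf μ) * (i.1.1 : LInf μ)) * Γ.form j.1.2 i.1.2 : LInf μ) := by
    rw [← Finset.sum_coe_sort S]
    simp only [map_sum, LinearMap.sum_apply, inner₀_tmul]
  rw [hsum]
  filter_upwards [ae_all_iff.mpr hq, hE,
    hexp fun i j => ((j.1.1 : LInf μ) * (i.1.1 : LInf μ)) * Γ.form j.1.2 i.1.2] with x hx h2 h1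
  rw [h1]
  simp only [h2]
  have hd : DenseRange (Pi.map fun (_ : S) (q : ℚ) => (q : ℝ)) :=
    DenseRange.piMap fun _ => Rat.denseRange_cast
  have key : ∀ v : S → ℝ, 0 ≤ ∑ i : S, ∑ j : S, v i * v j * Γ.form j.1.2 i.1.2 x := by
    intro v
    refine hd.induction_on (p := fun v : S → ℝ =>
      0 ≤ ∑ i : S, ∑ j : S, v i * v j * Γ.form j.1.2 i.1.2 x) v ?_ (fun q => hx q)
    exact isClosed_le continuous_const (by fun_prop)
  exact key fun i => (i.1.1 : LInf μ) x

/-- The Cauchy-Schwarz inequality, almost everywhere. -/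
theorem inner₀_mul_self_le (φ ψ : Γ.E₀) :
    Γ.inner₀ φ ψ * Γ.inner₀ φ ψ ≤ Γ.inner₀ φ φ * Γ.inner₀ ψ ψ := by
  have hq : ∀ q : ℚ, ∀ᵐ x ∂μ, 0 ≤ Γ.inner₀ ψ ψ x * ((q : ℝ) * q) + 2 * Γ.inner₀ φ ψ x * q
      + Γ.inner₀ φ φ x := by
    intro q
    have h := Γ.inner₀_self_nonneg (φ + (q : ℝ) • ψ)
    have e : Γ.inner₀ (φ + (q : ℝ) • ψ) (φ + (q : ℝ) • ψ) =
        ((q : ℝ) * q) • Γ.inner₀ ψ ψ + ((2 * q : ℝ) • Γ.inner₀ φ ψ + Γ.inner₀ φ φ) := by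
      simp only [map_add, map_smul, LinearMap.add_apply, LinearMap.smul_apply,
        Γ.inner₀_symm ψ φ]
      module
    rw [e, LInf.nonneg_iff] at h
    filter_upwards [h, Lp.coeFn_add (((q : ℝ) * q) • Γ.inner₀ ψ ψ)
      ((2 * q : ℝ) • Γ.inner₀ φ ψ + Γ.inner₀ φ φ), Lp.coeFn_add ((2 * q : ℝ) • Γ.inner₀ φ ψ)
      (Γ.inner₀ φ φ), Lp.coeFn_smul ((q : ℝ) * q) (Γ.inner₀ ψ ψ),
      Lp.coeFn_smul (2 * q : ℝ) (Γ.inner₀ φ ψ)] with x h1 h2 h3 h4 h5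
    rw [h2, Pi.add_apply, h3, Pi.add_apply, h4, h5, Pi.smul_apply, Pi.smul_apply, smul_eq_mul,
      smul_eq_mul] at h1
    linarith
  rw [LInf.le_iff]
  filter_upwards [ae_all_iff.mpr hq, LInf.coeFn_mul (Γ.inner₀ φ ψ) (Γ.inner₀ φ ψ),
    LInf.coeFn_mul (Γ.inner₀ φ φ) (Γ.inner₀ ψ ψ)] with x hx h1 h2
  rw [h1, h2]
  have key : ∀ t : ℝ, 0 ≤ Γ.inner₀ ψ ψ x * (t * t) + 2 * Γ.inner₀ φ ψ x * t
      + Γ.inner₀ φ φ x := by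
    intro t
    refine Rat.denseRange_cast.induction_on (p := fun t : ℝ => 0 ≤ Γ.inner₀ ψ ψ x * (t * t)
      + 2 * Γ.inner₀ φ ψ x * t + Γ.inner₀ φ φ x) t ?_ hx
    exact isClosed_le continuous_const (by fun_prop)
  have := discrim_le_zero key
  rw [discrim] at this
  nlinarith

theorem inner₀_eq_zero {φ : Γ.E₀} (h : Γ.inner₀ φ φ = 0) (ψ : Γ.E₀) : Γ.inner₀ φ ψ = 0 := by
  have h1 := Γ.inner₀_mul_self_le φ ψ
  rw [h, zero_mul, LInf.le_iff] at h1
  apply Lp.ext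
  filter_upwards [h1, LInf.coeFn_mul (Γ.inner₀ φ ψ) (Γ.inner₀ φ ψ), Lp.coeFn_zero ℝ ∞ μ]
    with x a b c
  rw [b, c] at a
  rw [c]
  exact mul_self_eq_zero.mp (le_antisymm a (mul_self_nonneg _))

/-- The null space `I = {φ : ⟨φ, φ⟩ = 0}` of `E₀`. -/
def nullSubmodule : Submodule Γ.domain Γ.E₀ where
  carrier := {φ | Γ.inner₀ φ φ = 0}
  zero_mem' := by simp
  add_mem' := by
    intro φ ψ hφ hψ
    change Γ.inner₀ (φ + ψ) (φ + ψ) = 0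
    rw [LinearMap.map_add₂, Γ.inner₀_eq_zero hφ, Γ.inner₀_eq_zero hψ, add_zero]
  smul_mem' := by
    intro a φ hφ
    change Γ.inner₀ (a • φ) (a • φ) = 0
    rw [inner₀_smul_left, Γ.inner₀_eq_zero hφ, smul_zero]

/-- The form of `E₀` as a form over `𝒟`. -/
def innerD : Γ.E₀ →ₗ[Γ.domain] Γ.E₀ →ₗ[Γ.domain] LInf μ :=
  LinearMap.mk₂ Γ.domain (fun φ ψ => Γ.inner₀ φ ψ)
    (fun φ φ' ψ => by rw [map_add, LinearMap.add_apply])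
    (fun a φ ψ => Γ.inner₀_smul_left a φ ψ)
    (fun φ ψ ψ' => by rw [map_add])
    (fun a φ ψ => by rw [inner₀_symm, inner₀_smul_left, inner₀_symm])

/-- The induced form on `E₀ / I`. -/
def innerQ : (Γ.E₀ ⧸ Γ.nullSubmodule) →ₗ[Γ.domain] (Γ.E₀ ⧸ Γ.nullSubmodule) →ₗ[Γ.domain] LInf μ :=
  (Γ.nullSubmodule.liftQ
    (Γ.nullSubmodule.liftQ Γ.innerD (fun _ hφ => LinearMap.ext fun ψ =>
      Γ.inner₀_eq_zero hφ ψ)).flip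
    (fun ψ hψ => by
      refine LinearMap.ext fun q => ?_
      obtain ⟨φ, rfl⟩ := Γ.nullSubmodule.mkQ_surjective q
      change Γ.inner₀ φ ψ = 0
      rw [inner₀_symm]; exact Γ.inner₀_eq_zero hψ φ)).flip

/-- The sub-bimodule of `E₀` generated by the elements `f ⊗ 1 - 1 ⊗ f`. -/
def diagonalIdeal : Ideal Γ.E₀ :=
  Ideal.span (Set.range fun f : Γ.domain => f ⊗ₜ[ℝ] (1 : Γ.domain) - (1 : Γ.domain) ⊗ₜ[ℝ] f)

/-- `E₁`, the image in `E₀ / I` of the sub-bimodule generated by the `f ⊗ 1 - 1 ⊗ f`. -/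
def E₁ : Submodule Γ.domain (Γ.E₀ ⧸ Γ.nullSubmodule) :=
  (Γ.diagonalIdeal.restrictScalars Γ.domain).map Γ.nullSubmodule.mkQ

/-- The `L^∞(X)`-valued inner product of `E₁`. -/
def inner₁ (φ ψ : Γ.E₁) : LInf μ := Γ.innerQ φ ψ

theorem inner₁_mul_self_le (φ ψ : Γ.E₁) :
    Γ.inner₁ φ ψ * Γ.inner₁ φ ψ ≤ Γ.inner₁ φ φ * Γ.inner₁ ψ ψ := by
  obtain ⟨φ, -⟩ := φ
  obtain ⟨ψ, -⟩ := ψ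
  obtain ⟨φ, rfl⟩ := Γ.nullSubmodule.mkQ_surjective φ
  obtain ⟨ψ, rfl⟩ := Γ.nullSubmodule.mkQ_surjective ψ
  exact Γ.inner₀_mul_self_le φ ψ

theorem inner₁_self_nonneg (φ : Γ.E₁) : 0 ≤ Γ.inner₁ φ φ := by
  obtain ⟨φ, -⟩ := φ
  obtain ⟨φ, rfl⟩ := Γ.nullSubmodule.mkQ_surjective φ
  exact Γ.inner₀_self_nonneg φ

/-- `|F(φ)| ≤ C |φ|` almost everywhere for all `φ`, where `|φ| = ⟨φ, φ⟩ ^ (1/2)`. -/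
def IsBound (F : Γ.E₁ →ₗ[Γ.domain] LInf μ) (C : ℝ) : Prop :=
  ∀ φ : Γ.E₁, F φ * F φ ≤ C ^ 2 • Γ.inner₁ φ φ

theorem isBound_iff {F : Γ.E₁ →ₗ[Γ.domain] LInf μ} {C : ℝ} :
    Γ.IsBound F C ↔ ∀ φ, ∀ᵐ x ∂μ, F φ x * F φ x ≤ C ^ 2 * Γ.inner₁ φ φ x := by
  refine forall_congr' fun φ => ?_
  rw [LInf.le_iff]
  constructor <;> intro h <;>
  filter_upwards [h, LInf.coeFn_mul (F φ) (F φ), Lp.coeFn_smul (C ^ 2) (Γ.inner₁ φ φ)]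
    with x h1 h2 h3
  · rwa [h2, h3] at h1
  · rwa [h2, h3]

theorem IsBound.add {F G : Γ.E₁ →ₗ[Γ.domain] LInf μ} {C C' : ℝ} (hC : 0 ≤ C) (hC' : 0 ≤ C')
    (hF : Γ.IsBound F C) (hG : Γ.IsBound G C') : Γ.IsBound (F + G) (C + C') := by
  rw [isBound_iff] at *
  intro φ
  filter_upwards [hF φ, hG φ, Lp.coeFn_add (F φ) (G φ)] with x h1 h2 h3
  rw [LinearMap.add_apply, h3, Pi.add_apply]
  generalize F φ x = a at *
  generalize G φ x = b at *
  generalize Γ.inner₁ φ φ x = q at *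
  rcases le_or_gt 0 q with hq | hq
  · have e1 : |a| ≤ C * √q := by
      rw [← Real.sqrt_sq hC, ← Real.sqrt_mul (sq_nonneg C)]
      exact Real.abs_le_sqrt (by rw [sq]; exact h1)
    have e2 : |b| ≤ C' * √q := by
      rw [← Real.sqrt_sq hC', ← Real.sqrt_mul (sq_nonneg C')]
      exact Real.abs_le_sqrt (by rw [sq]; exact h2)
    have e3 : |a + b| ≤ (C + C') * √q := by
      rw [add_mul]; exact (abs_add_le a b).trans (add_le_add e1 e2)
    have e4 := mul_self_le_mul_self (abs_nonneg _) e3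
    rw [abs_mul_abs_self] at e4
    calc _ ≤ _ := e4
      _ = (C + C') ^ 2 * (√q * √q) := by ring
      _ = _ := by rw [Real.mul_self_sqrt hq]
  · have ha : C ^ 2 * q = 0 := le_antisymm
      (mul_nonpos_of_nonneg_of_nonpos (sq_nonneg C) hq.le) ((mul_self_nonneg a).trans h1)
    have hb : C' ^ 2 * q = 0 := le_antisymm
      (mul_nonpos_of_nonneg_of_nonpos (sq_nonneg C') hq.le) ((mul_self_nonneg b).trans h2)
    have hC0 : C = 0 := by simpa [hq.ne] using ha
    have hC0' : C' = 0 := by simpa [hq.ne] using hb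
    rw [ha] at h1
    rw [hb] at h2
    have ha' : a = 0 := mul_self_eq_zero.mp (le_antisymm h1 (mul_self_nonneg a))
    have hb' : b = 0 := mul_self_eq_zero.mp (le_antisymm h2 (mul_self_nonneg b))
    subst ha' hb' hC0 hC0'
    simp

theorem IsBound.smul {F : Γ.E₁ →ₗ[Γ.domain] LInf μ} {C : ℝ} (f : LInf μ)
    (hF : Γ.IsBound F C) : Γ.IsBound (f • F) (‖f‖ * C) := by
  rw [isBound_iff] at *
  intro φ
  filter_upwards [hF φ, LInf.coeFn_mul f (F φ), LInf.ae_norm_le f] with x h1 h2 h3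
  rw [LinearMap.smul_apply, smul_eq_mul, h2]
  have h4 : f x * f x ≤ ‖f‖ ^ 2 := by
    rw [← abs_mul_abs_self, sq]; exact mul_self_le_mul_self (abs_nonneg _) h3
  calc f x * F φ x * (f x * F φ x) = (f x * f x) * (F φ x * F φ x) := by ring
    _ ≤ ‖f‖ ^ 2 * (C ^ 2 * Γ.inner₁ φ φ x) :=
      mul_le_mul h4 h1 (mul_self_nonneg _) (sq_nonneg _)
    _ = _ := by ring

theorem IsBound.const_smul {F : Γ.E₁ →ₗ[Γ.domain] LInf μ} {C : ℝ} (c : ℝ)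
    (hF : Γ.IsBound F C) : Γ.IsBound (c • F) (|c| * C) := by
  rw [isBound_iff] at *
  intro φ
  filter_upwards [hF φ, Lp.coeFn_smul c (F φ)] with x h1 h2
  rw [LinearMap.smul_apply, h2, Pi.smul_apply, smul_eq_mul]
  calc c * F φ x * (c * F φ x) = c ^ 2 * (F φ x * F φ x) := by ring
    _ ≤ c ^ 2 * (C ^ 2 * Γ.inner₁ φ φ x) := mul_le_mul_of_nonneg_left h1 (sq_nonneg _)
    _ = (|c| * C) ^ 2 * Γ.inner₁ φ φ x := by rw [mul_pow, sq_abs]; ring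

/-- The bounded `𝒟`-module homomorphisms from `E₁` to `L^∞(X)`, as an `L^∞(X)`-module.
Boundedness refers to the `L^∞(X)`-valued norm of `E₁`: `|F(φ)| ≤ C |φ|` almost everywhere. Since
`E₁` is only a module over `𝒟`, this is what makes `E` the dual of the `L^∞(X)`-module spanned by
`E₁`, that is, the self-dual Hilbert module generated by `E₁`. -/
def selfDualSubmodule : Submodule (LInf μ) (Γ.E₁ →ₗ[Γ.domain] LInf μ) where
  carrier := {F | ∃ C : ℝ, 0 ≤ C ∧ Γ.IsBound F C}
  zero_mem' := ⟨0, le_rfl, fun φ => by simp⟩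
  add_mem' := by
    rintro F G ⟨C, h0, hC⟩ ⟨C', h0', hC'⟩
    exact ⟨C + C', add_nonneg h0 h0', hC.add Γ h0 h0' hC'⟩
  smul_mem' := by
    rintro f F ⟨C, h0, hC⟩
    exact ⟨‖f‖ * C, mul_nonneg (norm_nonneg _) h0, hC.smul Γ f⟩

/-- The module `E` of bounded `𝒟`-module homomorphisms from `E₁` to `L^∞(X)`. -/
def E : Type _ := Γ.selfDualSubmodule

namespace E

instance : AddCommGroup Γ.E := inferInstanceAs (AddCommGroup Γ.selfDualSubmodule)

instance : Module (LInf μ) Γ.E := inferInstanceAs (Module (LInf μ) Γ.selfDualSubmodule)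

instance : Module ℝ Γ.E := inferInstanceAs (Module ℝ Γ.selfDualSubmodule)

instance : CoeFun Γ.E (fun _ => Γ.E₁ → LInf μ) := ⟨fun Φ => Φ.1⟩

/-- The constants `C ≥ 0` with `|Φ(φ)| ≤ C |φ|` for all `φ`. -/
def bounds (Φ : Γ.E) : Set ℝ := {C | 0 ≤ C ∧ Γ.IsBound Φ.1 C}

/-- The norm of `Φ` is the least `C ≥ 0` such that `|Φ(φ)| ≤ C |φ|` for all `φ`. -/
instance : Norm Γ.E := ⟨fun Φ => sInf (bounds Γ Φ)⟩

theorem isClosed_bounds (Φ : Γ.E) : IsClosed (bounds Γ Φ) := by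
  refine isClosed_Ici.inter ?_
  have h : {C : ℝ | Γ.IsBound Φ.1 C} = ⋂ φ, {C : ℝ | Φ φ * Φ φ ≤ C ^ 2 • Γ.inner₁ φ φ} := by
    ext C; simp [IsBound]
  change IsClosed {C : ℝ | Γ.IsBound Φ.1 C}
  rw [h]
  exact isClosed_iInter fun φ => isClosed_le continuous_const
    ((continuous_id.pow 2).smul continuous_const)

theorem norm_mem (Φ : Γ.E) : ‖Φ‖ ∈ bounds Γ Φ :=
  (isClosed_bounds Γ Φ).csInf_mem Φ.2 ⟨0, fun _ h => h.1⟩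

theorem core : NormedSpace.Core ℝ Γ.E := by
  refine leastConst_core (bounds Γ) (fun _ => rfl) (fun _ _ h => h.1) (fun Φ => Φ.2)
    (isClosed_bounds Γ) ?_ ?_ ?_
  · rintro Φ Ψ C ⟨h0, hC⟩ C' ⟨h0', hC'⟩
    exact ⟨add_nonneg h0 h0', hC.add Γ h0 h0' hC'⟩
  · rintro c Φ C ⟨h0, hC⟩
    exact ⟨mul_nonneg (abs_nonneg _) h0, hC.const_smul Γ c⟩
  · rintro Φ ⟨-, h⟩
    apply Subtype.ext
    refine LinearMap.ext fun φ => ?_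
    rw [isBound_iff] at h
    apply Lp.ext
    filter_upwards [h φ, Lp.coeFn_zero ℝ ∞ μ] with x h1 h2
    change Φ.1 φ x = (0 : LInf μ) x
    rw [h2]
    rw [zero_pow two_ne_zero, zero_mul] at h1
    exact mul_self_eq_zero.mp (le_antisymm h1 (mul_self_nonneg _))

instance : NormedAddCommGroup Γ.E := NormedAddCommGroup.ofCore (core Γ)

instance : NormedSpace ℝ Γ.E := NormedSpace.ofCore (core Γ)

/-- The predual of `E`: the closed span of the functionals `Φ ↦ ∫ Φ(φ) h dμ` for `φ ∈ E₁` and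
`h ∈ L^1(X)`. -/
def predual : Submodule ℝ (StrongDual ℝ Γ.E) :=
  (Submodule.span ℝ {p : StrongDual ℝ Γ.E | ∃ (φ : Γ.E₁) (h : Lp ℝ 1 μ),
    ∀ Φ : Γ.E, p Φ = LInf.pairing (Φ φ) h}).topologicalClosure

end E

/-- The embedding of `E₁` in `E`, `φ ↦ (ψ ↦ ⟨ψ, φ⟩)`. -/
def embed (φ : Γ.E₁) : Γ.E :=
  ⟨(Γ.innerQ.flip φ).comp Γ.E₁.subtype, √‖Γ.inner₁ φ φ‖, Real.sqrt_nonneg _, by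
    rw [isBound_iff]
    intro ψ
    have h := Γ.inner₁_mul_self_le ψ φ
    rw [LInf.le_iff] at h
    rw [Real.sq_sqrt (norm_nonneg _)]
    have h0 : 0 ≤ Γ.inner₁ ψ ψ := Γ.inner₁_self_nonneg ψ
    rw [LInf.nonneg_iff] at h0
    filter_upwards [h, h0, LInf.coeFn_mul (Γ.inner₁ ψ φ) (Γ.inner₁ ψ φ),
      LInf.coeFn_mul (Γ.inner₁ ψ ψ) (Γ.inner₁ φ φ), LInf.ae_norm_le (Γ.inner₁ φ φ)]
      with x h1 h2 h3 h4 h5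
    rw [h3, h4, mul_comm (Γ.inner₁ ψ ψ x)] at h1
    exact h1.trans (mul_le_mul_of_nonneg_right ((le_abs_self _).trans h5) h2)⟩

/-- The element of `E₁` given by `1 ⊗ f - f ⊗ 1`. -/
def delta₁ (f : Γ.domain) : Γ.E₁ :=
  ⟨Γ.nullSubmodule.mkQ ((1 : Γ.domain) ⊗ₜ[ℝ] f - f ⊗ₜ[ℝ] (1 : Γ.domain)),
    Submodule.mem_map_of_mem (by
      have h : f ⊗ₜ[ℝ] (1 : Γ.domain) - (1 : Γ.domain) ⊗ₜ[ℝ] f ∈ Γ.diagonalIdeal :=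
        Ideal.subset_span ⟨f, rfl⟩
      have h' := Γ.diagonalIdeal.neg_mem h
      rw [neg_sub] at h'
      exact h')⟩

/-- The derivation `δ : 𝒟 → E`, `δ(f) = 1 ⊗ f - f ⊗ 1`. -/
def delta (f : Γ.domain) : Γ.E := Γ.embed (Γ.delta₁ f)

end DiffusionForm

end

end Weaver

open Weaver

namespace Weaver
noncomputable section

variable {X : Type*} [MeasurableSpace X] {μ : Measure X}

namespace LInf

/-! ### Elements of `L^∞` -/

/-! The metric half rests on the ball of all `f ∈ 𝒟` with `Γ(f, f) ≤ 1`. The Leibniz rule yields the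
chain rule `Γ(p(f), g) = p'(f) Γ(f, g)` for polynomials. Approximating the positive part by
polynomials with derivative in `[0, 1]`, and using that `Γ` is closed, one finds that the ball is a
weak*-closed lattice, hence stable under bounded countable suprema and infima (`sup_mem_unitBall`,
`exists_isLUB_mem_unitBall`). So whenever `r < ρ(A, B)` the ball contains a function which is `0` on
`A` and `r` on `B` (`exists_separator`), and the axioms of a measurable pseudometric follow.
Conversely, if `ρ_f ≤ ρ` for all pairs of sets, then `f` is recovered by countable lattice
operations from such separators, so it lies in the ball (`mem_unitBall_of_essDist_le`). Pairs with
`ρ(A, B) = 0`, invisible to `L(f)`, are controlled by the weak* density of `𝒟` (`le_metric_of_gap`).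
Hence `𝒟 = Lip(M)` and `L(f)^2 = ‖Γ(f, f)‖`.

The Hilbert module half starts from the square norm `sup_φ (2 Φ(φ) - ⟨φ, φ⟩)` on `E`, an essential
supremum in `L^∞`. Translating `φ` shows that it satisfies the parallelogram law and extends the
form of `E₁`; a Jordan–von Neumann argument over `L^∞` then gives the inner product
(`exists_bilinear_of_quadratic`). Since `⟨Φ - φ, Φ - φ⟩ = ⟨Φ, Φ⟩ - (2 Φ(φ) - ⟨φ, φ⟩)`, gluing
elements of `E₁` along measurable sets approximates each `Φ` pointwise (`exists_seq_span`).
Therefore bounded module maps are determined by their values on `E₁`, and `E` is self-dual. The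
duality of `L^1` and `L^∞`, applied at each `φ ∈ E₁`, identifies `E` with the dual of its predual.

The derivation joins the two halves: `⟨δ f, δ g⟩ = Γ(f, g)`, so `‖δ f‖ = L(f)`. Its weak* continuity
is the closedness of `Γ`, tested on generators of the predual. Finally `T Φ = ⟨δ ·, Φ⟩`, and
self-duality supplies `T^*`. -/

theorem exists_ae_eq {f : X → ℝ} (hf : AEStronglyMeasurable f μ) {C : ℝ}
    (h : ∀ᵐ x ∂μ, |f x| ≤ C) : ∃ u : LInf μ, ⇑u =ᵐ[μ] f :=
  ⟨(memLp_top_of_bound hf C h).toLp f, MemLp.coeFn_toLp _⟩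

theorem measurable (f : LInf μ) : Measurable f := (Lp.stronglyMeasurable f).measurable

/-- The indicator function of a measurable set. -/
def ind {A : Set X} (hA : MeasurableSet A) : LInf μ :=
  ((memLp_top_const (1 : ℝ)).indicator hA).toLp (A.indicator fun _ => 1)

theorem coeFn_ind {A : Set X} (hA : MeasurableSet A) :
    ⇑(ind hA : LInf μ) =ᵐ[μ] A.indicator fun _ => 1 := MemLp.coeFn_toLp _

theorem ae_ind {A : Set X} (hA : MeasurableSet A) :
    ∀ᵐ x ∂μ, (x ∈ A → (ind hA : LInf μ) x = 1) ∧ (x ∉ A → (ind hA : LInf μ) x = 0) := by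
  filter_upwards [coeFn_ind (μ := μ) hA] with x h
  rw [h]
  exact ⟨fun hx => indicator_of_mem hx _, fun hx => indicator_of_notMem hx _⟩

theorem ind_mul_self {A : Set X} (hA : MeasurableSet A) :
    (ind hA : LInf μ) * ind hA = ind hA := by
  apply Lp.ext
  filter_upwards [coeFn_mul (ind hA : LInf μ) (ind hA), coeFn_ind (μ := μ) hA] with x h1 h2
  rw [h1, h2]
  by_cases hx : x ∈ A <;> simp [hx]

theorem coeFn_sub (f g : LInf μ) : ⇑(f - g) =ᵐ[μ] fun x => f x - g x := Lp.coeFn_sub f g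

theorem coeFn_add (f g : LInf μ) : ⇑(f + g) =ᵐ[μ] fun x => f x + g x := Lp.coeFn_add f g

theorem coeFn_neg (f : LInf μ) : ⇑(-f) =ᵐ[μ] fun x => -f x := Lp.coeFn_neg f

theorem coeFn_smul (c : ℝ) (f : LInf μ) : ⇑(c • f) =ᵐ[μ] fun x => c * f x := Lp.coeFn_smul c f

theorem coeFn_sup (f g : LInf μ) : ⇑(f ⊔ g) =ᵐ[μ] fun x => max (f x) (g x) := Lp.coeFn_sup f g

theorem coeFn_inf (f g : LInf μ) : ⇑(f ⊓ g) =ᵐ[μ] fun x => min (f x) (g x) := Lp.coeFn_inf f g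

theorem coeFn_algebraMap (c : ℝ) : ⇑(algebraMap ℝ (LInf μ) c) =ᵐ[μ] fun _ => c := by
  rw [Algebra.algebraMap_eq_smul_one]
  filter_upwards [coeFn_smul c (1 : LInf μ), coeFn_one (μ := μ)] with x h1 h2
  rw [h1, h2, mul_one]

theorem norm_le_iff {f : LInf μ} {C : ℝ} (hC : 0 ≤ C) : ‖f‖ ≤ C ↔ ∀ᵐ x ∂μ, |f x| ≤ C :=
  ⟨fun h => by filter_upwards [ae_norm_le f] with x hx; exact hx.trans h, norm_le_of_ae hC⟩

theorem mul_self_nonneg' (f : LInf μ) : 0 ≤ f * f := by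
  rw [nonneg_iff]
  filter_upwards [coeFn_mul f f] with x h
  rw [h]; exact mul_self_nonneg _

theorem exists_sqrt {f : LInf μ} (hf : 0 ≤ f) : ∃ r : LInf μ, 0 ≤ r ∧ r * r = f := by
  rw [nonneg_iff] at hf
  obtain ⟨r, hr⟩ := exists_ae_eq (μ := μ) (f := fun x => √(f x)) (C := √‖f‖)
    f.measurable.sqrt.aestronglyMeasurable (by
      filter_upwards [ae_norm_le f] with x hx
      rw [abs_of_nonneg (Real.sqrt_nonneg _)]
      exact Real.sqrt_le_sqrt ((le_abs_self _).trans hx))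
  refine ⟨r, ?_, ?_⟩
  · rw [nonneg_iff]
    filter_upwards [hr] with x hx
    rw [hx]; exact Real.sqrt_nonneg _
  · apply Lp.ext
    filter_upwards [hr, hf, coeFn_mul r r] with x h1 h2 h3
    rw [h3, h1, Real.mul_self_sqrt h2]

/-- The discriminant inequality for `L^∞`-valued quadratic polynomials. -/
theorem mul_self_le_of_quadratic {a b c : LInf μ}
    (h : ∀ q : ℚ, 0 ≤ ((q : ℝ) * q) • a + ((2 * q : ℝ) • b + c)) : b * b ≤ a * c := by
  have hq : ∀ q : ℚ, ∀ᵐ x ∂μ, 0 ≤ a x * ((q : ℝ) * q) + 2 * b x * q + c x := by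
    intro q
    have h' := h q
    rw [nonneg_iff] at h'
    filter_upwards [h', coeFn_add (((q : ℝ) * q) • a) ((2 * q : ℝ) • b + c),
      coeFn_add ((2 * q : ℝ) • b) c, coeFn_smul ((q : ℝ) * q) a, coeFn_smul (2 * q : ℝ) b]
      with x h1 h2 h3 h4 h5
    rw [h2, h3, h4, h5] at h1
    linarith
  rw [le_iff]
  filter_upwards [ae_all_iff.mpr hq, coeFn_mul b b, coeFn_mul a c] with x hx h1 h2
  rw [h1, h2]
  have key : ∀ t : ℝ, 0 ≤ a x * (t * t) + 2 * b x * t + c x := by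
    intro t
    refine Rat.denseRange_cast.induction_on (p := fun t : ℝ => 0 ≤ a x * (t * t)
      + 2 * b x * t + c x) t ?_ hx
    exact isClosed_le continuous_const (by fun_prop)
  have := discrim_le_zero key
  rw [discrim] at this
  nlinarith

/-! ### Weights -/

theorem exists_pos_integrable (μ : Measure X) [SigmaFinite μ] :
    ∃ w : X → ℝ, (∀ x, 0 < w x) ∧ Measurable w ∧ Integrable w μ := by
  obtain ⟨g, hg, hm, hi⟩ := exists_pos_lintegral_lt_of_sigmaFinite μ (ε := 1) one_ne_zero
  refine ⟨fun x => g x, fun x => hg x, hm.coe_nnreal_real, ?_⟩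
  refine ⟨hm.coe_nnreal_real.aestronglyMeasurable, ?_⟩
  rw [HasFiniteIntegral]
  simpa using hi.trans ENNReal.one_lt_top

/-- A function in `L^2` which is positive almost everywhere. -/
theorem exists_pos_L2 (μ : Measure X) [SigmaFinite μ] :
    ∃ w : Lp ℝ 2 μ, ∀ᵐ x ∂μ, 0 < w x := by
  obtain ⟨g, hg, hm, hi⟩ := exists_pos_integrable μ
  have h2 : MemLp (fun x => √(g x)) 2 μ := by
    rw [memLp_two_iff_integrable_sq hm.sqrt.aestronglyMeasurable]
    refine hi.congr (Eventually.of_forall fun x => ?_)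
    exact (Real.sq_sqrt (hg x).le).symm
  refine ⟨h2.toLp _, ?_⟩
  filter_upwards [h2.coeFn_toLp] with x hx
  rw [hx]; exact Real.sqrt_pos.mpr (hg x)

/-! ### The pairing with `L^1` -/

theorem pairing_sub (f g : LInf μ) (h : Lp ℝ 1 μ) :
    pairing (f - g) h = pairing f h - pairing g h := by
  have := pairing_add (f - g) g h
  rw [sub_add_cancel] at this
  linarith

theorem pairing_neg (f : LInf μ) (h : Lp ℝ 1 μ) : pairing (-f) h = -pairing f h := by
  have := pairing_smul (-1) f h
  rw [neg_one_smul] at this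
  rw [this]; ring

/-- The pairing as a bilinear map. -/
def pairingL (μ : Measure X) : Lp ℝ 1 μ →ₗ[ℝ] LInf μ →ₗ[ℝ] ℝ :=
  LinearMap.mk₂ ℝ (fun h f => pairing f h)
    (fun h k f => by
      unfold pairing
      rw [← integral_add (integrable_pairing f h) (integrable_pairing f k)]
      apply integral_congr_ae
      filter_upwards [Lp.coeFn_add h k] with x hx
      rw [hx, Pi.add_apply, mul_add])
    (fun c h f => by
      unfold pairing
      rw [smul_eq_mul, ← integral_const_mul]
      apply integral_congr_ae
      filter_upwards [Lp.coeFn_smul c h] with x hx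
      rw [hx, Pi.smul_apply, smul_eq_mul]; ring)
    (fun h f g => pairing_add f g h)
    (fun c h f => pairing_smul c f h)

theorem pairingL_apply (h : Lp ℝ 1 μ) (f : LInf μ) : pairingL μ h f = pairing f h := rfl

theorem tendsto_weakStar {ι : Type*} {l : Filter ι} {u : ι → LInf μ} {f : LInf μ} :
    Tendsto u l (@nhds _ (weakStar μ) f) ↔
      ∀ h : Lp ℝ 1 μ, Tendsto (fun i => pairing (u i) h) l (𝓝 (pairing f h)) := by
  rw [nhds_induced, tendsto_comap_iff, tendsto_pi_nhds]
  rfl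

theorem tendsto_weakStar_of_ae {u : ℕ → LInf μ} {f : LInf μ} {C : ℝ} (hu : ∀ n, ‖u n‖ ≤ C)
    (h : ∀ᵐ x ∂μ, Tendsto (fun n => u n x) atTop (𝓝 (f x))) :
    Tendsto u atTop (@nhds _ (weakStar μ) f) := by
  rw [tendsto_weakStar]
  intro k
  refine tendsto_integral_of_dominated_convergence (fun x => C * |k x|)
    (fun n => (integrable_pairing (u n) k).aestronglyMeasurable)
    ((L1.integrable_coeFn k).norm.const_mul _) (fun n => ?_) ?_
  · filter_upwards [ae_norm_le (u n)] with x hx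
    rw [Real.norm_eq_abs, abs_mul]
    exact mul_le_mul_of_nonneg_right (hx.trans (hu n)) (abs_nonneg _)
  · filter_upwards [h] with x hx
    exact hx.mul_const _

theorem pairing_mono {f g : LInf μ} (h : f ≤ g) {k : Lp ℝ 1 μ} (hk : ∀ᵐ x ∂μ, 0 ≤ k x) :
    pairing f k ≤ pairing g k := by
  rw [le_iff] at h
  refine integral_mono_ae (integrable_pairing f k) (integrable_pairing g k) ?_
  filter_upwards [h, hk] with x h1 h2
  exact mul_le_mul_of_nonneg_right h1 h2

/-- Test against a strictly positive integrable weight cut down to `{g < f}`: the integrand is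
nonnegative with nonpositive integral, so that set is null. -/
theorem le_of_pairing_le [SigmaFinite μ] {f g : LInf μ}
    (h : ∀ k : Lp ℝ 1 μ, (∀ᵐ x ∂μ, 0 ≤ k x) → pairing f k ≤ pairing g k) : f ≤ g := by
  obtain ⟨w, hw, hm, hi⟩ := exists_pos_integrable μ
  have hA : MeasurableSet {x | g x < f x} := measurableSet_lt g.measurable f.measurable
  have hk := (memLp_one_iff_integrable.mpr hi).indicator hA
  set k := hk.toLp _ with hkdef
  have e : ⇑k =ᵐ[μ] _ := hk.coeFn_toLp
  have h1 := h k (by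
    filter_upwards [e] with x hx
    rw [hx]
    exact indicator_nonneg (fun x _ => (hw x).le) x)
  have h2 : pairing (f - g) k ≤ 0 := by rw [pairing_sub]; linarith
  have h3 : 0 ≤ᵐ[μ] fun x => (f - g : LInf μ) x * k x := by
    filter_upwards [e, coeFn_sub f g] with x hx h4
    rw [hx, h4]
    by_cases hxA : x ∈ {x | g x < f x}
    · rw [indicator_of_mem hxA]
      exact mul_nonneg (sub_nonneg.mpr (le_of_lt hxA)) (hw x).le
    · rw [indicator_of_notMem hxA, mul_zero]; rfl
  have h4 := (integral_eq_zero_iff_of_nonneg_ae h3 (integrable_pairing _ k)).mp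
    (le_antisymm h2 (integral_nonneg_of_ae h3))
  rw [le_iff]
  filter_upwards [h4, e, coeFn_sub f g] with x h5 h6 h7
  by_contra! hlt
  rw [h6, h7, indicator_of_mem (show x ∈ {x | g x < f x} from hlt)] at h5
  exact (mul_pos (sub_pos.mpr hlt) (hw x)).ne' h5

theorem eq_of_pairing_eq [SigmaFinite μ] {f g : LInf μ}
    (h : ∀ k : Lp ℝ 1 μ, pairing f k = pairing g k) : f = g :=
  le_antisymm (le_of_pairing_le fun k _ => (h k).le) (le_of_pairing_le fun k _ => (h k).ge)

/-- Order intervals of `L^∞` are weak*-closed, being cut out by pairings with nonnegative elements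
of `L^1`. -/
theorem le_of_tendsto_weakStar [SigmaFinite μ] {ι : Type*} {l : Filter ι} [l.NeBot]
    {u : ι → LInf μ} {f g : LInf μ} (hu : Tendsto u l (@nhds _ (weakStar μ) f))
    (h : ∀ᶠ i in l, u i ≤ g) : f ≤ g := by
  rw [tendsto_weakStar] at hu
  exact le_of_pairing_le fun k hk =>
    le_of_tendsto (hu k) (h.mono fun i hi => pairing_mono hi hk)

theorem norm_le_iff_le {f : LInf μ} (hf : 0 ≤ f) {C : ℝ} (hC : 0 ≤ C) :
    ‖f‖ ≤ C ↔ f ≤ algebraMap ℝ (LInf μ) C := by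
  rw [norm_le_iff hC, le_iff]
  rw [nonneg_iff] at hf
  constructor <;> intro h <;> filter_upwards [h, hf, coeFn_algebraMap (μ := μ) C] with x h1 h2 h3
  · rw [h3]; exact (le_abs_self _).trans h1
  · rw [abs_of_nonneg h2, ← h3]; exact h1

end LInf

end

end Weaver

namespace Weaver
noncomputable section

variable {X : Type*} [MeasurableSpace X] {μ : Measure X}

/-! ### Polynomial approximation of the positive part -/

theorem exists_polynomial_derivative_eq (r : Polynomial ℝ) :
    ∃ p : Polynomial ℝ, p.derivative = r ∧ p.eval 0 = 0 := by
  induction r using Polynomial.induction_on' with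
  | add p q hp hq =>
    obtain ⟨a, ha, ha'⟩ := hp
    obtain ⟨b, hb, hb'⟩ := hq
    exact ⟨a + b, by rw [Polynomial.derivative_add, ha, hb], by
      rw [Polynomial.eval_add, ha', hb', add_zero]⟩
  | monomial n a =>
    refine ⟨Polynomial.monomial (n + 1) (a / (n + 1)), ?_, by simp⟩
    rw [Polynomial.derivative_monomial]
    congr 1
    push_cast
    rw [div_mul_cancel₀ a (by positivity)]

/-- Integrate a polynomial approximation of a steep ramp. The derivative bounds `0 ≤ p' ≤ 1` are
what makes the chain rule produce convex combinations later. -/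
theorem exists_polynomial_near_posPart (M : ℝ) (hM : 0 < M) (ε : ℝ) (hε : 0 < ε) :
    ∃ p : Polynomial ℝ, ∀ t ∈ Icc (-M) M,
      |p.eval t - max t 0| ≤ ε ∧ 0 ≤ p.derivative.eval t ∧ p.derivative.eval t ≤ 1 := by
  -- `η` bounds the loss on the ramp interval `[0, η]`, and `2 * η * M` bounds the error accumulated
  -- on the rest of either half of the interval.
  obtain ⟨η, hη, hη2, hηε⟩ : ∃ η : ℝ, 0 < η ∧ η ≤ 1 / 2 ∧ η + 2 * η * M ≤ ε := by
    refine ⟨min (1 / 2) (ε / (1 + 2 * M)), by positivity, min_le_left _ _, ?_⟩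
    have : min (1 / 2) (ε / (1 + 2 * M)) ≤ ε / (1 + 2 * M) := min_le_right _ _
    rw [le_div_iff₀ (by positivity)] at this
    linarith
  -- A ramp from `0` to `1` squeezed into `[η, 1 - η]`, so that a polynomial within `η` of it still
  -- takes values in `[0, 1]`.
  let φ : ℝ → ℝ := fun t => η + (1 - 2 * η) * max 0 (min 1 (t / η))
  have hφ : Continuous φ := by fun_prop
  obtain ⟨r, hr⟩ := exists_polynomial_near_of_continuousOn (-M) M φ hφ.continuousOn η hη
  obtain ⟨p, hp, hp0⟩ := exists_polynomial_derivative_eq r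
  have hφ1 : ∀ t, η ≤ φ t ∧ φ t ≤ 1 - η := fun t => by
    have h1 : 0 ≤ max 0 (min 1 (t / η)) := le_max_left _ _
    have h2 : max 0 (min 1 (t / η)) ≤ 1 := max_le zero_le_one (min_le_left _ _)
    have h3 : 0 ≤ 1 - 2 * η := by linarith
    constructor
    · have := mul_nonneg h3 h1
      change η ≤ η + _; linarith
    · have := mul_le_mul_of_nonneg_left h2 h3
      change η + _ ≤ 1 - η; linarith
  have hr01 : ∀ t ∈ Icc (-M) M, 0 ≤ r.eval t ∧ r.eval t ≤ 1 := fun t ht => by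
    have := abs_lt.mp (hr t ht)
    constructor <;> linarith [hφ1 t, this.1, this.2, (hφ1 t).1, (hφ1 t).2]
  have hrneg : ∀ t ∈ Icc (-M) 0, r.eval t ≤ 2 * η := fun t ht => by
    have h1 := abs_lt.mp (hr t ⟨ht.1, ht.2.trans hM.le⟩)
    have h2 : φ t = η := by
      change η + (1 - 2 * η) * max 0 (min 1 (t / η)) = η
      rw [max_eq_left ((min_le_right _ _).trans (div_nonpos_of_nonpos_of_nonneg ht.2 hη.le))]
      ring
    linarith [h1.2]
  have hrpos : ∀ t ∈ Icc η M, 1 - 2 * η ≤ r.eval t := fun t ht => by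
    have h1 := abs_lt.mp (hr t ⟨by linarith [ht.1], ht.2⟩)
    have h2 : φ t = 1 - η := by
      change η + (1 - 2 * η) * max 0 (min 1 (t / η)) = 1 - η
      rw [min_eq_left ((one_le_div hη).mpr ht.1), max_eq_right zero_le_one]
      ring
    linarith [h1.1]
  have hd : ∀ t, deriv (fun x => p.eval x) t = r.eval t := fun t => by
    rw [Polynomial.deriv, hp]
  have lower : ∀ a b C : ℝ, a ≤ b → (∀ t ∈ Icc a b, C ≤ r.eval t) →
      C * (b - a) ≤ p.eval b - p.eval a := fun a b C hab h =>
    (convex_Icc a b).mul_sub_le_image_sub_of_le_deriv p.continuous.continuousOn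
      p.differentiable.differentiableOn
      (fun t ht => by rw [hd]; exact h t (interior_subset ht)) a (left_mem_Icc.mpr hab) b
      (right_mem_Icc.mpr hab) hab
  have upper : ∀ a b C : ℝ, a ≤ b → (∀ t ∈ Icc a b, r.eval t ≤ C) →
      p.eval b - p.eval a ≤ C * (b - a) := fun a b C hab h =>
    (convex_Icc a b).image_sub_le_mul_sub_of_deriv_le p.continuous.continuousOn
      p.differentiable.differentiableOn
      (fun t ht => by rw [hd]; exact h t (interior_subset ht)) a (left_mem_Icc.mpr hab) b
      (right_mem_Icc.mpr hab) hab
  refine ⟨p, fun t ht => ⟨?_, by rw [hp]; exact (hr01 t ht).1, by rw [hp]; exact (hr01 t ht).2⟩⟩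
  rw [abs_le]
  have hηM : 0 < η * M := by positivity
  rcases le_total t 0 with h0 | h0
  · rw [max_eq_right h0]
    have h1 := lower t 0 0 h0 fun s hs => (hr01 s ⟨ht.1.trans hs.1, hs.2.trans hM.le⟩).1
    have h2 := upper t 0 (2 * η) h0 fun s hs => hrneg s ⟨ht.1.trans hs.1, hs.2⟩
    have h3 : 2 * η * (0 - t) ≤ 2 * η * M :=
      mul_le_mul_of_nonneg_left (by linarith [ht.1]) (by linarith)
    constructor <;> linarith
  · rw [max_eq_left h0]
    have h1 := upper 0 t 1 h0 fun s hs => (hr01 s ⟨by linarith [hs.1], hs.2.trans ht.2⟩).2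
    refine ⟨?_, by linarith⟩
    rcases le_total t η with h2 | h2
    · have h3 := lower 0 t 0 h0 fun s hs => (hr01 s ⟨by linarith [hs.1], hs.2.trans ht.2⟩).1
      linarith
    · have h3 := lower 0 η 0 hη.le fun s hs =>
        (hr01 s ⟨by linarith [hs.1], hs.2.trans (h2.trans ht.2)⟩).1
      have h4 := lower η t (1 - 2 * η) h2 fun s hs => hrpos s ⟨hs.1, hs.2.trans ht.2⟩
      have h5 : η * t ≤ η * M := mul_le_mul_of_nonneg_left ht.2 hη.le
      have h6 := mul_pos hη hη
      nlinarith

namespace LInf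

theorem coeFn_aeval (f : LInf μ) (p : Polynomial ℝ) :
    ⇑(Polynomial.aeval f p) =ᵐ[μ] fun x => p.eval (f x) := by
  induction p using Polynomial.induction_on with
  | C a =>
    rw [Polynomial.aeval_C]
    filter_upwards [coeFn_algebraMap (μ := μ) a] with x hx
    rw [hx, Polynomial.eval_C]
  | add p q hp hq =>
    rw [map_add]
    filter_upwards [hp, hq, coeFn_add (Polynomial.aeval f p) (Polynomial.aeval f q)]
      with x h1 h2 h3
    rw [h3, h1, h2, Polynomial.eval_add]
  | monomial n a h =>
    rw [pow_succ, ← mul_assoc, map_mul, Polynomial.aeval_X]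
    filter_upwards [h, coeFn_mul (Polynomial.aeval f (Polynomial.C a * Polynomial.X ^ n)) f]
      with x h1 h2
    rw [h2, h1, Polynomial.eval_mul_X]

theorem mul_nonneg' {f g : LInf μ} (hf : 0 ≤ f) (hg : 0 ≤ g) : 0 ≤ f * g := by
  rw [nonneg_iff] at *
  filter_upwards [hf, hg, coeFn_mul f g] with x h1 h2 h3
  rw [h3]; exact mul_nonneg h1 h2

theorem smul_nonneg' {c : ℝ} (hc : 0 ≤ c) {f : LInf μ} (hf : 0 ≤ f) : 0 ≤ c • f := by
  rw [nonneg_iff] at *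
  filter_upwards [hf, coeFn_smul c f] with x h1 h2
  rw [h2]; exact mul_nonneg hc h1

end LInf

/-! ### The chain rule for `Γ` and the lattice structure of its unit ball -/

namespace DiffusionForm

variable (Γ : DiffusionForm μ)

theorem form_one_left (g : Γ.domain) : Γ.form 1 g = 0 := by
  have h := Γ.leibniz 1 1 g
  rw [mul_one, OneMemClass.coe_one, one_mul] at h
  exact left_eq_add.mp h

theorem form_one_right (g : Γ.domain) : Γ.form g 1 = 0 := by
  rw [Γ.symm, form_one_left]

theorem form_algebraMap_left (c : ℝ) (g : Γ.domain) : Γ.form (algebraMap ℝ _ c) g = 0 := by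
  rw [Algebra.algebraMap_eq_smul_one, map_smul, LinearMap.smul_apply, form_one_left, smul_zero]

/-- The map `f ↦ Γ(f, g)` as a derivation. -/
def formDerivation (g : Γ.domain) : Derivation ℝ Γ.domain (LInf μ) :=
  Derivation.mk' (Γ.form.flip g) fun a b => Γ.leibniz a b g

theorem form_aeval_left (f g : Γ.domain) (p : Polynomial ℝ) :
    Γ.form (Polynomial.aeval f p) g = Polynomial.aeval (f : LInf μ) p.derivative * Γ.form f g := by
  have h := (Γ.formDerivation g).map_aeval p f
  rw [Subalgebra.smul_def, Polynomial.aeval_subalgebra_coe] at h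
  exact h

theorem form_add_self (f g : Γ.domain) :
    Γ.form (f + g) (f + g) = Γ.form f f + 2 * Γ.form f g + Γ.form g g := by
  simp only [map_add, LinearMap.add_apply]
  rw [Γ.symm g f]; ring

theorem form_sub_self (f g : Γ.domain) :
    Γ.form (f - g) (f - g) = Γ.form f f - 2 * Γ.form f g + Γ.form g g := by
  simp only [map_sub, LinearMap.sub_apply]
  rw [Γ.symm g f]; ring

theorem form_smul_self (c : ℝ) (f : Γ.domain) :
    Γ.form (c • f) (c • f) = c ^ 2 • Γ.form f f := by
  rw [map_smul, map_smul, LinearMap.smul_apply, smul_smul, sq]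

/-- The functions `f ∈ 𝒟` with `Γ(f, f) ≤ 1`. -/
def unitBall : Set (LInf μ) := {f | ∃ hf : f ∈ Γ.domain, Γ.form ⟨f, hf⟩ ⟨f, hf⟩ ≤ 1}

variable {Γ}

theorem coe_mem_unitBall {f : Γ.domain} : (f : LInf μ) ∈ Γ.unitBall ↔ Γ.form f f ≤ 1 :=
  ⟨fun h => h.2, fun h => ⟨f.2, h⟩⟩

theorem coe_mem_unitBall_iff_norm {f : Γ.domain} :
    (f : LInf μ) ∈ Γ.unitBall ↔ ‖Γ.form f f‖ ≤ 1 := by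
  rw [coe_mem_unitBall, LInf.norm_le_iff_le (Γ.nonneg f) zero_le_one, map_one]

theorem algebraMap_mem_unitBall (c : ℝ) : algebraMap ℝ (LInf μ) c ∈ Γ.unitBall := by
  refine coe_mem_unitBall (f := algebraMap ℝ Γ.domain c).mpr ?_
  rw [form_algebraMap_left]
  exact LInf.nonneg_iff.mpr (by
    filter_upwards [LInf.coeFn_one (μ := μ)] with x hx
    rw [hx]; exact zero_le_one)

theorem neg_mem_unitBall {f : LInf μ} (hf : f ∈ Γ.unitBall) : -f ∈ Γ.unitBall := by
  obtain ⟨h, h1⟩ := hf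
  refine coe_mem_unitBall (f := -⟨f, h⟩).mpr ?_
  rwa [map_neg, map_neg, LinearMap.neg_apply, neg_neg]

theorem add_algebraMap_mem_unitBall {f : LInf μ} (hf : f ∈ Γ.unitBall) (c : ℝ) :
    f + algebraMap ℝ (LInf μ) c ∈ Γ.unitBall := by
  obtain ⟨h, h1⟩ := hf
  refine coe_mem_unitBall (f := ⟨f, h⟩ + algebraMap ℝ Γ.domain c).mpr ?_
  rwa [form_add_self, Γ.symm _ (algebraMap ℝ Γ.domain c), form_algebraMap_left,
    form_algebraMap_left, mul_zero, add_zero, add_zero]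

/-- Closedness only controls `Γ(u, f)` in the limit, not `Γ(u, u)`. The inequality `2 Γ(u, f) ≤ Γ(u,
u) + Γ(f, f)` closes this gap. -/
theorem mem_unitBall_of_tendsto [SigmaFinite μ] {ι : Type*} {l : Filter ι} [l.NeBot]
    {u : ι → LInf μ} {f : LInf μ} (hu : ∀ᶠ i in l, u i ∈ Γ.unitBall)
    (h : Tendsto u l (@nhds _ (weakStar μ) f)) : f ∈ Γ.unitBall := by
  classical
  let v : ι → Γ.domain := fun i => if hi : u i ∈ Γ.domain then ⟨u i, hi⟩ else 0
  have hv : ∀ᶠ i in l, (v i : LInf μ) = u i := hu.mono fun i hi => by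
    change ((if hi : u i ∈ Γ.domain then (⟨u i, hi⟩ : Γ.domain) else 0 : Γ.domain) : LInf μ) = u i
    rw [dif_pos hi.1]
  have hv1 : ∀ᶠ i in l, Γ.form (v i) (v i) ≤ 1 := by
    filter_upwards [hu, hv] with i h1 h2
    rwa [← h2, coe_mem_unitBall] at h1
  obtain ⟨hf, hlim⟩ := Γ.closed (l.map v) 1 f
    (eventually_map.mpr (hv1.mono fun i hi => by
      rwa [← coe_mem_unitBall_iff_norm, coe_mem_unitBall]))
    (tendsto_map'_iff.mpr (h.congr' (hv.mono fun i hi => hi.symm)))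
  refine ⟨hf, ?_⟩
  have h1 := hlim ⟨f, hf⟩
  rw [tendsto_map'_iff] at h1
  -- The bound `Γ(u, f) ≤ (1 + Γ(f, f)) / 2` survives the limit, and `Γ(f, f) ≤ (1 + Γ(f, f)) / 2`
  -- means `Γ(f, f) ≤ 1`.
  have h2 : Γ.form ⟨f, hf⟩ ⟨f, hf⟩ ≤ (1 / 2 : ℝ) • (1 + Γ.form ⟨f, hf⟩ ⟨f, hf⟩) := by
    refine LInf.le_of_tendsto_weakStar h1 (hv1.mono fun i hi => ?_)
    have h3 := LInf.smul_nonneg' (c := 1 / 2) (by norm_num) (Γ.nonneg (v i - ⟨f, hf⟩))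
    have h4 := LInf.smul_nonneg' (c := 1 / 2) (by norm_num) (sub_nonneg.mpr hi)
    rw [form_sub_self] at h3
    rw [← sub_nonneg]
    refine (add_nonneg h3 h4).trans_eq ?_
    simp only [Function.comp_apply, two_mul]
    module
  have h3 := add_le_add h2 h2
  rw [← sub_nonneg] at h3 ⊢
  refine h3.trans_eq ?_
  module

/-- Write `f ⊔ g = g + (f - g)⁺` and replace the positive part by `p(f - g)`. By the chain rule
`Γ(w, ·)` is the pointwise convex combination `(1 - r) Γ(g, ·) + r Γ(f, ·)` with `r = p'(f - g)`, so
the approximants stay in the ball, which is weak*-closed. -/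
theorem sup_mem_unitBall [SigmaFinite μ] {f g : LInf μ} (hf : f ∈ Γ.unitBall)
    (hg : g ∈ Γ.unitBall) : f ⊔ g ∈ Γ.unitBall := by
  obtain ⟨hf, hf1⟩ := hf
  obtain ⟨hg, hg1⟩ := hg
  lift f to Γ.domain using hf
  lift g to Γ.domain using hg
  have hM : 0 < ‖(f - g : LInf μ)‖ + 1 := by positivity
  choose p hp using fun n : ℕ => exists_polynomial_near_posPart _ hM (1 / (n + 1 : ℝ))
    (by positivity)
  have hIcc : ∀ᵐ x ∂μ, (f - g : LInf μ) x ∈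
      Icc (-(‖(f - g : LInf μ)‖ + 1)) (‖(f - g : LInf μ)‖ + 1) := by
    filter_upwards [LInf.ae_norm_le (f - g : LInf μ)] with x hx
    exact abs_le.mp (hx.trans (by linarith))
  let w : ℕ → Γ.domain := fun n => g + Polynomial.aeval (f - g) (p n)
  have hw : ∀ n, (w n : LInf μ) ∈ Γ.unitBall := fun n => by
    rw [coe_mem_unitBall]
    set r : LInf μ := Polynomial.aeval (f - g : LInf μ) (p n).derivative with hr
    have e : ∀ k, Γ.form (w n) k = Γ.form g k + r * (Γ.form f k - Γ.form g k) := fun k => by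
      change Γ.form (g + Polynomial.aeval (f - g) (p n)) k = _
      rw [map_add, LinearMap.add_apply, form_aeval_left, map_sub, LinearMap.sub_apply]
      rfl
    have hr0 : 0 ≤ r := by
      rw [LInf.nonneg_iff]
      filter_upwards [hIcc, LInf.coeFn_aeval (f - g : LInf μ) (p n).derivative] with x h1 h2
      rw [hr, h2]; exact (hp n _ h1).2.1
    have hr1 : 0 ≤ 1 - r := by
      rw [LInf.nonneg_iff]
      filter_upwards [hIcc, LInf.coeFn_aeval (f - g : LInf μ) (p n).derivative,
        LInf.coeFn_sub 1 r, LInf.coeFn_one (μ := μ)] with x h1 h2 h3 h4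
      rw [h3, h4, hr, h2]; exact sub_nonneg.mpr (hp n _ h1).2.2
    -- Convexity of the quadratic form made explicit: each summand on the right is a product of
    -- nonnegative factors.
    have e2 : 1 - Γ.form (w n) (w n) = (1 - r) * (1 - r) * (1 - Γ.form g g)
        + r * r * (1 - Γ.form f f)
        + r * (1 - r) * ((1 - Γ.form f f) + (1 - Γ.form g g) + Γ.form (f - g) (f - g)) := by
      rw [e, Γ.symm g (w n), Γ.symm f (w n), e, e, form_sub_self, Γ.symm g f]
      ring
    rw [← sub_nonneg, e2]
    have hf2 := sub_nonneg.mpr hf1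
    have hg2 := sub_nonneg.mpr hg1
    exact add_nonneg (add_nonneg (LInf.mul_nonneg' (LInf.mul_nonneg' hr1 hr1) hg2)
      (LInf.mul_nonneg' (LInf.mul_nonneg' hr0 hr0) hf2)) (LInf.mul_nonneg'
        (LInf.mul_nonneg' hr0 hr1) (add_nonneg (add_nonneg hf2 hg2) (Γ.nonneg _)))
  have hwx : ∀ᵐ x ∂μ, ∀ n, |(w n : LInf μ) x - (f ⊔ g : LInf μ) x| ≤ 1 / (n + 1 : ℝ) := by
    rw [ae_all_iff]
    intro n
    have e : (w n : LInf μ) = g + Polynomial.aeval (f - g : LInf μ) (p n) := by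
      change (g : LInf μ) + (Polynomial.aeval (f - g) (p n) : Γ.domain)
        = g + Polynomial.aeval ((f - g : Γ.domain) : LInf μ) (p n)
      rw [← Polynomial.aeval_subalgebra_coe]
    rw [e]
    filter_upwards [hIcc, LInf.coeFn_aeval (f - g : LInf μ) (p n),
      LInf.coeFn_add (g : LInf μ) (Polynomial.aeval (f - g : LInf μ) (p n)),
      LInf.coeFn_sub (f : LInf μ) g, LInf.coeFn_sup (f : LInf μ) g] with x h1 h2 h3 h4 h5
    have h6 := (hp n _ h1).1
    rw [h3, h2, h5]
    rw [h4] at h6 ⊢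
    convert h6 using 2
    have : max ((f : LInf μ) x - (g : LInf μ) x) 0
        = max ((f : LInf μ) x) ((g : LInf μ) x) - (g : LInf μ) x := by
      rw [← max_sub_sub_right, sub_self]
    rw [this]; ring
  refine mem_unitBall_of_tendsto (u := fun n => (w n : LInf μ)) (l := atTop)
    (Eventually.of_forall hw) (LInf.tendsto_weakStar_of_ae (C := 1 + ‖(f ⊔ g : LInf μ)‖) ?_ ?_)
  · intro n
    refine LInf.norm_le_of_ae (by positivity) ?_
    filter_upwards [hwx, LInf.ae_norm_le (f ⊔ g : LInf μ)] with x h1 h2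
    have h3 : (1 : ℝ) / (n + 1) ≤ 1 := by
      rw [div_le_one (by positivity)]; linarith [(Nat.cast_nonneg n : (0 : ℝ) ≤ n)]
    have h4 := abs_sub_abs_le_abs_sub ((w n : LInf μ) x) ((f ⊔ g : LInf μ) x)
    linarith [h1 n]
  · filter_upwards [hwx] with x hx
    rw [tendsto_iff_norm_sub_tendsto_zero]
    exact squeeze_zero (fun _ => norm_nonneg _) hx tendsto_one_div_add_atTop_nhds_zero_nat

theorem inf_mem_unitBall [SigmaFinite μ] {f g : LInf μ} (hf : f ∈ Γ.unitBall)
    (hg : g ∈ Γ.unitBall) : f ⊓ g ∈ Γ.unitBall := by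
  have h := neg_mem_unitBall (sup_mem_unitBall (neg_mem_unitBall hf) (neg_mem_unitBall hg))
  rwa [neg_sup, neg_neg, neg_neg] at h

/-- The unit ball of `𝒟` is closed under bounded countable suprema. -/
theorem exists_isLUB_mem_unitBall [SigmaFinite μ] {ι : Type*} [Countable ι] [Nonempty ι]
    {u : ι → LInf μ} (hu : ∀ i, u i ∈ Γ.unitBall) {C : ℝ} (hC : ∀ i, ‖u i‖ ≤ C) :
    ∃ f ∈ Γ.unitBall, ∀ᵐ x ∂μ, IsLUB (range fun i => u i x) (f x) := by
  obtain ⟨e, he⟩ := exists_surjective_nat ι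
  have hbd : ∀ᵐ x ∂μ, ∀ i, |u i x| ≤ C := ae_all_iff.mpr fun i => by
    filter_upwards [LInf.ae_norm_le (u i)] with x hx
    exact hx.trans (hC i)
  -- Finite suprema remain in the ball and increase to the full supremum; being uniformly bounded,
  -- they converge weak* by dominated convergence.
  let v : ℕ → LInf μ := fun n => partialSups (fun n => u (e n)) n
  have hv : ∀ n, v n ∈ Γ.unitBall := fun n => by
    induction n with
    | zero => change partialSups _ 0 ∈ _; rw [partialSups_zero]; exact hu _
    | succ n ih => change partialSups _ (n + 1) ∈ _; rw [partialSups_add_one]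
                   exact sup_mem_unitBall ih (hu _)
  have hvx : ∀ᵐ x ∂μ, ∀ n, v n x = partialSups (fun n => u (e n) x) n := by
    rw [ae_all_iff]
    intro n
    induction n with
    | zero =>
      refine Eventually.of_forall fun x => ?_
      change (partialSups _ 0 : LInf μ) x = _
      rw [partialSups_zero, partialSups_zero]
    | succ n ih =>
      filter_upwards [ih, LInf.coeFn_sup (v n) (u (e (n + 1)))] with x h1 h2
      change (partialSups _ (n + 1) : LInf μ) x = _
      rw [partialSups_add_one, partialSups_add_one, ← h1]
      exact h2
  obtain ⟨f, hf⟩ := LInf.exists_ae_eq (μ := μ) (f := fun x => ⨆ i, u i x) (C := C)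
    (Measurable.iSup fun i => (u i).measurable).aestronglyMeasurable (by
      filter_upwards [hbd] with x hx
      obtain ⟨i⟩ := ‹Nonempty ι›
      rw [abs_le]
      exact ⟨(abs_le.mp (hx i)).1.trans (le_ciSup (f := fun i => u i x)
        ⟨C, by rintro _ ⟨j, rfl⟩; exact (abs_le.mp (hx j)).2⟩ i),
        ciSup_le fun j => (abs_le.mp (hx j)).2⟩)
  have hlub : ∀ᵐ x ∂μ, IsLUB (range fun i => u i x) (f x) := by
    filter_upwards [hbd, hf] with x h1 h2
    rw [h2]
    exact isLUB_ciSup ⟨C, by rintro _ ⟨j, rfl⟩; exact (abs_le.mp (h1 j)).2⟩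
  have hlub' : ∀ᵐ x ∂μ, IsLUB (range fun n => v n x) (f x) := by
    filter_upwards [hlub, hvx] with x h1 h2
    have h3 : (range fun n => v n x) = range (partialSups fun n => u (e n) x) := by
      congr 1; funext n; exact h2 n
    constructor
    · rintro _ ⟨n, rfl⟩
      change v n x ≤ f x
      rw [h2 n]
      exact partialSups_le _ _ _ fun k _ => h1.1 ⟨e k, rfl⟩
    · intro b hb
      refine h1.2 ?_
      rintro _ ⟨i, rfl⟩
      obtain ⟨n, rfl⟩ := he i
      refine le_trans ?_ (hb ⟨n, rfl⟩)
      change u (e n) x ≤ v n x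
      rw [h2 n]
      exact le_partialSups (fun n => u (e n) x) n
  refine ⟨f, mem_unitBall_of_tendsto (l := atTop) (Eventually.of_forall hv)
    (LInf.tendsto_weakStar_of_ae (C := C) (fun n => ?_) ?_), hlub⟩
  · refine LInf.norm_le_of_ae ((norm_nonneg _).trans (hC (e 0))) ?_
    filter_upwards [hvx, hbd] with x h1 h2
    rw [h1, abs_le]
    exact ⟨(abs_le.mp (h2 (e 0))).1.trans (le_partialSups_of_le (fun n => u (e n) x)
      (Nat.zero_le n)), partialSups_le _ _ _ fun k _ => (abs_le.mp (h2 (e k))).2⟩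
  · filter_upwards [hlub', hvx] with x h1 h2
    refine tendsto_atTop_isLUB (fun m n hmn => ?_) h1
    change v m x ≤ v n x
    rw [h2 m, h2 n]
    exact (partialSups fun n => u (e n) x).monotone hmn

theorem exists_isGLB_mem_unitBall [SigmaFinite μ] {ι : Type*} [Countable ι] [Nonempty ι]
    {u : ι → LInf μ} (hu : ∀ i, u i ∈ Γ.unitBall) {C : ℝ} (hC : ∀ i, ‖u i‖ ≤ C) :
    ∃ f ∈ Γ.unitBall, ∀ᵐ x ∂μ, IsGLB (range fun i => u i x) (f x) := by
  obtain ⟨f, hf, h⟩ := exists_isLUB_mem_unitBall (u := fun i => -u i)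
    (fun i => neg_mem_unitBall (hu i)) (C := C) (fun i => by rw [norm_neg]; exact hC i)
  refine ⟨-f, neg_mem_unitBall hf, ?_⟩
  filter_upwards [h, LInf.coeFn_neg f, ae_all_iff.mpr fun i => LInf.coeFn_neg (u i)]
    with x h1 h2 h3
  have h4 : (range fun i => u i x) = -range fun i => (-u i : LInf μ) x := by
    ext a
    rw [Set.mem_neg]
    constructor
    · rintro ⟨i, rfl⟩
      exact ⟨i, h3 i⟩
    · rintro ⟨i, hi⟩
      exact ⟨i, neg_injective ((h3 i).symm.trans hi)⟩
  rw [h2, h4, isGLB_neg]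
  rwa [neg_neg]

end DiffusionForm

end

end Weaver

namespace Weaver
noncomputable section

variable {X : Type*} [MeasurableSpace X] {μ : Measure X}

/-! ### Essential ranges -/

/-- Intervals with rational endpoints form a countable base, so the null sets belonging to values
outside the essential range can be discarded simultaneously. -/
theorem ae_mem_essRange (f : LInf μ) (A : Set X) : ∀ᵐ x ∂μ, x ∈ A → f x ∈ essRange f A := by
  have h : ∀ᵐ x ∂μ, ∀ p q : ℚ, μ (A ∩ f ⁻¹' Ioo (p : ℝ) q) = 0 →
      x ∉ A ∩ f ⁻¹' Ioo (p : ℝ) q := by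
    rw [ae_all_iff]; intro p
    rw [ae_all_iff]; intro q
    rw [eventually_imp_distrib_left]
    exact fun h0 => measure_eq_zero_iff_ae_notMem.mp h0
  filter_upwards [h] with x hx hxA
  by_contra hcon
  simp only [essRange, mem_ofPred_eq, not_forall, not_not] at hcon
  obtain ⟨U, hU, h0⟩ := hcon
  obtain ⟨l, u, ⟨hl, hu⟩, hlu⟩ := mem_nhds_iff_exists_Ioo_subset.mp hU
  obtain ⟨p, hp1, hp2⟩ := exists_rat_btwn hl
  obtain ⟨q, hq1, hq2⟩ := exists_rat_btwn hu
  refine hx p q (measure_mono_null ?_ h0) ⟨hxA, hp2, hq1⟩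
  exact inter_subset_inter_right _ (preimage_mono
    ((Ioo_subset_Ioo hp1.le hq2.le).trans hlu))

theorem essRange_subset {f : LInf μ} {A : Set X} {K : Set ℝ} (hK : IsClosed K)
    (h : ∀ᵐ x ∂μ, x ∈ A → f x ∈ K) : essRange f A ⊆ K := by
  intro a ha
  by_contra hcon
  refine ha Kᶜ (hK.isOpen_compl.mem_nhds hcon) ?_
  rw [measure_eq_zero_iff_ae_notMem]
  filter_upwards [h] with x hx hx'
  exact hx'.2 (hx hx'.1)

theorem essRange_mono {f : LInf μ} {A B : Set X} (h : A ≤ᵐ[μ] B) :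
    essRange f A ⊆ essRange f B := by
  intro a ha U hU h0
  refine ha U hU (measure_mono_null_ae ?_ h0)
  filter_upwards [h] with x hx hx'
  exact ⟨hx hx'.1, hx'.2⟩

theorem essRange_nonempty (f : LInf μ) {A : Set X} (hA : μ A ≠ 0) : (essRange f A).Nonempty := by
  by_contra hcon
  rw [not_nonempty_iff_eq_empty] at hcon
  refine hA (measure_eq_zero_iff_ae_notMem.mpr ?_)
  filter_upwards [ae_mem_essRange f A] with x hx hxA
  have := hx hxA
  rw [hcon] at this
  exact this

theorem essDist_anti {f : LInf μ} {A A' B B' : PosSet μ} (hA : A.1 ≤ᵐ[μ] A'.1)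
    (hB : B.1 ≤ᵐ[μ] B'.1) : essDist f A' B' ≤ essDist f A B :=
  le_iInf₂ fun a ha => le_iInf₂ fun b hb =>
    iInf₂_le_of_le a (essRange_mono hA ha) (iInf₂_le b (essRange_mono hB hb))

theorem essDist_comm (f : LInf μ) (A B : PosSet μ) : essDist f A B = essDist f B A := by
  have h : ∀ A B : PosSet μ, essDist f A B ≤ essDist f B A := fun A B =>
    le_iInf₂ fun b hb => le_iInf₂ fun a ha =>
      iInf₂_le_of_le a ha (iInf₂_le_of_le b hb (edist_comm a b).le)
  exact le_antisymm (h A B) (h B A)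

theorem essDist_self (f : LInf μ) (A : PosSet μ) : essDist f A A = 0 := by
  obtain ⟨a, ha⟩ := essRange_nonempty f A.2.2
  refine le_antisymm (iInf₂_le_of_le a ha (iInf₂_le_of_le a ha ?_)) zero_le
  rw [edist_self]

theorem ofReal_le_essDist_iff {f : LInf μ} {A B : PosSet μ} {r : ℝ} :
    ENNReal.ofReal r ≤ essDist f A B ↔
      ∀ a ∈ essRange f A.1, ∀ b ∈ essRange f B.1, r ≤ |a - b| := by
  simp only [essDist, le_iInf_iff, edist_dist, Real.dist_eq,
    ENNReal.ofReal_le_ofReal_iff (abs_nonneg _)]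

/-- If `f ≤ a` on `A` and `b ≤ f` on `B`, then `b - a ≤ ρ_f(A, B)`. -/
theorem ofReal_le_essDist_of_ae {f : LInf μ} {A B : PosSet μ} {a b : ℝ}
    (hA : ∀ᵐ x ∂μ, x ∈ A.1 → f x ≤ a) (hB : ∀ᵐ x ∂μ, x ∈ B.1 → b ≤ f x) :
    ENNReal.ofReal (b - a) ≤ essDist f A B := by
  rw [ofReal_le_essDist_iff]
  intro s hs t ht
  have h1 : s ≤ a := essRange_subset isClosed_Iic hA hs
  have h2 : b ≤ t := essRange_subset isClosed_Ici hB ht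
  rw [abs_sub_comm]
  exact (sub_le_sub h2 h1).trans (le_abs_self _)

/-! ### The intrinsic metric is a measurable pseudometric -/

namespace DiffusionForm

variable {Γ : DiffusionForm μ}

theorem essDist_le_metric {f : LInf μ} (hf : f ∈ Γ.unitBall) (A B : PosSet μ) :
    essDist f A B ≤ Γ.metric A B := by
  obtain ⟨h, h1⟩ := id hf
  exact le_iSup₂_of_le (f := fun (f : Γ.domain) (_ : ‖Γ.form f f‖ ≤ 1) => essDist (f : LInf μ) A B)
    ⟨f, h⟩ (coe_mem_unitBall_iff_norm.mp hf) le_rfl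

theorem metric_le_iff {A B : PosSet μ} {c : ℝ≥0∞} :
    Γ.metric A B ≤ c ↔ ∀ f ∈ Γ.unitBall, essDist f A B ≤ c := by
  refine ⟨fun h f hf => (essDist_le_metric hf A B).trans h, fun h => iSup₂_le fun f hf => ?_⟩
  exact h f (coe_mem_unitBall_iff_norm.mpr hf)

theorem lt_metric_iff {A B : PosSet μ} {c : ℝ≥0∞} :
    c < Γ.metric A B ↔ ∃ f ∈ Γ.unitBall, c < essDist f A B := by
  rw [← not_le, metric_le_iff]
  push Not
  rfl

theorem metric_anti {A A' B B' : PosSet μ} (hA : A.1 ≤ᵐ[μ] A'.1) (hB : B.1 ≤ᵐ[μ] B'.1) :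
    Γ.metric A' B' ≤ Γ.metric A B :=
  iSup₂_mono fun _ _ => essDist_anti hA hB

theorem metric_comm (A B : PosSet μ) : Γ.metric A B = Γ.metric B A :=
  iSup_congr fun _ => iSup_congr fun _ => essDist_comm _ A B

theorem ofReal_le_metric_of_ae {f : LInf μ} (hf : f ∈ Γ.unitBall) {A B : PosSet μ} {a b : ℝ}
    (hA : ∀ᵐ x ∂μ, x ∈ A.1 → f x ≤ a) (hB : ∀ᵐ x ∂μ, x ∈ B.1 → b ≤ f x) :
    ENNReal.ofReal (b - a) ≤ Γ.metric A B :=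
  (ofReal_le_essDist_of_ae hA hB).trans (essDist_le_metric hf A B)

/-- A function in the unit ball of `𝒟` which separates `A` from `B`. -/
theorem exists_separator [SigmaFinite μ] {A B : PosSet μ} {r : ℝ} (hr : 0 ≤ r)
    (h : ENNReal.ofReal r < Γ.metric A B) :
    ∃ u ∈ Γ.unitBall, (∀ᵐ x ∂μ, 0 ≤ u x ∧ u x ≤ r) ∧ (∀ᵐ x ∂μ, x ∈ A.1 → u x = 0) ∧
      ∀ᵐ x ∂μ, x ∈ B.1 → u x = r := by
  obtain ⟨g, hg, hgr⟩ := lt_metric_iff.mp h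
  have hsep := ofReal_le_essDist_iff.mp hgr.le
  have hne : Nonempty (essRange g A.1) := (essRange_nonempty g A.2.2).to_subtype
  -- The separator is the distance from `g` to its essential range on `A`, truncated at `r`. It is
  -- the infimum of `min |g - q n| r` over a dense sequence of that range, hence a countable infimum
  -- in the ball.
  let q : ℕ → ℝ := fun n => (TopologicalSpace.denseSeq (essRange g A.1) n : ℝ)
  have hq : ∀ n, q n ∈ essRange g A.1 := fun n => Subtype.mem _
  let v : ℕ → LInf μ := fun n => (g + algebraMap ℝ (LInf μ) (-q n))
  let u : ℕ → LInf μ := fun n => (v n ⊔ -v n) ⊓ algebraMap ℝ (LInf μ) r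
  have hv : ∀ n, v n ∈ Γ.unitBall := fun n => add_algebraMap_mem_unitBall hg _
  have hu : ∀ n, u n ∈ Γ.unitBall := fun n => inf_mem_unitBall
    (sup_mem_unitBall (hv n) (neg_mem_unitBall (hv n))) (algebraMap_mem_unitBall r)
  have hux : ∀ᵐ x ∂μ, ∀ n, u n x = min |g x - q n| r := by
    rw [ae_all_iff]
    intro n
    filter_upwards [LInf.coeFn_inf (v n ⊔ -v n) (algebraMap ℝ (LInf μ) r),
      LInf.coeFn_sup (v n) (-v n), LInf.coeFn_neg (v n),
      LInf.coeFn_add g (algebraMap ℝ (LInf μ) (-q n)), LInf.coeFn_algebraMap (μ := μ) (-q n),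
      LInf.coeFn_algebraMap (μ := μ) r] with x h1 h2 h3 h4 h5 h6
    change v n x = _ at h4
    change u n x = _ at h1
    rw [h1, h2, h3, h6, h4, h5, ← sub_eq_add_neg]
    rfl
  obtain ⟨f, hf, hglb⟩ := exists_isGLB_mem_unitBall hu (C := r) (fun n => by
    refine LInf.norm_le_of_ae hr ?_
    filter_upwards [hux] with x hx
    rw [hx n, abs_of_nonneg (le_min (abs_nonneg _) hr)]
    exact min_le_right _ _)
  have hbd : ∀ᵐ x ∂μ, 0 ≤ f x ∧ f x ≤ r := by
    filter_upwards [hglb, hux] with x h1 h2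
    constructor
    · refine h1.2 ?_
      rintro _ ⟨n, rfl⟩
      change 0 ≤ u n x
      rw [h2 n]; exact le_min (abs_nonneg _) hr
    · refine (h1.1 ⟨0, rfl⟩).trans ?_
      change u 0 x ≤ r
      rw [h2 0]; exact min_le_right _ _
  refine ⟨f, hf, hbd, ?_, ?_⟩
  · filter_upwards [hglb, hux, hbd, ae_mem_essRange g A.1] with x h1 h2 h3 h4 hxA
    refine le_antisymm (le_of_forall_pos_le_add fun ε hε => ?_) h3.1
    obtain ⟨n, hn⟩ := (TopologicalSpace.denseRange_denseSeq (essRange g A.1)).exists_dist_lt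
      ⟨g x, h4 hxA⟩ hε
    rw [zero_add]
    refine (h1.1 ⟨n, rfl⟩).trans ?_
    change u n x ≤ ε
    rw [h2 n]
    exact (min_le_left _ _).trans hn.le
  · filter_upwards [hglb, hux, hbd, ae_mem_essRange g B.1] with x h1 h2 h3 h4 hxB
    refine le_antisymm h3.2 (h1.2 ?_)
    rintro _ ⟨n, rfl⟩
    change r ≤ u n x
    rw [h2 n, abs_sub_comm]
    exact le_min (hsep _ (hq n) _ (h4 hxB)) le_rfl

/-- For the lower bound, take separators vanishing on `B` and equal to `r` on the individual `A n`;
their supremum stays in the ball, vanishes on `B` and is at least `r` on the union. -/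
theorem metric_iUnion [SigmaFinite μ] (A : ℕ → PosSet μ) (U B : PosSet μ)
    (hU : U.1 = ⋃ n, (A n).1) : Γ.metric U B = ⨅ n, Γ.metric (A n) B := by
  refine le_antisymm (le_iInf fun n => metric_anti ?_ EventuallyLE.rfl) ?_
  · rw [hU]; exact (subset_iUnion (fun n => (A n).1) n).eventuallyLE
  refine ENNReal.le_of_forall_nnreal_lt fun r hr => ?_
  have hr' : ∀ n, ENNReal.ofReal r < Γ.metric B (A n) := fun n => by
    rw [ENNReal.ofReal_coe_nnreal, metric_comm]
    exact hr.trans_le (iInf_le _ n)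
  choose u hu h1 h2 h3 using fun n => exists_separator (Γ := Γ) r.2 (hr' n)
  obtain ⟨f, hf, hlub⟩ := exists_isLUB_mem_unitBall hu (C := r) (fun n => by
    refine LInf.norm_le_of_ae r.2 ?_
    filter_upwards [h1 n] with x hx
    rw [abs_of_nonneg hx.1]; exact hx.2)
  have h4 := ofReal_le_metric_of_ae hf (A := B) (B := U) (a := 0) (b := r) ?_ ?_
  · rwa [sub_zero, ENNReal.ofReal_coe_nnreal, metric_comm] at h4
  · filter_upwards [hlub, ae_all_iff.mpr h2] with x h5 h6 hxB
    refine h5.2 ?_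
    rintro _ ⟨n, rfl⟩
    exact (h6 n hxB).le
  · filter_upwards [hlub, ae_all_iff.mpr h3] with x h5 h6 hxU
    rw [hU, mem_iUnion] at hxU
    obtain ⟨n, hn⟩ := hxU
    exact (h6 n hn).ge.trans (h5.1 ⟨n, rfl⟩)

/-- For each competitor `g`, pass through a single value `b` of the essential range of `g` on `B`,
and shrink `B` to the part where `g` is close to `b`. -/
theorem metric_triangle (A B C : PosSet μ) : Γ.metric A C ≤
    ⨆ (B' : PosSet μ) (_ : B'.1 ⊆ B.1), (Γ.metric A B' + Γ.metric B' C) := by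
  rw [metric_le_iff]
  intro g hg
  obtain ⟨b, hb⟩ := essRange_nonempty g B.2.2
  refine ENNReal.le_of_forall_pos_le_add fun ε hε _ => ?_
  have hε2 : 0 < (ε / 2 : NNReal) := half_pos hε
  -- This set has positive measure precisely because `b` is in the essential range. The radius `ε /
  -- 2` enters twice, once for each leg of the path.
  let B' : PosSet μ := ⟨B.1 ∩ g ⁻¹' Metric.closedBall b (ε / 2 : NNReal),
    B.2.1.inter (g.measurable measurableSet_closedBall), hb _ (Metric.closedBall_mem_nhds b hε2)⟩
  have hB' : ∀ c ∈ essRange g B'.1, edist c b ≤ (ε / 2 : NNReal) := fun c hc => by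
    have h1 : c ∈ Metric.closedBall b (ε / 2 : NNReal) :=
      essRange_subset Metric.isClosed_closedBall (Eventually.of_forall fun x hx => hx.2) hc
    rwa [edist_nndist, ENNReal.coe_le_coe, ← NNReal.coe_le_coe]
  set α := ⨅ a ∈ essRange g A.1, edist a b
  set γ := ⨅ c ∈ essRange g C.1, edist b c
  have h1 : essDist g A C ≤ α + γ := by
    rw [← tsub_le_iff_left]
    refine le_iInf₂ fun c hc => ?_
    rw [tsub_le_iff_left, ← tsub_le_iff_right]
    refine le_iInf₂ fun a ha => ?_
    rw [tsub_le_iff_right]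
    exact (iInf₂_le_of_le a ha (iInf₂_le c hc)).trans (edist_triangle a b c)
  have h2 : α ≤ essDist g A B' + (ε / 2 : NNReal) := by
    rw [← tsub_le_iff_right]
    refine le_iInf₂ fun a ha => le_iInf₂ fun c hc => ?_
    rw [tsub_le_iff_right]
    exact (iInf₂_le a ha).trans ((edist_triangle a c b).trans (by gcongr; exact hB' c hc))
  have h3 : γ ≤ essDist g B' C + (ε / 2 : NNReal) := by
    rw [← tsub_le_iff_right]
    refine le_iInf₂ fun c hc => le_iInf₂ fun a ha => ?_
    rw [tsub_le_iff_right]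
    refine (iInf₂_le a ha).trans ((edist_triangle b c a).trans ?_)
    rw [add_comm, edist_comm b c]
    gcongr
    exact hB' c hc
  have h4 : essDist g A B' + essDist g B' C ≤
      ⨆ (B' : PosSet μ) (_ : B'.1 ⊆ B.1), (Γ.metric A B' + Γ.metric B' C) :=
    (add_le_add (essDist_le_metric hg A B') (essDist_le_metric hg B' C)).trans
      (le_iSup₂ (f := fun (B' : PosSet μ) (_ : B'.1 ⊆ B.1) => Γ.metric A B' + Γ.metric B' C)
        B' inter_subset_left)
  calc essDist g A C ≤ α + γ := h1
    _ ≤ (essDist g A B' + (ε / 2 : NNReal)) + (essDist g B' C + (ε / 2 : NNReal)) :=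
      add_le_add h2 h3
    _ = (essDist g A B' + essDist g B' C) + ((ε / 2 : NNReal) + (ε / 2 : NNReal)) := by ring
    _ ≤ _ := by
      refine add_le_add h4 ?_
      rw [← ENNReal.coe_add, add_halves]

theorem isMeasurablePseudometric_metric [SigmaFinite μ] (Γ : DiffusionForm μ) :
    IsMeasurablePseudometric Γ.metric where
  congr _ _ _ _ hA hB :=
    le_antisymm (metric_anti hA.symm.le hB.symm.le) (metric_anti hA.le hB.le)
  self A := le_antisymm (metric_le_iff.mpr fun f _ => (essDist_self f A).le) zero_le
  symm := metric_comm
  iUnion := metric_iUnion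
  triangle := metric_triangle

end DiffusionForm

end

end Weaver

namespace Weaver
noncomputable section

variable {X : Type*} [MeasurableSpace X] {μ : Measure X}

/-! ### The domain of `Γ` is `Lip(M)` -/

theorem LInf.continuous_pairing (h : Lp ℝ 1 μ) :
    @Continuous _ _ (weakStar μ) _ fun f : LInf μ => LInf.pairing f h := by
  have h1 : @Continuous _ _ (weakStar μ) _ fun (f : LInf μ) (k : Lp ℝ 1 μ) =>
    LInf.pairing f k := continuous_induced_dom
  let _ := weakStar μ
  exact continuous_pi_iff.mp h1 h

theorem essDist_smul_le {c : ℝ} (hc : 0 < c) (f : LInf μ) (A B : PosSet μ) :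
    essDist (c • f) A B ≤ ENNReal.ofReal c * essDist f A B := by
  have key : ∀ (A : Set X) (a : ℝ), a ∈ essRange f A → c * a ∈ essRange (c • f) A := by
    intro A a ha U hU h0
    refine ha ((fun t => c * t) ⁻¹' U) ((continuous_const_mul c).continuousAt hU)
      (measure_mono_null_ae ?_ h0)
    filter_upwards [LInf.coeFn_smul c f] with x hx hxA
    refine ⟨hxA.1, ?_⟩
    rw [mem_preimage, hx]
    exact hxA.2
  have hc0 : ENNReal.ofReal c ≠ 0 := by simpa using hc
  rw [mul_comm, ← ENNReal.div_le_iff_le_mul (Or.inl hc0) (Or.inl ENNReal.ofReal_ne_top)]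
  refine le_iInf₂ fun a ha => le_iInf₂ fun b hb => ?_
  rw [ENNReal.div_le_iff_le_mul (Or.inl hc0) (Or.inl ENNReal.ofReal_ne_top)]
  refine (iInf₂_le_of_le (c * a) (key _ a ha) (iInf₂_le (c * b) (key _ b hb))).trans ?_
  rw [edist_dist, edist_dist, ← ENNReal.ofReal_mul dist_nonneg, Real.dist_eq, Real.dist_eq,
    ← mul_sub, abs_mul, abs_of_pos hc, mul_comm]

namespace DiffusionForm

variable {Γ : DiffusionForm μ}

theorem inv_smul_mem_unitBall_iff {c : ℝ} (hc : 0 < c) {f : Γ.domain} :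
    c⁻¹ • (f : LInf μ) ∈ Γ.unitBall ↔ ‖Γ.form f f‖ ≤ c ^ 2 := by
  have h : c⁻¹ • (f : LInf μ) = ((c⁻¹ • f : Γ.domain) : LInf μ) := rfl
  rw [h, coe_mem_unitBall_iff_norm, form_smul_self, norm_smul, norm_pow, norm_inv,
    Real.norm_of_nonneg hc.le, inv_pow, inv_mul_le_iff₀ (by positivity), mul_one]

theorem exists_smul_mem_unitBall (f : Γ.domain) :
    ∃ c : ℝ, 0 < c ∧ c • (f : LInf μ) ∈ Γ.unitBall := by
  have h : 0 < ‖Γ.form f f‖ + 1 := by positivity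
  refine ⟨_, inv_pos.mpr h, (inv_smul_mem_unitBall_iff h).mpr ?_⟩
  nlinarith [norm_nonneg (Γ.form f f)]

theorem pairing_eq_zero_of_domain {h : Lp ℝ 1 μ}
    (H : ∀ g : Γ.domain, LInf.pairing (g : LInf μ) h = 0) (u : LInf μ) :
    LInf.pairing u h = 0 := by
  let _ := weakStar μ
  have h1 : closure (Γ.domain : Set (LInf μ)) ⊆ {v | LInf.pairing v h = 0} :=
    closure_minimal (fun g hg => H ⟨g, hg⟩)
      (isClosed_singleton.preimage (LInf.continuous_pairing h))
  exact h1 (Γ.dense_domain u)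

/-- Every function in `L^∞` is a limit almost everywhere of a sequence in `𝒟`. -/
theorem exists_seq_domain_tendsto_ae [SigmaFinite μ] (Γ : DiffusionForm μ) (u : LInf μ) :
    ∃ g : ℕ → Γ.domain, ∀ᵐ x ∂μ, Tendsto (fun n => (g n : LInf μ) x) atTop (𝓝 (u x)) := by
  -- Multiplication by a positive `w` in `L^2` embeds `L^∞` in a Hilbert space, where weak* density
  -- becomes norm density; norm convergence gives an almost everywhere convergent subsequence, and
  -- `w` is divided out.
  obtain ⟨w, hw⟩ := LInf.exists_pos_L2 μ
  let J : LInf μ →ₗ[ℝ] Lp ℝ 2 μ :=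
    { toFun := fun g => g • w
      map_add' := fun a b => Lp.smul_add a b w
      map_smul' := fun c a => by
        apply Lp.ext
        filter_upwards [Lp.coeFn_lpSMul (r := 2) (c • a) w, Lp.coeFn_lpSMul (r := 2) a w,
          LInf.coeFn_smul c a, Lp.coeFn_smul c (a • w : Lp ℝ 2 μ)] with x h1 h2 h3 h4
        rw [RingHom.id_apply, h1, h4, Pi.smul_apply, h2, Pi.smul_apply', Pi.smul_apply', h3]
        simp only [smul_eq_mul, mul_assoc] }
  have hJ : ∀ g, ⇑(J g) =ᵐ[μ] fun x => g x * w x := fun g => Lp.coeFn_lpSMul (r := 2) g w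
  let K : Submodule ℝ (Lp ℝ 2 μ) := (Subalgebra.toSubmodule Γ.domain).map J
  have hmem : J u ∈ K.topologicalClosure := by
    -- It suffices to test vectors `k` orthogonal to the image of `𝒟`. The product `w k` lies in
    -- `L^1` and annihilates `𝒟`, hence all of `L^∞`.
    rw [← Submodule.orthogonal_orthogonal_eq_closure, Submodule.mem_orthogonal]
    intro k hk
    rw [Submodule.mem_orthogonal] at hk
    have e : ∀ v : LInf μ, inner ℝ (J v) k = LInf.pairing v (w • k : Lp ℝ 1 μ) := fun v => by
      rw [L2.inner_def]
      refine integral_congr_ae ?_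
      filter_upwards [hJ v, Lp.coeFn_lpSMul (r := 1) w k] with x h1 h2
      rw [h1, h2, Pi.smul_apply', smul_eq_mul]
      simp only [RCLike.inner_apply, conj_trivial]
      ring
    rw [real_inner_comm, e]
    refine pairing_eq_zero_of_domain (Γ := Γ) (fun g => ?_) u
    rw [← e]
    exact hk _ (Submodule.mem_map_of_mem g.2)
  rw [← SetLike.mem_coe, Submodule.topologicalClosure_coe, mem_closure_iff_seq_limit] at hmem
  obtain ⟨v, hv, hlim⟩ := hmem
  choose g hg hgv using hv
  obtain ⟨ns, -, hns⟩ := (tendstoInMeasure_of_tendsto_Lp hlim).exists_seq_tendsto_ae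
  refine ⟨fun n => ⟨g (ns n), hg (ns n)⟩, ?_⟩
  filter_upwards [hns, hw, ae_all_iff.mpr fun n => hJ (g (ns n)), hJ u] with x h1 h2 h3 h4
  rw [h4] at h1
  have h5 := h1.mul_const (w x)⁻¹
  rw [mul_assoc, mul_inv_cancel₀ h2.ne', mul_one] at h5
  refine h5.congr fun n => ?_
  rw [← hgv (ns n), h3 n, mul_assoc, mul_inv_cancel₀ h2.ne', mul_one]

/-- If the distances between subsets of `A` and of `B` avoid `(0, ε)`, then the distance of `A`
and `B` is at least `ε`. This depends on the density of `𝒟`. -/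
theorem le_metric_of_gap [SigmaFinite μ] {A B : PosSet μ} {ε : ℝ≥0∞} (hAB : μ (A.1 ∩ B.1) = 0)
    (h : ∀ A' B' : PosSet μ, A'.1 ⊆ A.1 → B'.1 ⊆ B.1 → 0 < Γ.metric A' B' →
      ε ≤ Γ.metric A' B') : ε ≤ Γ.metric A B := by
  -- The functions `g n` tend to the indicator of `A`. Up to null sets, `A` and `B` are exhausted by
  -- the increasing sets on which all later `g m` exceed `3 / 4`, respectively stay below `1 / 4`.
  obtain ⟨g, hg⟩ := Γ.exists_seq_domain_tendsto_ae (LInf.ind A.2.1)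
  let S : ℕ → Set X := fun n => A.1 ∩ ⋂ m ≥ n, {x | 3 / 4 < (g m : LInf μ) x}
  let T : ℕ → Set X := fun n => B.1 ∩ ⋂ m ≥ n, {x | (g m : LInf μ) x < 1 / 4}
  have hSm : ∀ n, MeasurableSet (S n) := fun n => A.2.1.inter <|
    MeasurableSet.iInter fun m => MeasurableSet.iInter fun _ =>
      measurableSet_lt measurable_const (LInf.measurable _)
  have hTm : ∀ n, MeasurableSet (T n) := fun n => B.2.1.inter <|
    MeasurableSet.iInter fun m => MeasurableSet.iInter fun _ =>
      measurableSet_lt (LInf.measurable _) measurable_const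
  have hS : ∀ᵐ x ∂μ, x ∈ A.1 → ∃ n, x ∈ S n := by
    filter_upwards [hg, LInf.coeFn_ind (μ := μ) A.2.1] with x h1 h2 hxA
    rw [h2, indicator_of_mem hxA] at h1
    obtain ⟨n, hn⟩ := eventually_atTop.mp (h1.eventually_const_lt (by norm_num : (3 : ℝ) / 4 < 1))
    exact ⟨n, hxA, mem_iInter₂.mpr hn⟩
  have hT : ∀ᵐ x ∂μ, x ∈ B.1 → ∃ n, x ∈ T n := by
    filter_upwards [hg, LInf.coeFn_ind (μ := μ) A.2.1,
      measure_eq_zero_iff_ae_notMem.mp hAB] with x h1 h2 h3 hxB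
    rw [h2, indicator_of_notMem fun hxA => h3 ⟨hxA, hxB⟩] at h1
    obtain ⟨n, hn⟩ := eventually_atTop.mp (h1.eventually_lt_const (by norm_num : (0 : ℝ) < 1 / 4))
    exact ⟨n, hxB, mem_iInter₂.mpr hn⟩
  have hpos : ∀ (C : PosSet μ) (R : ℕ → Set X), (∀ᵐ x ∂μ, x ∈ C.1 → ∃ n, x ∈ R n) →
      ∃ n, μ (R n) ≠ 0 := fun C R hR => by
    by_contra! hcon
    refine C.2.2 (measure_eq_zero_iff_ae_notMem.mpr ?_)
    filter_upwards [hR, ae_all_iff.mpr fun n => measure_eq_zero_iff_ae_notMem.mp (hcon n)]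
      with x h1 h2 hxC
    obtain ⟨n, hn⟩ := h1 hxC
    exact h2 n hn
  obtain ⟨n₀, hn₀⟩ := hpos A S hS
  obtain ⟨n₁, hn₁⟩ := hpos B T hT
  have hSmono : Monotone S := fun m n hmn => inter_subset_inter_right _
    (biInter_subset_biInter_left fun k hk => le_trans hmn hk)
  have hTmono : Monotone T := fun m n hmn => inter_subset_inter_right _
    (biInter_subset_biInter_left fun k hk => le_trans hmn hk)
  let N := max n₀ n₁
  let a : ℕ → PosSet μ := fun n => ⟨S (N + n), hSm _, fun h0 => hn₀ (measure_mono_null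
    (hSmono ((le_max_left _ _).trans (Nat.le_add_right _ _))) h0)⟩
  let b : ℕ → PosSet μ := fun n => ⟨T (N + n), hTm _, fun h0 => hn₁ (measure_mono_null
    (hTmono ((le_max_right _ _).trans (Nat.le_add_right _ _))) h0)⟩
  -- A positive multiple of `g (N + n)` lies in the ball and separates the two sets, so their
  -- distance is positive and the gap hypothesis raises it to `ε`.
  have hab : ∀ n, ε ≤ Γ.metric (a n) (b n) := fun n => by
    refine h _ _ inter_subset_left inter_subset_left ?_
    obtain ⟨c, hc, hcg⟩ := exists_smul_mem_unitBall (g (N + n))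
    rw [metric_comm]
    have h1 : 0 < ENNReal.ofReal (c * (3 / 4) - c * (1 / 4)) :=
      ENNReal.ofReal_pos.mpr (by linarith)
    refine h1.trans_le (ofReal_le_metric_of_ae hcg ?_ ?_)
    · filter_upwards [LInf.coeFn_smul c (g (N + n) : LInf μ)] with x hx hxb
      rw [hx]
      exact mul_le_mul_of_nonneg_left (le_of_lt (mem_iInter₂.mp hxb.2 (N + n) le_rfl)) hc.le
    · filter_upwards [LInf.coeFn_smul c (g (N + n) : LInf μ)] with x hx hxb
      rw [hx]
      exact mul_le_mul_of_nonneg_left (le_of_lt (mem_iInter₂.mp hxb.2 (N + n) le_rfl)) hc.le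
  -- The uniform bound along the diagonal extends to all pairs by monotonicity; the union axiom in
  -- each variable then carries it to the exhausted sets.
  have hmn : ∀ m n, ε ≤ Γ.metric (a m) (b n) := fun m n => (hab (max m n)).trans <|
    metric_anti (hSmono (Nat.add_le_add_left (le_max_left _ _) _)).eventuallyLE
      (hTmono (Nat.add_le_add_left (le_max_right _ _) _)).eventuallyLE
  let U : PosSet μ := ⟨⋃ n, (a n).1, MeasurableSet.iUnion fun n => (a n).2.1, fun h0 =>
    (a 0).2.2 (measure_mono_null (subset_iUnion (fun n => (a n).1) 0) h0)⟩
  let V : PosSet μ := ⟨⋃ n, (b n).1, MeasurableSet.iUnion fun n => (b n).2.1, fun h0 =>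
    (b 0).2.2 (measure_mono_null (subset_iUnion (fun n => (b n).1) 0) h0)⟩
  have hle : Γ.metric U V ≤ Γ.metric A B := by
    refine metric_anti ?_ ?_
    · filter_upwards [hS] with x hx hxA
      obtain ⟨n, hn⟩ := hx hxA
      exact mem_iUnion.mpr ⟨n, hSmono (Nat.le_add_left _ _) hn⟩
    · filter_upwards [hT] with x hx hxB
      obtain ⟨n, hn⟩ := hx hxB
      exact mem_iUnion.mpr ⟨n, hTmono (Nat.le_add_left _ _) hn⟩
  refine le_trans ?_ hle
  have hU : Γ.metric U V = ⨅ m, Γ.metric (a m) V := metric_iUnion a U V rfl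
  have hV : ∀ C, Γ.metric V C = ⨅ n, Γ.metric (b n) C := fun C => metric_iUnion b V C rfl
  rw [hU]
  refine le_iInf fun m => ?_
  rw [metric_comm, hV]
  refine le_iInf fun n => ?_
  rw [metric_comm]
  exact hmn m n

/-- `L(f)` says nothing about pairs at distance zero. If `f` separated such a pair, any subpair at
positive distance would have distance at least `essDist f A B / c`, and `le_metric_of_gap` would
make `ρ(A, B)` positive. -/
theorem essDist_le_of_lipNumber_le [SigmaFinite μ] {f : LInf μ} {c : ℝ} (hc : 0 < c)
    (h : lipNumber Γ.metric f ≤ ENNReal.ofReal c) (A B : PosSet μ) :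
    essDist f A B ≤ ENNReal.ofReal c * Γ.metric A B := by
  have hc0 : ENNReal.ofReal c ≠ 0 := by simpa using hc
  have hpos : ∀ A B : PosSet μ, 0 < Γ.metric A B →
      essDist f A B ≤ ENNReal.ofReal c * Γ.metric A B := fun A B hAB => by
    rw [← ENNReal.div_le_iff_le_mul (Or.inl hAB.ne') (Or.inr hc0)]
    refine le_trans ?_ h
    exact le_iSup_of_le A (le_iSup₂_of_le (f := fun (B : PosSet μ) (_ : 0 < Γ.metric A B) =>
      essDist f A B / Γ.metric A B) B hAB le_rfl)
  rcases (zero_le (a := Γ.metric A B)).eq_or_lt with h0 | h0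
  · rw [← h0, mul_zero]
    by_contra! hcon
    have hnull : μ (A.1 ∩ B.1) = 0 := by
      by_contra hne
      let P : PosSet μ := ⟨A.1 ∩ B.1, A.2.1.inter B.2.1, hne⟩
      have h1 : essDist f A B ≤ essDist f P P :=
        essDist_anti inter_subset_left.eventuallyLE inter_subset_right.eventuallyLE
      rw [essDist_self] at h1
      exact hcon.not_ge h1
    have h2 : essDist f A B / ENNReal.ofReal c ≤ Γ.metric A B := by
      refine le_metric_of_gap hnull fun A' B' hA hB h' => ?_
      rw [ENNReal.div_le_iff_le_mul (Or.inl hc0) (Or.inl ENNReal.ofReal_ne_top), mul_comm]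
      exact (essDist_anti hA.eventuallyLE hB.eventuallyLE).trans (hpos A' B' h')
    rw [← h0] at h2
    exact (ENNReal.div_pos hcon.ne' ENNReal.ofReal_ne_top).not_ge h2
  · exact hpos A B h0

/-- An approximate step function for the levels `t < s` of `f`: since `ρ({f ≤ t}, {s ≤ f}) ≥ s - t`,
a separator of these two sets does the job. The family is the raw material for rebuilding `f`. -/
theorem exists_step [SigmaFinite μ] {f : LInf μ}
    (h : ∀ A B : PosSet μ, essDist f A B ≤ Γ.metric A B) {s t δ : ℝ} (hts : t < s) (hδ : 0 < δ) :
    ∃ w ∈ Γ.unitBall, ∀ᵐ x ∂μ, t ≤ w x ∧ w x ≤ s ∧ (s ≤ f x → w x = s) ∧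
      (f x ≤ t → w x ≤ t + δ) := by
  have hPm : MeasurableSet {x | s ≤ f x} := measurableSet_le measurable_const f.measurable
  have hQm : MeasurableSet {x | f x ≤ t} := measurableSet_le f.measurable measurable_const
  by_cases hP : μ {x | s ≤ f x} = 0
  · refine ⟨_, algebraMap_mem_unitBall t, ?_⟩
    filter_upwards [LInf.coeFn_algebraMap (μ := μ) t, measure_eq_zero_iff_ae_notMem.mp hP]
      with x h1 h2
    rw [h1]
    exact ⟨le_rfl, hts.le, fun h3 => (h2 h3).elim, fun _ => by linarith⟩
  by_cases hQ : μ {x | f x ≤ t} = 0 ∨ s ≤ t + δ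
  · refine ⟨_, algebraMap_mem_unitBall s, ?_⟩
    have hQ' : ∀ᵐ x ∂μ, f x ≤ t → s ≤ t + δ := by
      rcases hQ with hQ | hQ
      · filter_upwards [measure_eq_zero_iff_ae_notMem.mp hQ] with x hx hx'
        exact (hx hx').elim
      · exact Eventually.of_forall fun _ _ => hQ
    filter_upwards [LInf.coeFn_algebraMap (μ := μ) s, hQ'] with x h1 h2
    rw [h1]
    exact ⟨hts.le, le_rfl, fun _ => rfl, h2⟩
  push Not at hQ
  let P : PosSet μ := ⟨_, hPm, hP⟩
  let Q : PosSet μ := ⟨_, hQm, hQ.1⟩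
  have h1 : ENNReal.ofReal (s - t) ≤ Γ.metric P Q := by
    rw [metric_comm]
    exact (ofReal_le_essDist_of_ae (Eventually.of_forall fun x hx => hx)
      (Eventually.of_forall fun x hx => hx)).trans (h Q P)
  -- Separators require a height strictly below the distance; the loss `δ` reappears in the bound `t
  -- + δ` on `{f ≤ t}`.
  obtain ⟨u, hu, hu1, hu2, hu3⟩ := exists_separator (Γ := Γ) (A := P) (B := Q) (r := s - t - δ)
    (by linarith [hQ.2]) (lt_of_lt_of_le (by
      rw [ENNReal.ofReal_lt_ofReal_iff (by linarith)]; linarith) h1)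
  refine ⟨_, add_algebraMap_mem_unitBall (neg_mem_unitBall hu) s, ?_⟩
  filter_upwards [hu1, hu2, hu3, LInf.coeFn_add (-u) (algebraMap ℝ (LInf μ) s), LInf.coeFn_neg u,
    LInf.coeFn_algebraMap (μ := μ) s] with x h2 h3 h4 h5 h6 h7
  rw [h5, h6, h7]
  refine ⟨by linarith, by linarith, fun h8 => ?_, fun h8 => ?_⟩
  · rw [h3 h8]; ring
  · rw [h4 h8]; linarith

/-- Rebuild `f` by lattice operations: the infimum of the steps from `t` to `s` over rational `t <
s` and small `δ` lies below `f` and equals `s` where `s ≤ f`. The supremum of these over rational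
`s` is `f`. -/
theorem mem_unitBall_of_essDist_le [SigmaFinite μ] {f : LInf μ}
    (h : ∀ A B : PosSet μ, essDist f A B ≤ Γ.metric A B) : f ∈ Γ.unitBall := by
  set M := ‖f‖ with hM
  have hM0 : 0 ≤ M := norm_nonneg _
  have hfM : ∀ᵐ x ∂μ, -M ≤ f x ∧ f x ≤ M := by
    filter_upwards [LInf.ae_norm_le f] with x hx
    exact abs_le.mp hx
  -- Restricting levels to `(-M - 1, M + 1)` keeps the families uniformly bounded, as suprema and
  -- infima in the ball require, while leaving room below the essential range of `f`.
  have inner : ∀ s : {s : ℚ // -M - 1 < s ∧ (s : ℝ) < M + 1}, ∃ w ∈ Γ.unitBall,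
      ‖w‖ ≤ M + 1 ∧ ∀ᵐ x ∂μ, (s ≤ f x → w x = s) ∧ w x ≤ f x := by
    rintro ⟨s, hs1, hs2⟩
    change ∃ w ∈ Γ.unitBall, ‖w‖ ≤ M + 1 ∧ ∀ᵐ x ∂μ, ((s : ℝ) ≤ f x → w x = s) ∧ w x ≤ f x
    choose v hv hvx using fun i : {t : ℚ // -M - 1 < t ∧ (t : ℝ) < s} × ℕ =>
      exists_step h (s := s) (t := i.1.1) (δ := 1 / (i.2 + 1 : ℝ)) i.1.2.2 (by positivity)
    have hne : Nonempty {t : ℚ // -M - 1 < t ∧ (t : ℝ) < s} := by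
      obtain ⟨t, ht⟩ := exists_rat_btwn hs1
      exact ⟨⟨t, ht⟩⟩
    have hvx' := ae_all_iff.mpr hvx
    have hnorm : ∀ (u : LInf μ), (∀ᵐ x ∂μ, -M - 1 ≤ u x ∧ u x ≤ s) → ‖u‖ ≤ M + 1 := fun u hu => by
      refine LInf.norm_le_of_ae (by linarith) ?_
      filter_upwards [hu] with x hx
      rw [abs_le]
      constructor <;> linarith
    obtain ⟨w, hw, hglb⟩ := exists_isGLB_mem_unitBall hv (C := M + 1) (fun i => hnorm _ (by
      filter_upwards [hvx i] with x hx
      exact ⟨i.1.2.1.le.trans hx.1, hx.2.1⟩))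
    have hwx : ∀ᵐ x ∂μ, -M - 1 ≤ w x ∧ w x ≤ s := by
      filter_upwards [hglb, hvx'] with x h1 h2
      constructor
      · refine h1.2 ?_
        rintro _ ⟨i, rfl⟩
        exact i.1.2.1.le.trans (h2 i).1
      · have i : {t : ℚ // -M - 1 < t ∧ (t : ℝ) < s} × ℕ := Classical.arbitrary _
        exact (h1.1 ⟨i, rfl⟩).trans (h2 i).2.1
    have hws : ∀ᵐ x ∂μ, (s : ℝ) ≤ f x → w x = s := by
      filter_upwards [hglb, hvx', hwx] with x h1 h2 h3 hsx
      refine le_antisymm h3.2 (h1.2 ?_)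
      rintro _ ⟨i, rfl⟩
      exact ((h2 i).2.2.1 hsx).ge
    refine ⟨w, hw, hnorm w hwx, ?_⟩
    filter_upwards [hglb, hvx', hws, hfM] with x h1 h2 h3 h4
    refine ⟨h3, ?_⟩
    rcases le_or_gt (s : ℝ) (f x) with h5 | h5
    · rw [h3 h5]; exact h5
    · refine le_of_forall_pos_le_add fun ε hε => ?_
      -- Where `f x < s`, a level `t` just above `f x` and a small `δ` give a step whose value at
      -- `x` exceeds `f x` by at most `ε`.
      obtain ⟨t, ht1, ht2⟩ := exists_rat_btwn (lt_min h5 (by linarith : f x < f x + ε / 2))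
      rw [lt_min_iff] at ht2
      obtain ⟨n, hn⟩ := exists_nat_one_div_lt (half_pos hε)
      have h6 := (h2 (⟨t, by linarith, ht2.1⟩, n)).2.2.2 ht1.le
      refine (h1.1 ⟨(⟨t, by linarith, ht2.1⟩, n), rfl⟩).trans (h6.trans ?_)
      change (t : ℝ) + 1 / (n + 1 : ℝ) ≤ _
      linarith [ht2.2]
  choose w hw hwn hwx using inner
  have hne : Nonempty {s : ℚ // -M - 1 < s ∧ (s : ℝ) < M + 1} :=
    ⟨⟨0, by push_cast; linarith, by push_cast; linarith⟩⟩
  obtain ⟨g, hg, hlub⟩ := exists_isLUB_mem_unitBall hw hwn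
  have : f = g := by
    apply Lp.ext
    filter_upwards [hlub, ae_all_iff.mpr hwx, hfM] with x h1 h2 h3
    refine le_antisymm (le_of_forall_rat_lt_imp_le fun q hq => ?_) (h1.2 ?_)
    · rcases lt_or_ge (-M - 1) (q : ℝ) with h4 | h4
      · have h5 := (h2 ⟨q, h4, by linarith⟩).1 hq.le
        rw [← h5]
        exact h1.1 ⟨_, rfl⟩
      -- Here `q` lies below all admissible levels; any level between `-M - 1` and `-M` is below `f
      -- x` and already forces `q ≤ g x`.
      · have i : {s : ℚ // -M - 1 < s ∧ (s : ℝ) < M + 1} := hne.some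
        obtain ⟨p, hp1, hp2⟩ := exists_rat_btwn (by linarith : -M - 1 < -M)
        have h5 := (h2 ⟨p, hp1, by linarith⟩).1 (by
          change (p : ℝ) ≤ f x
          linarith)
        have h6 : (p : ℝ) ≤ g x := by
          rw [← h5]
          exact h1.1 ⟨_, rfl⟩
        linarith
    · rintro _ ⟨i, rfl⟩
      exact (h2 i).2
  rw [this]; exact hg

/-- Rescaling by `c⁻¹` reduces both sides to membership in the ball. Positivity of `c` is needed for
this; `lipNumber_eq` covers `L(f) = 0` by approximation. -/
theorem lipNumber_le_ofReal_iff [SigmaFinite μ] {f : LInf μ} {c : ℝ} (hc : 0 < c) :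
    lipNumber Γ.metric f ≤ ENNReal.ofReal c ↔
      ∃ hf : f ∈ Γ.domain, ‖Γ.form ⟨f, hf⟩ ⟨f, hf⟩‖ ≤ c ^ 2 := by
  have hc0 : ENNReal.ofReal c ≠ 0 := by simpa using hc
  have hinv : c • c⁻¹ • f = f := smul_inv_smul₀ hc.ne' f
  constructor
  · intro h
    have h1 : c⁻¹ • f ∈ Γ.unitBall := mem_unitBall_of_essDist_le fun A B => by
      refine (essDist_smul_le (inv_pos.mpr hc) f A B).trans ?_
      rw [ENNReal.ofReal_inv_of_pos hc]
      calc _ ≤ (ENNReal.ofReal c)⁻¹ * (ENNReal.ofReal c * Γ.metric A B) := by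
            gcongr; exact essDist_le_of_lipNumber_le hc h A B
        _ = _ := by
            rw [← mul_assoc, ENNReal.inv_mul_cancel hc0 ENNReal.ofReal_ne_top, one_mul]
    have hf : f ∈ Γ.domain := by
      have := Γ.domain.smul_mem h1.1 c
      rwa [hinv] at this
    exact ⟨hf, (inv_smul_mem_unitBall_iff (f := ⟨f, hf⟩) hc).mp h1⟩
  · rintro ⟨hf, h⟩
    have h1 := (inv_smul_mem_unitBall_iff (f := ⟨f, hf⟩) hc).mpr h
    refine iSup_le fun A => iSup₂_le fun B hAB => ?_
    rw [ENNReal.div_le_iff_le_mul (Or.inl hAB.ne') (Or.inr hc0)]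
    have h2 := essDist_smul_le hc (c⁻¹ • f) A B
    rw [hinv] at h2
    refine h2.trans ?_
    gcongr
    exact essDist_le_metric h1 A B

theorem lipNumber_eq [SigmaFinite μ] (f : Γ.domain) :
    lipNumber Γ.metric f = ENNReal.ofReal √‖Γ.form f f‖ := by
  refine le_antisymm (ENNReal.le_of_forall_pos_le_add fun ε hε _ => ?_) ?_
  · have h1 : 0 < √‖Γ.form f f‖ + ε := add_pos_of_nonneg_of_pos (Real.sqrt_nonneg _) hε
    have h2 := (lipNumber_le_ofReal_iff (f := (f : LInf μ)) h1).mpr ⟨f.2, ?_⟩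
    · rwa [ENNReal.ofReal_add (Real.sqrt_nonneg _) ε.coe_nonneg, ENNReal.ofReal_coe_nnreal] at h2
    · rw [← Real.sqrt_le_left h1.le]
      exact le_add_of_nonneg_right ε.2
  · by_contra! hcon
    obtain ⟨r, h1, h2⟩ := ENNReal.lt_iff_exists_nnreal_btwn.mp hcon
    rw [← ENNReal.ofReal_coe_nnreal] at h1 h2
    have hr : 0 < (r : ℝ) := ENNReal.ofReal_pos.mp (zero_le.trans_lt h1)
    obtain ⟨_, h3⟩ := (lipNumber_le_ofReal_iff hr).mp h1.le
    have h4 : √‖Γ.form f f‖ ≤ r := (Real.sqrt_le_left hr.le).mpr h3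
    exact h2.not_ge (ENNReal.ofReal_le_ofReal h4)

theorem mem_domain_iff_mem_lip [SigmaFinite μ] (f : LInf μ) :
    f ∈ Γ.domain ↔ f ∈ lip Γ.metric := by
  constructor
  · intro hf
    change lipNumber Γ.metric f ≠ ∞
    rw [lipNumber_eq ⟨f, hf⟩]
    exact ENNReal.ofReal_ne_top
  · intro hf
    have h1 : 0 < (lipNumber Γ.metric f).toReal + 1 := by positivity
    refine ((lipNumber_le_ofReal_iff (Γ := Γ) h1).mp ?_).1
    rw [← ENNReal.ofReal_toReal (a := lipNumber Γ.metric f) hf]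
    exact ENNReal.ofReal_le_ofReal (by simp)

theorem isMeasurableMetric_metric [SigmaFinite μ] (Γ : DiffusionForm μ) :
    IsMeasurableMetric Γ.metric where
  toIsMeasurablePseudometric := Γ.isMeasurablePseudometric_metric
  dense_lip := by
    convert Γ.dense_domain using 1
    ext f
    exact (mem_domain_iff_mem_lip f).symm

end DiffusionForm

end

end Weaver

namespace Weaver
noncomputable section

variable {X : Type*} [MeasurableSpace X] {μ : Measure X}

/-! ### Essential suprema and order identities in `L^∞` -/

namespace LInf

/-- A bounded above family in `L^∞` has a supremum, which is attained on a countable subfamily. -/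
theorem exists_seq_isLUB [SigmaFinite μ] {ι : Type*} [Nonempty ι] (F : ι → LInf μ) (C : ℝ)
    (hF : ∀ i, ∀ᵐ x ∂μ, F i x ≤ C) :
    ∃ (s : ℕ → ι) (N : LInf μ), (∀ᵐ x ∂μ, IsLUB (range fun n => F (s n) x) (N x)) ∧
      ∀ i, F i ≤ N := by
  obtain ⟨w, hw, hwm, hwi⟩ := exists_pos_integrable μ
  -- The increasing map `a ↦ w * exp a` makes the family positive and dominated by an integrable
  -- function. A countable subfamily maximizing the integral of the pointwise supremum is then
  -- sought.
  let G : ι → X → ℝ≥0∞ := fun i x => ENNReal.ofReal (w x * Real.exp (F i x))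
  have hG : ∀ i, Measurable (G i) := fun i =>
    (hwm.mul (F i).measurable.exp).ennreal_ofReal
  let J : (ℕ → ι) → ℝ≥0∞ := fun s => ∫⁻ x, ⨆ n, G (s n) x ∂μ
  obtain ⟨j, -, hj, hjr⟩ := exists_seq_tendsto_sSup (range_nonempty J) (OrderTop.bddAbove _)
  choose s hs using hjr
  -- Interleaving a maximizing sequence of countable subfamilies gives one at which the maximum is
  -- attained.
  let t : ℕ → ι := fun k => s k.unpair.1 k.unpair.2
  have hJt : ∀ u, J u ≤ J t := fun u => by
    have h1 : J u ≤ sSup (range J) := le_sSup ⟨u, rfl⟩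
    refine h1.trans (le_of_tendsto' hj fun k => ?_)
    rw [← hs k]
    refine lintegral_mono fun x => iSup_le fun n => ?_
    refine le_iSup_of_le (Nat.pair k n) ?_
    simp only [t, Nat.unpair_pair]
    exact le_rfl
  have hbd : ∀ᵐ x ∂μ, ∀ n, F (t n) x ≤ C := ae_all_iff.mpr fun n => hF (t n)
  have hJfin : J t ≠ ∞ := by
    have h1 : ∫⁻ x, ENNReal.ofReal (w x * Real.exp C) ∂μ ≠ ∞ :=
      (hwi.mul_const (Real.exp C)).lintegral_lt_top.ne
    refine ne_top_of_le_ne_top h1 (lintegral_mono_ae ?_)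
    filter_upwards [hbd] with x hx
    refine iSup_le fun n => ENNReal.ofReal_le_ofReal ?_
    exact mul_le_mul_of_nonneg_left (Real.exp_le_exp.mpr (hx n)) (hw x).le
  obtain ⟨N, hN⟩ := exists_ae_eq (μ := μ) (f := fun x => ⨆ n, F (t n) x)
    (C := max ‖F (t 0)‖ |C|)
    (Measurable.iSup fun n => (F (t n)).measurable).aestronglyMeasurable (by
      filter_upwards [hbd, ae_norm_le (F (t 0))] with x h1 h2
      rw [abs_le]
      constructor
      · have h3 : F (t 0) x ≤ ⨆ n, F (t n) x :=
          le_ciSup (f := fun n => F (t n) x) ⟨C, by rintro _ ⟨n, rfl⟩; exact h1 n⟩ 0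
        linarith [(abs_le.mp h2).1, le_max_left ‖F (t 0)‖ |C|]
      · exact ciSup_le fun n => (h1 n).trans ((le_abs_self C).trans (le_max_right _ _)))
  have hlub : ∀ᵐ x ∂μ, IsLUB (range fun n => F (t n) x) (N x) := by
    filter_upwards [hN, hbd] with x h1 h2
    rw [h1]
    exact isLUB_ciSup ⟨C, by rintro _ ⟨n, rfl⟩; exact h2 n⟩
  refine ⟨t, N, hlub, fun i => ?_⟩
  -- Prepending an arbitrary index cannot increase the maximal finite integral, so it does not
  -- change the supremum almost everywhere.
  let u : ℕ → ι := fun n => Nat.casesOn n i t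
  have h1 : (fun x => ⨆ n, G (t n) x) =ᵐ[μ] fun x => ⨆ n, G (u n) x :=
    ae_eq_of_ae_le_of_lintegral_le
      (Eventually.of_forall fun x => iSup_le fun n => le_iSup (fun n => G (u n) x) (n + 1))
      hJfin (Measurable.iSup fun n => hG (u n)).aemeasurable (hJt u)
  rw [le_iff]
  filter_upwards [h1, hlub] with x h2 h3
  have h4 : G i x ≤ ⨆ n, G (t n) x := by
    rw [h2]; exact le_iSup (fun n => G (u n) x) 0
  have h5 : (⨆ n, G (t n) x) ≤ ENNReal.ofReal (w x * Real.exp (N x)) :=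
    iSup_le fun n => ENNReal.ofReal_le_ofReal
      (mul_le_mul_of_nonneg_left (Real.exp_le_exp.mpr (h3.1 ⟨n, rfl⟩)) (hw x).le)
  have h6 := (ENNReal.ofReal_le_ofReal_iff (by have := hw x; positivity)).mp (h4.trans h5)
  exact Real.exp_le_exp.mp (le_of_mul_le_mul_left h6 (hw x))

theorem add_self_le_iff {f g : LInf μ} : f + f ≤ g ↔ f ≤ (1 / 2 : ℝ) • g := by
  constructor <;> intro h <;> rw [← sub_nonneg] at h ⊢
  · refine (smul_nonneg' (c := 1 / 2) (by norm_num) h).trans_eq ?_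
    module
  · refine (smul_nonneg' (c := 2) (by norm_num) h).trans_eq ?_
    module

theorem eq_of_add_self_eq {f g : LInf μ} (h : f + f = g + g) : f = g := by
  rw [← two_smul ℝ f, ← two_smul ℝ g] at h
  exact smul_right_injective (LInf μ) (two_ne_zero (α := ℝ)) h

theorem sub_mul_self_le (f g : LInf μ) : (f - g) * (f - g) ≤ 2 * (f * f) + 2 * (g * g) := by
  rw [← sub_nonneg]
  refine (mul_self_nonneg' (f + g)).trans_eq ?_
  ring

theorem mul_le_mul_left' {f g h : LInf μ} (hf : 0 ≤ f) (hgh : g ≤ h) : f * g ≤ f * h := by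
  rw [← sub_nonneg] at hgh ⊢
  refine (mul_nonneg' hf hgh).trans_eq ?_
  ring

end LInf

/-! ### From `L^∞`-valued quadratic forms to bilinear forms -/

section Polarization

variable {V : Type*} [AddCommGroup V] [Module (LInf μ) V] {N : V → LInf μ}

/-- A positive `L^∞`-valued quadratic form arises from a bilinear form. -/
theorem exists_bilinear_of_quadratic (hs : ∀ (f : LInf μ) v, N (f • v) = f * f * N v)
    (hp : ∀ v w, N (v + w) + N (v - w) = 2 * (N v + N w)) (h0 : ∀ v, 0 ≤ N v) :
    ∃ B : V →ₗ[LInf μ] V →ₗ[LInf μ] LInf μ, (∀ v w, B v w = B w v) ∧ (∀ v, B v v = N v) ∧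
      ∀ v w, 4 * B v w = N (v + w) - N (v - w) := by
  have hN0 : N 0 = 0 := by
    have := hs 0 0
    rwa [zero_smul, zero_mul, zero_mul] at this
  have hneg : ∀ v, N (-v) = N v := fun v => by
    have := hs (-1) v
    rwa [neg_smul, one_smul, neg_mul_neg, one_mul, one_mul] at this
  -- Jordan–von Neumann: the parallelogram law makes the polarization additive. Homogeneity over `ℚ`
  -- is then automatic, but homogeneity over `L^∞` needs a separate argument.
  let q : V → V → LInf μ := fun v w => N (v + w) - N (v - w)
  have hq0 : ∀ w, q 0 w = 0 := fun w => by
    change N (0 + w) - N (0 - w) = 0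
    rw [zero_add, zero_sub, hneg, sub_self]
  have hq2 : ∀ x y z, (q x z + q y z) + (q x z + q y z) = q (x + y) (z + z) := fun x y z => by
    have h1 := hp (x + z) (y + z)
    have h2 := hp (x - z) (y - z)
    have e1 : x + z + (y + z) = x + y + (z + z) := by abel
    have e2 : x + z - (y + z) = x - y := by abel
    have e3 : x - z + (y - z) = x + y - (z + z) := by abel
    have e4 : x - z - (y - z) = x - y := by abel
    rw [e1, e2] at h1
    rw [e3, e4] at h2
    change (N (x + z) - N (x - z) + (N (y + z) - N (y - z)))
      + (N (x + z) - N (x - z) + (N (y + z) - N (y - z))) = N (x + y + (z + z)) - N (x + y - (z + z))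
    linear_combination h2 - h1
  have hqadd : ∀ x y z, q (x + y) z = q x z + q y z := fun x y z => by
    have h1 := hq2 x y z
    have h2 := hq2 (x + y) 0 z
    rw [add_zero, hq0, add_zero] at h2
    exact LInf.eq_of_add_self_eq (h2.trans h1.symm)
  have hqsymm : ∀ v w, q v w = q w v := fun v w => by
    change N (v + w) - N (v - w) = N (w + v) - N (w - v)
    rw [add_comm, ← neg_sub w v, hneg]
  let β : V → V → LInf μ := fun v w => (1 / 4 : ℝ) • q v w
  have hβadd : ∀ x y z, β (x + y) z = β x z + β y z := fun x y z => by
    change (1 / 4 : ℝ) • q (x + y) z = (1 / 4 : ℝ) • q x z + (1 / 4 : ℝ) • q y z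
    rw [hqadd, smul_add]
  have hβsymm : ∀ v w, β v w = β w v := fun v w => congrArg (fun a => (1 / 4 : ℝ) • a) (hqsymm v w)
  have hβ4 : ∀ v w, 4 * β v w = N (v + w) - N (v - w) := fun v w => by
    change 4 * (1 / 4 : ℝ) • q v w = q v w
    rw [mul_smul_comm, ← map_ofNat (algebraMap ℝ (LInf μ)) 4, ← Algebra.smul_def, smul_smul]
    norm_num
  have hexp : ∀ v w, N (v + w) = N v + (β v w + β v w) + N w := fun v w => by
    refine LInf.eq_of_add_self_eq ?_
    linear_combination hp v w - hβ4 v w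
  have hrat : ∀ (c : ℚ) v w, β (((c : ℝ) • (1 : LInf μ)) • v) w = (c : ℝ) • β v w :=
    fun c v w => by
      let φ : LInf μ →+ LInf μ :=
        { toFun := fun g => β (g • v) w
          map_zero' := by
            change (1 / 4 : ℝ) • q ((0 : LInf μ) • v) w = 0
            rw [zero_smul, hq0, smul_zero]
          map_add' := fun a b => by rw [add_smul, hβadd] }
      have h1 := map_ratCast_smul φ ℝ ℝ c 1
      change β (((c : ℝ) • (1 : LInf μ)) • v) w = (c : ℝ) • β ((1 : LInf μ) • v) w at h1
      rwa [one_smul] at h1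
  have hcs : ∀ v w, β v w * β v w ≤ N v * N w := fun v w =>
    LInf.mul_self_le_of_quadratic fun c => by
      refine (h0 (((c : ℝ) • (1 : LInf μ)) • v + w)).trans_eq ?_
      rw [hexp, hs, hrat, smul_mul_smul_comm, mul_one, smul_mul_assoc, one_mul]
      module
  have hsmul : ∀ (g : LInf μ) v w, β (g • v) w = g * β v w := fun g v w => by
    -- The defect of homogeneity. By Cauchy–Schwarz its square is at most `4 g² N(v) N(w)`, and it
    -- does not change when a rational constant is subtracted from `g`. Hence almost everywhere the
    -- bound holds with `g x - t` for every real `t`, and `t = g x` makes it vanish.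
    let c : LInf μ → LInf μ := fun g => β (g • v) w - g * β v w
    have hc : ∀ g, c g * c g ≤ 4 * (g * g * (N v * N w)) := fun g => by
      have h1 : 0 ≤ g * g * (N v * N w - β v w * β v w) :=
        LInf.mul_nonneg' (LInf.mul_self_nonneg' g) (sub_nonneg.mpr (hcs v w))
      have h2 := sub_nonneg.mpr (hcs (g • v) w)
      have h3 := sub_nonneg.mpr (LInf.sub_mul_self_le (β (g • v) w) (g * β v w))
      rw [hs] at h2
      rw [← sub_nonneg]
      refine (add_nonneg h3 (add_nonneg (add_nonneg h1 h1) (add_nonneg h2 h2))).trans_eq ?_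
      change _ = _ - (β (g • v) w - g * β v w) * (β (g • v) w - g * β v w)
      ring
    have hcq : ∀ r : ℚ, c (g - algebraMap ℝ _ (r : ℝ)) = c g := fun r => by
      have h1 := hβadd (((g - algebraMap ℝ _ (r : ℝ)) : LInf μ) • v)
        (((r : ℝ) • (1 : LInf μ)) • v) w
      rw [hrat, ← add_smul, Algebra.algebraMap_eq_smul_one, sub_add_cancel] at h1
      change β _ w - _ * β v w = β (g • v) w - g * β v w
      rw [h1, Algebra.algebraMap_eq_smul_one, sub_mul, smul_mul_assoc, one_mul]
      ring
    have h1 : ∀ᵐ x ∂μ, ∀ r : ℚ, c g x * c g x ≤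
        4 * ((g x - r) * (g x - r) * (N v * N w : LInf μ) x) := by
      rw [ae_all_iff]
      intro r
      have h2 := hc (g - algebraMap ℝ _ (r : ℝ))
      rw [hcq, ← map_ofNat (algebraMap ℝ (LInf μ)) 4, ← Algebra.smul_def, LInf.le_iff] at h2
      set k := g - algebraMap ℝ _ (r : ℝ) with hk
      filter_upwards [h2, LInf.coeFn_mul (c g) (c g), LInf.coeFn_smul 4 (k * k * (N v * N w)),
        LInf.coeFn_mul (k * k) (N v * N w), LInf.coeFn_mul k k,
        LInf.coeFn_sub g (algebraMap ℝ _ (r : ℝ)), LInf.coeFn_algebraMap (μ := μ) (r : ℝ)]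
        with x a1 a2 a3 a4 a5 a6 a7
      rwa [a2, a3, a4, a5, hk, a6, a7] at a1
    rw [← sub_eq_zero]
    apply Lp.ext
    filter_upwards [h1, Lp.coeFn_zero ℝ ∞ μ] with x h2 h3
    rw [h3]
    have key : ∀ t : ℝ, c g x * c g x ≤ 4 * ((g x - t) * (g x - t) * (N v * N w : LInf μ) x) := by
      intro t
      refine Rat.denseRange_cast.induction_on (p := fun t : ℝ => c g x * c g x ≤
        4 * ((g x - t) * (g x - t) * (N v * N w : LInf μ) x)) t ?_ h2
      exact isClosed_le continuous_const (by fun_prop)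
    have h4 := key (g x)
    rw [sub_self, zero_mul, zero_mul, mul_zero] at h4
    exact mul_self_eq_zero.mp (le_antisymm h4 (mul_self_nonneg _))
  refine ⟨LinearMap.mk₂ (LInf μ) β hβadd hsmul
    (fun v w w' => by rw [hβsymm, hβadd, hβsymm w, hβsymm w'])
    (fun f v w => by rw [hβsymm, hsmul, hβsymm w]; rfl), hβsymm, fun v => ?_, hβ4⟩
  change β v v = N v
  have h1 := hexp v v
  have h2 := hs 2 v
  rw [two_smul] at h2
  refine LInf.eq_of_add_self_eq ?_
  linear_combination h2 - h1

end Polarization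

end

end Weaver

namespace Weaver
noncomputable section

variable {X : Type*} [MeasurableSpace X] {μ : Measure X}

namespace DiffusionForm

variable (Γ : DiffusionForm μ)

/-! ### The inner product of `E₁` -/

instance instModuleE₁ : Module Γ.domain Γ.E₁ := Submodule.module Γ.E₁

instance instSMulE₁ : SMul Γ.domain Γ.E₁ := (instModuleE₁ Γ).toSMul

theorem inner₁_symm (φ ψ : Γ.E₁) : Γ.inner₁ φ ψ = Γ.inner₁ ψ φ := by
  obtain ⟨φ, -⟩ := φ
  obtain ⟨ψ, -⟩ := ψ
  obtain ⟨φ, rfl⟩ := Γ.nullSubmodule.mkQ_surjective φ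
  obtain ⟨ψ, rfl⟩ := Γ.nullSubmodule.mkQ_surjective ψ
  exact Γ.inner₀_symm φ ψ

theorem inner₁_add_left (φ φ' ψ : Γ.E₁) :
    Γ.inner₁ (φ + φ') ψ = Γ.inner₁ φ ψ + Γ.inner₁ φ' ψ := by
  change Γ.innerQ (φ + φ' : Γ.E₁) ψ = _
  rw [Submodule.coe_add, map_add]; rfl

theorem inner₁_sub_left (φ φ' ψ : Γ.E₁) :
    Γ.inner₁ (φ - φ') ψ = Γ.inner₁ φ ψ - Γ.inner₁ φ' ψ := by
  change Γ.innerQ (φ - φ' : Γ.E₁) ψ = _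
  rw [Submodule.coe_sub, map_sub]; rfl

theorem inner₁_smul_left (a : Γ.domain) (φ ψ : Γ.E₁) :
    Γ.inner₁ (a • φ) ψ = (a : LInf μ) * Γ.inner₁ φ ψ :=
  LinearMap.map_smul₂ Γ.innerQ a φ.1 ψ.1

theorem inner₁_add_right (φ ψ ψ' : Γ.E₁) :
    Γ.inner₁ φ (ψ + ψ') = Γ.inner₁ φ ψ + Γ.inner₁ φ ψ' := by
  rw [inner₁_symm, inner₁_add_left, inner₁_symm, Γ.inner₁_symm ψ']

theorem inner₁_sub_right (φ ψ ψ' : Γ.E₁) :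
    Γ.inner₁ φ (ψ - ψ') = Γ.inner₁ φ ψ - Γ.inner₁ φ ψ' := by
  rw [inner₁_symm, inner₁_sub_left, inner₁_symm, Γ.inner₁_symm ψ']

theorem inner₁_smul_right (a : Γ.domain) (φ ψ : Γ.E₁) :
    Γ.inner₁ φ (a • ψ) = (a : LInf μ) * Γ.inner₁ φ ψ := by
  rw [inner₁_symm, inner₁_smul_left, inner₁_symm]

namespace E

variable {Γ}

theorem ext {Φ Ψ : Γ.E} (h : ∀ φ, Φ φ = Ψ φ) : Φ = Ψ :=
  Subtype.ext (LinearMap.ext h)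

theorem add_apply (Φ Ψ : Γ.E) (φ : Γ.E₁) : (Φ + Ψ) φ = Φ φ + Ψ φ := rfl

theorem sub_apply (Φ Ψ : Γ.E) (φ : Γ.E₁) : (Φ - Ψ) φ = Φ φ - Ψ φ := rfl

theorem neg_apply (Φ : Γ.E) (φ : Γ.E₁) : (-Φ) φ = -Φ φ := rfl

theorem smul_apply (f : LInf μ) (Φ : Γ.E) (φ : Γ.E₁) : (f • Φ) φ = f * Φ φ := rfl

theorem real_smul_apply (c : ℝ) (Φ : Γ.E) (φ : Γ.E₁) : (c • Φ) φ = c • Φ φ := rfl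

theorem apply_add (Φ : Γ.E) (φ ψ : Γ.E₁) : Φ (φ + ψ) = Φ φ + Φ ψ := map_add Φ.1 φ ψ

theorem apply_sub (Φ : Γ.E) (φ ψ : Γ.E₁) : Φ (φ - ψ) = Φ φ - Φ ψ := map_sub Φ.1 φ ψ

theorem apply_zero (Φ : Γ.E) : Φ 0 = 0 := map_zero Φ.1

theorem apply_smul (Φ : Γ.E) (a : Γ.domain) (φ : Γ.E₁) : Φ (a • φ) = (a : LInf μ) * Φ φ :=
  map_smul Φ.1 a φ

theorem embed_apply (φ ψ : Γ.E₁) : Γ.embed φ ψ = Γ.inner₁ ψ φ := rfl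

theorem embed_add (φ ψ : Γ.E₁) : Γ.embed (φ + ψ) = Γ.embed φ + Γ.embed ψ :=
  ext fun η => by rw [add_apply, embed_apply, inner₁_add_right]; rfl

theorem embed_smul (a : Γ.domain) (φ : Γ.E₁) : Γ.embed (a • φ) = (a : LInf μ) • Γ.embed φ :=
  ext fun η => by rw [smul_apply, embed_apply, inner₁_smul_right]; rfl

theorem mul_self_le (Φ : Γ.E) (φ : Γ.E₁) : Φ φ * Φ φ ≤ ‖Φ‖ ^ 2 • Γ.inner₁ φ φ :=
  (norm_mem Γ Φ).2 φ

/-! ### The `L^∞`-valued square norm of `E` -/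

/-- The Legendre functional whose supremum over `φ` is the square norm of `Φ`. -/
def legendre (Φ : Γ.E) (φ : Γ.E₁) : LInf μ := 2 * Φ φ - Γ.inner₁ φ φ

theorem legendre_zero (Φ : Γ.E) : legendre Φ 0 = 0 := by
  have h : Γ.inner₁ 0 0 = 0 := by
    have := Γ.inner₁_add_left 0 0 0
    rw [add_zero] at this
    exact left_eq_add.mp this
  rw [legendre, apply_zero, h]; ring

/-- The arithmetic-geometric mean inequality: `2 |Φ(φ)| ≤ u + ⟨φ, φ⟩` pointwise. -/
theorem legendre_le_of_mul_self_le {Φ : Γ.E} {φ : Γ.E₁} {u : LInf μ} (hu : 0 ≤ u)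
    (h : Φ φ * Φ φ ≤ u * Γ.inner₁ φ φ) : legendre Φ φ ≤ u := by
  have h0 := Γ.inner₁_self_nonneg φ
  rw [LInf.le_iff] at h
  rw [legendre, two_mul, LInf.le_iff]
  rw [LInf.nonneg_iff] at h0 hu
  filter_upwards [h, h0, hu, LInf.coeFn_mul (Φ φ) (Φ φ), LInf.coeFn_mul u (Γ.inner₁ φ φ),
    LInf.coeFn_sub (Φ φ + Φ φ) (Γ.inner₁ φ φ), LInf.coeFn_add (Φ φ) (Φ φ)]
    with x h1 h2 h3 h4 h5 h6 h7
  rw [h4, h5] at h1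
  rw [h6, h7]
  have : |Φ φ x| ≤ (u x + Γ.inner₁ φ φ x) / 2 := abs_le_of_sq_le_sq (by
    nlinarith [sq_nonneg (u x - Γ.inner₁ φ φ x)]) (by linarith)
  linarith [le_abs_self (Φ φ x)]

variable [SigmaFinite μ]

theorem exists_normSq (Φ : Γ.E) : ∃ (N : LInf μ) (s : ℕ → Γ.E₁),
    (∀ᵐ x ∂μ, IsLUB (range fun n => legendre Φ (s n) x) (N x)) ∧ ∀ φ, legendre Φ φ ≤ N := by
  obtain ⟨s, N, h1, h2⟩ := LInf.exists_seq_isLUB (fun φ => legendre Φ φ) (‖Φ‖ ^ 2) (fun φ => by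
    have h := legendre_le_of_mul_self_le (u := algebraMap ℝ (LInf μ) (‖Φ‖ ^ 2)) (φ := φ) (Φ := Φ)
      (by
        rw [LInf.nonneg_iff]
        filter_upwards [LInf.coeFn_algebraMap (μ := μ) (‖Φ‖ ^ 2)] with x hx
        rw [hx]; positivity)
      (by rw [← Algebra.smul_def]; exact mul_self_le Φ φ)
    rw [LInf.le_iff] at h
    filter_upwards [h, LInf.coeFn_algebraMap (μ := μ) (‖Φ‖ ^ 2)] with x h3 h4
    rwa [h4] at h3)
  exact ⟨N, s, h1, h2⟩

/-- The square norm `⟨Φ, Φ⟩ = sup_φ (2 Φ(φ) - ⟨φ, φ⟩)`. -/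
def normSq (Φ : Γ.E) : LInf μ := (exists_normSq Φ).choose

theorem exists_seq_isLUB_normSq (Φ : Γ.E) :
    ∃ s : ℕ → Γ.E₁, ∀ᵐ x ∂μ, IsLUB (range fun n => legendre Φ (s n) x) (normSq Φ x) :=
  let ⟨s, hs, _⟩ := (exists_normSq Φ).choose_spec
  ⟨s, hs⟩

theorem legendre_le (Φ : Γ.E) (φ : Γ.E₁) : legendre Φ φ ≤ normSq Φ :=
  let ⟨_, _, h⟩ := (exists_normSq Φ).choose_spec
  h φ

theorem normSq_le {Φ : Γ.E} {u : LInf μ} (h : ∀ φ, legendre Φ φ ≤ u) : normSq Φ ≤ u := by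
  obtain ⟨s, hs⟩ := exists_seq_isLUB_normSq Φ
  rw [LInf.le_iff]
  filter_upwards [hs, ae_all_iff.mpr fun n => LInf.le_iff.mp (h (s n))] with x h1 h2
  refine h1.2 ?_
  rintro _ ⟨n, rfl⟩
  exact h2 n

theorem normSq_nonneg (Φ : Γ.E) : 0 ≤ normSq Φ := by
  have h := legendre_le Φ 0
  rwa [legendre_zero] at h

theorem normSq_le_of_mul_self_le {Φ : Γ.E} {u : LInf μ} (hu : 0 ≤ u)
    (h : ∀ φ, Φ φ * Φ φ ≤ u * Γ.inner₁ φ φ) : normSq Φ ≤ u :=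
  normSq_le fun φ => legendre_le_of_mul_self_le hu (h φ)

/-- Evaluating the Legendre functional along the line `-q φ`, with `q` rational, gives a nonnegative
quadratic polynomial, and its discriminant is the claim. -/
theorem apply_mul_self_le (Φ : Γ.E) (φ : Γ.E₁) : Φ φ * Φ φ ≤ normSq Φ * Γ.inner₁ φ φ := by
  rw [mul_comm (normSq Φ)]
  refine LInf.mul_self_le_of_quadratic fun q => ?_
  have h := sub_nonneg.mpr (legendre_le Φ (algebraMap ℝ Γ.domain (-q) • φ))
  refine h.trans_eq ?_
  rw [legendre, apply_smul, inner₁_smul_left, inner₁_smul_right]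
  have e : ((algebraMap ℝ Γ.domain (-q : ℝ) : Γ.domain) : LInf μ) = algebraMap ℝ (LInf μ) (-q) :=
    rfl
  rw [e, Algebra.algebraMap_eq_smul_one]
  simp only [smul_mul_assoc, one_mul, two_mul]
  module

theorem mul_sub_le_of_mul_self_le {r a q n : ℝ} (hq : 0 ≤ q) (hn : 0 ≤ n)
    (h : r * a * (r * a) ≤ n * q) : r * r * (a + a - q) ≤ n := by
  rcases hq.eq_or_lt with hq | hq
  · rw [← hq, mul_zero] at h
    have h0 : r * a = 0 := mul_self_eq_zero.mp (le_antisymm h (mul_self_nonneg _))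
    rw [← hq]
    calc r * r * (a + a - 0) = 2 * r * (r * a) := by ring
      _ ≤ n := by rw [h0, mul_zero]; exact hn
  · refine le_of_mul_le_mul_right ?_ hq
    have h5 := mul_nonneg (mul_self_nonneg r) (mul_self_nonneg (a - q))
    nlinarith

/-- `E₁` is only a module over `𝒟`, so `f` cannot be absorbed into `φ`. Both inequalities go through
Cauchy–Schwarz instead, the second by the pointwise estimate `mul_sub_le_of_mul_self_le`. -/
theorem normSq_smul (f : LInf μ) (Φ : Γ.E) : normSq (f • Φ) = f * f * normSq Φ := by
  apply le_antisymm
  · refine normSq_le_of_mul_self_le (LInf.mul_nonneg' (LInf.mul_self_nonneg' f)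
      (normSq_nonneg Φ)) fun φ => ?_
    rw [← sub_nonneg, smul_apply]
    refine (LInf.mul_nonneg' (LInf.mul_self_nonneg' f)
      (sub_nonneg.mpr (apply_mul_self_le Φ φ))).trans_eq ?_
    ring
  · have h1 : ∀ φ, ∀ᵐ x ∂μ, f x * f x * legendre Φ φ x ≤ normSq (f • Φ) x := fun φ => by
      have h2 := apply_mul_self_le (f • Φ) φ
      have h3 := Γ.inner₁_self_nonneg φ
      have h4 := normSq_nonneg (f • Φ)
      have e : legendre Φ φ = Φ φ + Φ φ - Γ.inner₁ φ φ := by rw [legendre, two_mul]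
      rw [LInf.le_iff, smul_apply] at h2
      rw [LInf.nonneg_iff] at h3 h4
      rw [e]
      filter_upwards [h2, h3, h4, LInf.coeFn_mul f (Φ φ), LInf.coeFn_mul (f * Φ φ) (f * Φ φ),
        LInf.coeFn_mul (normSq (f • Φ)) (Γ.inner₁ φ φ), LInf.coeFn_add (Φ φ) (Φ φ),
        LInf.coeFn_sub (Φ φ + Φ φ) (Γ.inner₁ φ φ)] with x a1 a2 a3 a4 a5 a6 a7 a8
      rw [a5, a6, a4] at a1
      rw [a8, a7]
      exact mul_sub_le_of_mul_self_le a2 a3 a1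
    obtain ⟨s, hs⟩ := exists_seq_isLUB_normSq Φ
    have h4 := normSq_nonneg (f • Φ)
    rw [LInf.nonneg_iff] at h4
    rw [LInf.le_iff]
    filter_upwards [hs, ae_all_iff.mpr fun n => h1 (s n), LInf.coeFn_mul (f * f) (normSq Φ),
      LInf.coeFn_mul f f, h4] with x a1 a2 a3 a4 a5
    rw [a3, a4]
    rcases (mul_self_nonneg (f x)).eq_or_lt with h0 | h0
    · rw [← h0, zero_mul]; exact a5
    · rw [← le_div_iff₀' h0]
      refine a1.2 ?_
      rintro _ ⟨n, rfl⟩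
      rw [le_div_iff₀' h0]
      exact a2 n

theorem normSq_neg (Φ : Γ.E) : normSq (-Φ) = normSq Φ := by
  have := normSq_smul (-1) Φ
  rwa [neg_smul, one_smul, neg_mul_neg, one_mul, one_mul] at this

/-- The Legendre functionals satisfy the parallelogram identity at `φ + ψ` and `φ - ψ`. Taking
suprema gives one inequality, and applying it to `Φ + Ψ` and `Φ - Ψ` gives the other. -/
theorem normSq_add_add_normSq_sub (Φ Ψ : Γ.E) :
    normSq (Φ + Ψ) + normSq (Φ - Ψ) = 2 * (normSq Φ + normSq Ψ) := by
  have key : ∀ Φ Ψ : Γ.E, 2 * (normSq Φ + normSq Ψ) ≤ normSq (Φ + Ψ) + normSq (Φ - Ψ) := by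
    intro Φ Ψ
    have h1 : ∀ φ ψ, 2 * (legendre Φ φ + legendre Ψ ψ) ≤ normSq (Φ + Ψ) + normSq (Φ - Ψ) :=
      fun φ ψ => by
        refine le_trans (le_of_eq ?_) (add_le_add (legendre_le (Φ + Ψ) (φ + ψ))
          (legendre_le (Φ - Ψ) (φ - ψ)))
        simp only [legendre, apply_add, apply_sub, add_apply, sub_apply, inner₁_add_left,
          inner₁_add_right, inner₁_sub_left, inner₁_sub_right]
        ring
    have h2 : ∀ φ, 2 * (legendre Φ φ + normSq Ψ) ≤ normSq (Φ + Ψ) + normSq (Φ - Ψ) := fun φ => by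
      have h3 : normSq Ψ ≤ (1 / 2 : ℝ) •
          (normSq (Φ + Ψ) + normSq (Φ - Ψ) - 2 * legendre Φ φ) := normSq_le fun ψ => by
        rw [← LInf.add_self_le_iff, le_sub_iff_add_le]
        refine (le_of_eq ?_).trans (h1 φ ψ)
        ring
      rw [← LInf.add_self_le_iff, le_sub_iff_add_le] at h3
      refine (le_of_eq ?_).trans h3
      ring
    have h3 : normSq Φ ≤ (1 / 2 : ℝ) •
        (normSq (Φ + Ψ) + normSq (Φ - Ψ) - 2 * normSq Ψ) := normSq_le fun φ => by
      rw [← LInf.add_self_le_iff, le_sub_iff_add_le]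
      refine (le_of_eq ?_).trans (h2 φ)
      ring
    rw [← LInf.add_self_le_iff, le_sub_iff_add_le] at h3
    refine (le_of_eq ?_).trans h3
    ring
  refine le_antisymm ?_ (key Φ Ψ)
  -- The sum and difference of the new pair are `2 Φ` and `2 Ψ`, whose square norms carry a factor
  -- `4`.
  have h1 := key (Φ + Ψ) (Φ - Ψ)
  have e1 : Φ + Ψ + (Φ - Ψ) = (2 : LInf μ) • Φ := by rw [two_smul]; abel
  have e2 : Φ + Ψ - (Φ - Ψ) = (2 : LInf μ) • Ψ := by rw [two_smul]; abel
  rw [e1, e2, normSq_smul, normSq_smul] at h1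
  rw [← sub_nonneg] at h1 ⊢
  refine (LInf.smul_nonneg' (c := 1 / 2) (by norm_num) h1).trans_eq ?_
  refine LInf.eq_of_add_self_eq ?_
  rw [← add_smul]
  norm_num
  ring

/-- Completing the square: the translation `ψ ↦ ψ - φ` carries one supremum to the other. -/
theorem normSq_add_embed (Φ : Γ.E) (φ : Γ.E₁) :
    normSq (Φ + Γ.embed φ) = normSq Φ + 2 * Φ φ + Γ.inner₁ φ φ := by
  apply le_antisymm
  · refine normSq_le fun ψ => ?_
    have h := legendre_le Φ (ψ - φ)
    rw [← sub_nonneg] at h ⊢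
    refine h.trans_eq ?_
    simp only [legendre, apply_sub, add_apply, embed_apply, inner₁_sub_left, inner₁_sub_right]
    rw [Γ.inner₁_symm φ ψ]
    ring
  · rw [add_assoc, ← le_sub_iff_add_le]
    refine normSq_le fun ψ => ?_
    have h := legendre_le (Φ + Γ.embed φ) (ψ + φ)
    rw [← sub_nonneg] at h ⊢
    refine h.trans_eq ?_
    simp only [legendre, apply_add, add_apply, embed_apply, inner₁_add_left, inner₁_add_right]
    rw [Γ.inner₁_symm φ ψ]
    ring

/-- Thus a nearly optimal `φ` in the Legendre supremum is pointwise close to `Φ`. -/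
theorem normSq_sub_embed (Φ : Γ.E) (φ : Γ.E₁) :
    normSq (Φ - Γ.embed φ) = normSq Φ - legendre Φ φ := by
  have h := normSq_add_embed (-Φ) φ
  rw [← normSq_neg, normSq_neg Φ, neg_add, neg_neg, ← sub_eq_add_neg, neg_apply] at h
  rw [h, legendre]
  ring

theorem norm_sq_eq (Φ : Γ.E) : ‖Φ‖ ^ 2 = ‖normSq Φ‖ := by
  apply le_antisymm
  · have h : ‖Φ‖ ≤ √‖normSq Φ‖ := by
      refine csInf_le ⟨0, fun _ h => h.1⟩ ⟨Real.sqrt_nonneg _, fun φ => ?_⟩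
      rw [Real.sq_sqrt (norm_nonneg _)]
      refine (apply_mul_self_le Φ φ).trans ?_
      rw [mul_comm, Algebra.smul_def, mul_comm (algebraMap _ _ _)]
      exact LInf.mul_le_mul_left' (Γ.inner₁_self_nonneg φ)
        ((LInf.norm_le_iff_le (normSq_nonneg Φ) (norm_nonneg _)).mp le_rfl)
    rw [← Real.sq_sqrt (norm_nonneg (normSq Φ))]
    exact pow_le_pow_left₀ (norm_nonneg _) h 2
  · rw [LInf.norm_le_iff_le (normSq_nonneg Φ) (sq_nonneg _)]
    refine normSq_le_of_mul_self_le ?_ fun φ => ?_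
    · rw [LInf.nonneg_iff]
      filter_upwards [LInf.coeFn_algebraMap (μ := μ) (‖Φ‖ ^ 2)] with x hx
      rw [hx]; positivity
    · rw [← Algebra.smul_def]; exact mul_self_le Φ φ

/-! ### The inner product of `E` -/

theorem exists_inner (Γ : DiffusionForm μ) : ∃ B : Γ.E →ₗ[LInf μ] Γ.E →ₗ[LInf μ] LInf μ,
    (∀ Φ Ψ, B Φ Ψ = B Ψ Φ) ∧ (∀ Φ, B Φ Φ = normSq Φ) ∧
      ∀ Φ Ψ, 4 * B Φ Ψ = normSq (Φ + Ψ) - normSq (Φ - Ψ) :=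
  exists_bilinear_of_quadratic normSq_smul normSq_add_add_normSq_sub normSq_nonneg

/-- The `L^∞`-valued inner product of `E`. -/
def inner (Γ : DiffusionForm μ) : Γ.E →ₗ[LInf μ] Γ.E →ₗ[LInf μ] LInf μ := (exists_inner Γ).choose

theorem inner_symm (Φ Ψ : Γ.E) : inner Γ Φ Ψ = inner Γ Ψ Φ := (exists_inner Γ).choose_spec.1 Φ Ψ

theorem inner_self (Φ : Γ.E) : inner Γ Φ Φ = normSq Φ := (exists_inner Γ).choose_spec.2.1 Φ

theorem inner_embed (φ : Γ.E₁) (Φ : Γ.E) : inner Γ (Γ.embed φ) Φ = Φ φ := by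
  have h := (exists_inner Γ).choose_spec.2.2 Φ (Γ.embed φ)
  change 4 * inner Γ Φ (Γ.embed φ) = _ at h
  rw [normSq_add_embed, normSq_sub_embed, legendre] at h
  rw [inner_symm]
  refine LInf.eq_of_add_self_eq (LInf.eq_of_add_self_eq ?_)
  linear_combination h

theorem inner_mul_self_le (Φ Ψ : Γ.E) :
    inner Γ Φ Ψ * inner Γ Φ Ψ ≤ normSq Φ * normSq Ψ := by
  refine LInf.mul_self_le_of_quadratic fun q => ?_
  refine (normSq_nonneg (algebraMap ℝ (LInf μ) q • Φ + Ψ)).trans_eq ?_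
  rw [← inner_self, LinearMap.map_add₂, map_add, map_add]
  simp only [map_smul, LinearMap.smul_apply, inner_self, inner_symm Ψ Φ]
  simp only [smul_eq_mul, ← Algebra.smul_def]
  module

theorem eq_zero_of_normSq_eq_zero {Φ : Γ.E} (h : normSq Φ = 0) : Φ = 0 := by
  rw [← norm_eq_zero]
  have := norm_sq_eq Φ
  rw [h, norm_zero] at this
  exact pow_eq_zero_iff two_ne_zero |>.mp this

theorem eq_of_inner_eq {Φ Ψ : Γ.E} (h : ∀ Θ, inner Γ Φ Θ = inner Γ Ψ Θ) : Φ = Ψ := by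
  rw [← sub_eq_zero]
  apply eq_zero_of_normSq_eq_zero
  rw [← inner_self, LinearMap.map_sub₂, h, sub_self]

/-! ### Approximation by the span of `E₁` -/

theorem normSq_glue {p : LInf μ} (hp : p * p = p) (Φ Ψ : Γ.E) :
    normSq (p • Φ + (1 - p) • Ψ) = p * normSq Φ + (1 - p) * normSq Ψ := by
  rw [← inner_self, LinearMap.map_add₂, map_add, map_add]
  simp only [map_smul, LinearMap.smul_apply, inner_self, inner_symm Ψ Φ, smul_eq_mul]
  linear_combination (normSq Φ - 2 * inner Γ Φ Ψ + normSq Ψ) * hp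

/-- Take `f` to be the indicator of the set where `Ψ` is closer to `Φ` than `Θ`; the cross terms
vanish since `f (1 - f) = 0`. -/
theorem exists_normSq_sub_eq_inf (Φ Ψ Θ : Γ.E) :
    ∃ f : LInf μ, normSq (Φ - (f • Ψ + (1 - f) • Θ)) = normSq (Φ - Ψ) ⊓ normSq (Φ - Θ) := by
  have hW : MeasurableSet {x | normSq (Φ - Ψ) x < normSq (Φ - Θ) x} :=
    measurableSet_lt (LInf.measurable _) (LInf.measurable _)
  set p : LInf μ := LInf.ind hW with hp
  refine ⟨p, ?_⟩
  have e : Φ - (p • Ψ + (1 - p) • Θ) = p • (Φ - Ψ) + (1 - p) • (Φ - Θ) := by module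
  have e1 : p * normSq (Φ - Ψ) + (1 - p) * normSq (Φ - Θ)
      = p * (normSq (Φ - Ψ) - normSq (Φ - Θ)) + normSq (Φ - Θ) := by ring
  rw [e, normSq_glue (LInf.ind_mul_self hW), e1]
  apply Lp.ext
  filter_upwards [LInf.coeFn_add (p * (normSq (Φ - Ψ) - normSq (Φ - Θ))) (normSq (Φ - Θ)),
    LInf.coeFn_mul p (normSq (Φ - Ψ) - normSq (Φ - Θ)),
    LInf.coeFn_sub (normSq (Φ - Ψ)) (normSq (Φ - Θ)), LInf.ae_ind (μ := μ) hW,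
    LInf.coeFn_inf (normSq (Φ - Ψ)) (normSq (Φ - Θ))] with x h1 h2 h3 h4 h5
  rw [h1, h2, h3, h5, hp]
  by_cases hx : normSq (Φ - Ψ) x < normSq (Φ - Θ) x
  · rw [h4.1 hx, min_eq_left hx.le]; ring
  · rw [h4.2 hx, min_eq_right (not_lt.mp hx)]; ring

/-- Every element of `E` is a pointwise limit of elements of the `L^∞`-span of `E₁`. -/
theorem exists_seq_span (Φ : Γ.E) : ∃ Ψ : ℕ → Γ.E,
    (∀ n, Ψ n ∈ Submodule.span (LInf μ) (range Γ.embed)) ∧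
    (∀ n, normSq (Φ - Ψ n) ≤ normSq Φ) ∧
    ∀ᵐ x ∂μ, Tendsto (fun n => normSq (Φ - Ψ n) x) atTop (𝓝 0) := by
  obtain ⟨s, hs⟩ := exists_seq_isLUB_normSq Φ
  have step : ∀ (Ψ : Submodule.span (LInf μ) (range Γ.embed)) (φ : Γ.E₁),
      ∃ Ψ' : Submodule.span (LInf μ) (range Γ.embed),
        normSq (Φ - (Ψ' : Γ.E)) = normSq (Φ - Γ.embed φ) ⊓ normSq (Φ - (Ψ : Γ.E)) := fun Ψ φ => by
    obtain ⟨f, hf⟩ := exists_normSq_sub_eq_inf Φ (Γ.embed φ) Ψ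
    exact ⟨⟨_, add_mem (Submodule.smul_mem _ f (Submodule.subset_span ⟨φ, rfl⟩))
      (Submodule.smul_mem _ (1 - f) Ψ.2)⟩, hf⟩
  choose next hnext using step
  -- Greedy gluing: `s n` replaces the current approximant exactly where it is closer to `Φ`. The
  -- error is a running minimum, whose limit is `0` because `s` attains the supremum.
  obtain ⟨Ψ, hΨ0, hΨ⟩ : ∃ Ψ : ℕ → Submodule.span (LInf μ) (range Γ.embed),
      Ψ 0 = 0 ∧ ∀ n, Ψ (n + 1) = next (Ψ n) (s n) :=
    ⟨fun n => Nat.rec 0 (fun n Ψ => next Ψ (s n)) n, rfl, fun _ => rfl⟩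
  have h0 : normSq (Φ - (Ψ 0 : Γ.E)) = normSq Φ := by
    rw [hΨ0, Submodule.coe_zero, sub_zero]
  have hsucc : ∀ n, normSq (Φ - (Ψ (n + 1) : Γ.E))
      = normSq (Φ - Γ.embed (s n)) ⊓ normSq (Φ - (Ψ n : Γ.E)) := fun n => by rw [hΨ]; exact hnext (Ψ n) (s n)
  have hanti : ∀ n, normSq (Φ - (Ψ n : Γ.E)) ≤ normSq Φ := fun n => by
    induction n with
    | zero => exact h0.le
    | succ n ih => rw [hsucc]; exact inf_le_right.trans ih
  refine ⟨fun n => Ψ n, fun n => (Ψ n).2, hanti, ?_⟩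
  filter_upwards [hs, ae_all_iff.mpr fun n => LInf.coeFn_inf (normSq (Φ - Γ.embed (s n)))
    (normSq (Φ - (Ψ n : Γ.E))),
    ae_all_iff.mpr fun n => LInf.nonneg_iff.mp (normSq_nonneg (Φ - (Ψ n : Γ.E))),
    ae_all_iff.mpr fun n => LInf.coeFn_sub (normSq Φ) (legendre Φ (s n))] with x h1 h2 h3 h4
  have hs' : ∀ n, normSq (Φ - (Ψ (n + 1) : Γ.E)) x
      = min (normSq Φ x - legendre Φ (s n) x) (normSq (Φ - (Ψ n : Γ.E)) x) := fun n => by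
    rw [hsucc, h2, normSq_sub_embed, h4]
  have hmono : Antitone fun n => normSq (Φ - (Ψ n : Γ.E)) x :=
    antitone_nat_of_succ_le fun n => by rw [hs']; exact min_le_right _ _
  rw [Metric.tendsto_atTop]
  intro ε hε
  obtain ⟨_, ⟨n, rfl⟩, hn⟩ := (lt_isLUB_iff h1).mp (sub_lt_self (normSq Φ x) hε)
  refine ⟨n + 1, fun m hm => ?_⟩
  rw [Real.dist_eq, sub_zero, abs_of_nonneg (h3 m)]
  refine (hmono hm).trans_lt ?_
  change normSq (Φ - (Ψ (n + 1) : Γ.E)) x < ε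
  rw [hs']
  exact (min_le_left _ _).trans_lt (by linarith)

/-- Kernels are `L^∞`-submodules, so `G` vanishes on the span of `E₁`, and a pointwise quadratic
bound passes to pointwise limits of such elements. -/
theorem eq_zero_of_embed {G : Γ.E →ₗ[LInf μ] LInf μ} {K : LInf μ}
    (hK : ∀ Φ, G Φ * G Φ ≤ K * normSq Φ) (h : ∀ φ, G (Γ.embed φ) = 0) : G = 0 := by
  refine LinearMap.ext fun Φ => ?_
  obtain ⟨Ψ, hΨ, -, hlim⟩ := exists_seq_span Φ
  have hspan : ∀ n, G (Ψ n) = 0 := fun n => by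
    have : Submodule.span (LInf μ) (range Γ.embed) ≤ LinearMap.ker G := by
      rw [Submodule.span_le]
      rintro _ ⟨φ, rfl⟩
      exact h φ
    exact this (hΨ n)
  have h1 : ∀ n, G Φ * G Φ ≤ K * normSq (Φ - Ψ n) := fun n => by
    have := hK (Φ - Ψ n)
    rwa [map_sub, hspan, sub_zero] at this
  apply Lp.ext
  filter_upwards [hlim, ae_all_iff.mpr fun n => LInf.le_iff.mp (h1 n), LInf.coeFn_mul (G Φ) (G Φ),
    ae_all_iff.mpr fun n => LInf.coeFn_mul K (normSq (Φ - Ψ n)), Lp.coeFn_zero ℝ ∞ μ]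
    with x a1 a2 a3 a4 a5
  rw [LinearMap.zero_apply, a5]
  have a6 := ge_of_tendsto' (a1.const_mul (K x)) fun n => (a2 n).trans_eq (a4 n)
  rw [mul_zero, a3] at a6
  exact mul_self_eq_zero.mp (le_antisymm a6 (mul_self_nonneg _))

/-- A bounded module homomorphism is bounded pointwise. -/
theorem dual_mul_self_le {F : Γ.E →ₗ[LInf μ] LInf μ} {C : ℝ} (hC : ∀ Φ, ‖F Φ‖ ≤ C * ‖Φ‖)
    (Φ : Γ.E) : F Φ * F Φ ≤ C ^ 2 • normSq Φ := by
  -- Cutting `Φ` down to `{normSq Φ ≤ r²}` gives norm at most `r`, so the scalar bound becomes a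
  -- pointwise one on that set. Letting rational `r` decrease to the square root of `normSq Φ` gives
  -- the estimate.
  have h1 : ∀ r : ℚ, 0 < r → ∀ᵐ x ∂μ, normSq Φ x ≤ (r : ℝ) ^ 2 → |F Φ x| ≤ |C| * r := by
    intro r hr
    have hr' : (0 : ℝ) < r := by exact_mod_cast hr
    have hA : MeasurableSet {x | normSq Φ x ≤ (r : ℝ) ^ 2} :=
      measurableSet_le (LInf.measurable _) measurable_const
    set p : LInf μ := LInf.ind hA with hp
    have h2 : ‖p • Φ‖ ≤ r := by
      rw [← abs_of_nonneg (norm_nonneg (p • Φ)), ← abs_of_pos hr', ← sq_le_sq, norm_sq_eq,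
        normSq_smul, LInf.ind_mul_self]
      refine LInf.norm_le_of_ae (sq_nonneg _) ?_
      filter_upwards [LInf.coeFn_mul p (normSq Φ), LInf.ae_ind (μ := μ) hA,
        LInf.nonneg_iff.mp (normSq_nonneg Φ)] with x a1 a2 a3
      rw [← hp, a1, hp]
      by_cases hx : normSq Φ x ≤ (r : ℝ) ^ 2
      · rw [a2.1 hx, one_mul, abs_of_nonneg a3]; exact hx
      · rw [a2.2 hx, zero_mul, abs_zero]; positivity
    have h3 : ‖p * F Φ‖ ≤ |C| * r := by
      have h4 := hC (p • Φ)
      rw [map_smul, smul_eq_mul] at h4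
      exact h4.trans (mul_le_mul (le_abs_self C) h2 (norm_nonneg _) (abs_nonneg _))
    filter_upwards [LInf.ae_norm_le (p * F Φ), LInf.coeFn_mul p (F Φ),
      LInf.ae_ind (μ := μ) hA] with x a1 a2 a3 hx
    rw [a2, hp, a3.1 hx, one_mul] at a1
    exact a1.trans h3
  have h2 : ∀ᵐ x ∂μ, ∀ r : ℚ, 0 < r → normSq Φ x ≤ (r : ℝ) ^ 2 → |F Φ x| ≤ |C| * r := by
    rw [ae_all_iff]; intro r
    rw [eventually_imp_distrib_left]; exact h1 r
  rw [LInf.le_iff]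
  filter_upwards [h2, LInf.coeFn_mul (F Φ) (F Φ), LInf.coeFn_smul (C ^ 2) (normSq Φ),
    LInf.nonneg_iff.mp (normSq_nonneg Φ)] with x a1 a2 a3 a4
  rw [a2, a3]
  have h3 : |F Φ x| ≤ |C| * √(normSq Φ x) := by
    refine le_of_forall_pos_le_add fun ε hε => ?_
    have h5 : 0 < ε / (|C| + 1) := by positivity
    obtain ⟨r, hr1, hr2⟩ := exists_rat_btwn (lt_add_of_pos_right (√(normSq Φ x)) h5)
    have hr0 : (0 : ℝ) < r := (Real.sqrt_nonneg _).trans_lt hr1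
    refine (a1 r (by exact_mod_cast hr0) ((Real.sqrt_le_left hr0.le).mp hr1.le)).trans ?_
    calc |C| * r ≤ |C| * (√(normSq Φ x) + ε / (|C| + 1)) :=
          mul_le_mul_of_nonneg_left hr2.le (abs_nonneg _)
      _ = |C| * √(normSq Φ x) + ε * (|C| / (|C| + 1)) := by ring
      _ ≤ |C| * √(normSq Φ x) + ε * 1 := by
        gcongr
        rw [div_le_one (by positivity)]; linarith
      _ = _ := by ring
  calc F Φ x * F Φ x = |F Φ x| * |F Φ x| := (abs_mul_abs_self _).symm
    _ ≤ (|C| * √(normSq Φ x)) * (|C| * √(normSq Φ x)) :=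
      mul_self_le_mul_self (abs_nonneg _) h3
    _ = (|C| * |C|) * (√(normSq Φ x) * √(normSq Φ x)) := by ring
    _ = C ^ 2 * normSq Φ x := by rw [Real.mul_self_sqrt a4, abs_mul_abs_self, sq]

/-- The representing element is forced: it is the restriction of `F` to `E₁`. The difference of the
two module maps vanishes on `E₁` and is pointwise bounded, hence is zero. -/
theorem self_dual {F : Γ.E →ₗ[LInf μ] LInf μ} (hF : F ∈ dualModule μ Γ.E) :
    ∃ Ψ, ∀ Φ, F Φ = inner Γ Φ Ψ := by
  obtain ⟨C, hC⟩ := hF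
  have hF := dual_mul_self_le hC
  let Ψ : Γ.E := ⟨{ toFun := fun φ => F (Γ.embed φ)
                    map_add' := fun φ ψ => by rw [embed_add, map_add]
                    map_smul' := fun a φ => by rw [embed_smul, map_smul]; rfl },
    |C|, abs_nonneg C, fun φ => by
      have h := hF (Γ.embed φ)
      rw [← inner_self, inner_embed] at h
      rwa [sq_abs]⟩
  have h1 : F - (inner Γ).flip Ψ = 0 := by
    refine eq_zero_of_embed (K := 2 * (algebraMap ℝ (LInf μ) (C ^ 2) + normSq Ψ))
      (fun Φ => ?_) fun φ => ?_
    · have h2 := inner_mul_self_le Φ Ψ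
      have h3 := hF Φ
      have h4 := LInf.sub_mul_self_le (F Φ) (inner Γ Φ Ψ)
      rw [Algebra.smul_def] at h3
      rw [← sub_nonneg] at h2 h3 h4 ⊢
      refine (add_nonneg h4 (add_nonneg (add_nonneg h2 h2) (add_nonneg h3 h3))).trans_eq ?_
      change _ = _ - (F Φ - inner Γ Φ Ψ) * (F Φ - inner Γ Φ Ψ)
      ring
    · rw [LinearMap.sub_apply, LinearMap.flip_apply, inner_embed]
      exact sub_self _
  exact ⟨Ψ, fun Φ => sub_eq_zero.mp (LinearMap.congr_fun h1 Φ)⟩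

end E

end DiffusionForm

end

end Weaver

namespace Weaver
noncomputable section

variable {X : Type*} [MeasurableSpace X] {μ : Measure X}

namespace LInf

/-! ### The dual of `L^1` -/

theorem coeFn_smul_L1 (f : LInf μ) (h : Lp ℝ 1 μ) :
    ⇑(f • h : Lp ℝ 1 μ) =ᵐ[μ] fun x => f x * h x := Lp.coeFn_lpSMul (r := 1) f h

theorem norm_smul_L1 (f : LInf μ) (h : Lp ℝ 1 μ) :
    ‖(f • h : Lp ℝ 1 μ)‖ = ∫ x, |f x| * |h x| ∂μ := by
  rw [L1.norm_eq_integral_norm]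
  apply integral_congr_ae
  filter_upwards [coeFn_smul_L1 f h] with x hx
  rw [hx, Real.norm_eq_abs, abs_mul]

theorem norm_smul_L1_of_nonneg {f : LInf μ} (hf : 0 ≤ f) {h : Lp ℝ 1 μ} (hh : ∀ᵐ x ∂μ, 0 ≤ h x) :
    ‖(f • h : Lp ℝ 1 μ)‖ = pairing f h := by
  rw [norm_smul_L1]
  apply integral_congr_ae
  filter_upwards [nonneg_iff.mp hf, hh] with x h1 h2
  rw [abs_of_nonneg h1, abs_of_nonneg h2]

/-- A bound of `L^2` functions from a bound of their integrals against positive functions. -/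
theorem le_of_L2_integral_le {u v : Lp ℝ 2 μ}
    (h : ∀ k : Lp ℝ 2 μ, (∀ᵐ x ∂μ, 0 ≤ k x) → ∫ x, u x * k x ∂μ ≤ ∫ x, v x * k x ∂μ) :
    ∀ᵐ x ∂μ, u x ≤ v x := by
  have hint : ∀ f g : Lp ℝ 2 μ, Integrable (fun x => f x * g x) μ := fun f g => by
    rw [← memLp_one_iff_integrable]
    exact (Lp.memLp g).mul (r := 1) (Lp.memLp f)
  set k := Lp.posPart (u - v) with hk
  have e : ∀ᵐ x ∂μ, k x = max (u x - v x) 0 := by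
    filter_upwards [Lp.coeFn_posPart (u - v), Lp.coeFn_sub u v] with x h1 h2
    rw [h1, h2]; rfl
  have h1 := h k (by filter_upwards [e] with x hx; rw [hx]; exact le_max_right _ _)
  have h2 : ∫ x, k x * k x ∂μ ≤ 0 := by
    rw [← sub_nonpos, ← integral_sub (hint u k) (hint v k)] at h1
    refine (integral_congr_ae ?_).trans_le h1
    filter_upwards [e] with x hx
    rw [hx]
    rcases le_total (u x - v x) 0 with h0 | h0
    · rw [max_eq_right h0]; ring
    · rw [max_eq_left h0]; ring
  have h3 := (integral_eq_zero_iff_of_nonneg (fun x => mul_self_nonneg (k x)) (hint k k)).mp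
    (le_antisymm h2 (integral_nonneg fun x => mul_self_nonneg _))
  filter_upwards [e, h3] with x h4 h5
  have h6 : k x = 0 := mul_self_eq_zero.mp h5
  rw [h6] at h4
  linarith [le_max_left (u x - v x) 0]

/-- For `w > 0` in `L^2`, the products of `w` with elements of `L^2` are dense in `L^1`. -/
theorem exists_seq_smul_tendsto {w : Lp ℝ 2 μ} (hw : ∀ᵐ x ∂μ, 0 < w x) (h : Lp ℝ 1 μ) :
    ∃ k : ℕ → Lp ℝ 2 μ, Tendsto (fun n => ‖h - (w • k n : Lp ℝ 1 μ)‖) atTop (𝓝 0) := by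
  have hwm : Measurable w := (Lp.stronglyMeasurable w).measurable
  have hhm : Measurable h := (Lp.stronglyMeasurable h).measurable
  have hi : Integrable h μ := L1.integrable_coeFn h
  -- On this set the square of `h / w` is at most `n |h|`, so the cut quotient lies in `L^2`; the
  -- sets exhaust the space.
  have hA : ∀ n : ℕ, MeasurableSet {x | |h x| ≤ n * w x ^ 2} := fun n =>
    measurableSet_le hhm.abs ((hwm.pow_const 2).const_mul _)
  have hk : ∀ n : ℕ, MemLp ({x | |h x| ≤ n * w x ^ 2}.indicator fun x => h x / w x) 2 μ := by
    intro n
    have hm : Measurable ({x | |h x| ≤ n * w x ^ 2}.indicator fun x => h x / w x) :=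
      (hhm.div hwm).indicator (hA n)
    rw [memLp_two_iff_integrable_sq hm.aestronglyMeasurable]
    refine (hi.abs.const_mul n).mono' (hm.pow_const 2).aestronglyMeasurable ?_
    filter_upwards [hw] with x hx
    rw [Real.norm_eq_abs, abs_of_nonneg (sq_nonneg _)]
    by_cases hxA : x ∈ {x | |h x| ≤ n * w x ^ 2}
    · rw [indicator_of_mem hxA, div_pow, div_le_iff₀ (pow_pos hx 2), ← sq_abs, sq]
      calc |h x| * |h x| ≤ |h x| * (n * w x ^ 2) := mul_le_mul_of_nonneg_left hxA (abs_nonneg _)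
        _ = _ := by ring
    · rw [indicator_of_notMem hxA]; rw [zero_pow two_ne_zero]; positivity
  refine ⟨fun n => (hk n).toLp _, ?_⟩
  have e : ∀ n, ‖h - (w • (hk n).toLp _ : Lp ℝ 1 μ)‖
      = ∫ x, ‖h x - {x | |h x| ≤ n * w x ^ 2}.indicator h x‖ ∂μ := fun n => by
    rw [L1.norm_eq_integral_norm]
    apply integral_congr_ae
    filter_upwards [Lp.coeFn_sub h (w • (hk n).toLp _ : Lp ℝ 1 μ),
      Lp.coeFn_lpSMul (r := 1) w ((hk n).toLp _), (hk n).coeFn_toLp, hw] with x h1 h2 h3 h4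
    rw [h1, Pi.sub_apply, h2, Pi.smul_apply', h3, smul_eq_mul]
    by_cases hxA : x ∈ {x | |h x| ≤ n * w x ^ 2}
    · rw [indicator_of_mem hxA, indicator_of_mem hxA, mul_div_cancel₀ _ h4.ne']
    · rw [indicator_of_notMem hxA, indicator_of_notMem hxA, mul_zero]
  simp only [e]
  have h0 : (0 : ℝ) = ∫ _, (0 : ℝ) ∂μ := by simp
  rw [h0]
  refine tendsto_integral_of_dominated_convergence (fun x => |h x|)
    (fun n => (hhm.sub (hhm.indicator (hA n))).norm.aestronglyMeasurable) hi.abs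
    (fun n => Eventually.of_forall fun x => ?_) ?_
  · rw [norm_norm, Real.norm_eq_abs]
    by_cases hxA : x ∈ {x | |h x| ≤ n * w x ^ 2}
    · rw [indicator_of_mem hxA, sub_self, abs_zero]; exact abs_nonneg _
    · rw [indicator_of_notMem hxA, sub_zero]
  · filter_upwards [hw] with x hx
    obtain ⟨N, hN⟩ := exists_nat_ge (|h x| / w x ^ 2)
    refine tendsto_const_nhds.congr' ?_
    filter_upwards [eventually_ge_atTop N] with n hn
    have hxA : x ∈ {x | |h x| ≤ n * w x ^ 2} := by
      rw [mem_ofPred_eq, ← div_le_iff₀ (pow_pos hx 2)]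
      exact hN.trans (by exact_mod_cast hn)
    rw [indicator_of_mem hxA, sub_self, norm_zero]

/-- `L^∞` is the dual of `L^1`. -/
theorem exists_eq_pairing [SigmaFinite μ] (F : Lp ℝ 1 μ →ₗ[ℝ] ℝ) {C : ℝ}
    (hF : ∀ h, |F h| ≤ C * ‖h‖) : ∃ f : LInf μ, ∀ h, F h = pairing f h := by
  obtain ⟨w, hw⟩ := exists_pos_L2 μ
  -- Pull the functional back to `L^2`, where the Riesz theorem gives a density `u`; then `u / w` is
  -- the wanted function.
  let G : Lp ℝ 2 μ →ₗ[ℝ] ℝ :=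
    { toFun := fun k => F (w • k : Lp ℝ 1 μ)
      map_add' := fun k k' => by
        rw [← map_add]
        congr 1
        apply Lp.ext
        filter_upwards [Lp.coeFn_lpSMul (r := 1) w (k + k'), Lp.coeFn_lpSMul (r := 1) w k,
          Lp.coeFn_lpSMul (r := 1) w k', Lp.coeFn_add k k',
          Lp.coeFn_add (w • k : Lp ℝ 1 μ) (w • k')] with x h1 h2 h3 h4 h5
        rw [h1, h5, Pi.add_apply, h2, h3, Pi.smul_apply', h4, Pi.add_apply, smul_add]; rfl
      map_smul' := fun c k => by
        rw [RingHom.id_apply, ← map_smul]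
        congr 1
        apply Lp.ext
        filter_upwards [Lp.coeFn_lpSMul (r := 1) w (c • k), Lp.coeFn_lpSMul (r := 1) w k,
          Lp.coeFn_smul c k, Lp.coeFn_smul c (w • k : Lp ℝ 1 μ)] with x h1 h2 h3 h4
        rw [h1, h4, Pi.smul_apply, h2, Pi.smul_apply', h3, Pi.smul_apply, Pi.smul_apply',
          smul_comm] }
  have hC : ∀ k : Lp ℝ 2 μ, |F (w • k : Lp ℝ 1 μ)| ≤ C * ∫ x, w x * |k x| ∂μ := fun k => by
    refine (hF _).trans_eq ?_
    rw [L1.norm_eq_integral_norm]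
    congr 1
    apply integral_congr_ae
    filter_upwards [Lp.coeFn_lpSMul (r := 1) w k, hw] with x h1 h2
    rw [h1, Pi.smul_apply', smul_eq_mul, Real.norm_eq_abs, abs_mul, abs_of_pos h2]
  have hGc : ∀ k, ‖G k‖ ≤ |C| * ‖w‖ * ‖k‖ := fun k => by
    refine (hF _).trans ?_
    rw [mul_assoc]
    exact mul_le_mul (le_abs_self C) (Lp.norm_smul_le w k) (norm_nonneg _) (abs_nonneg _)
  set u := (InnerProductSpace.toDual ℝ (Lp ℝ 2 μ)).symm (G.mkContinuous _ hGc) with hu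
  have hGu : ∀ k : Lp ℝ 2 μ, F (w • k : Lp ℝ 1 μ) = ∫ x, u x * k x ∂μ := fun k => by
    have h1 : inner ℝ u k = G k := by
      rw [hu, InnerProductSpace.toDual_symm_apply, LinearMap.mkContinuous_apply]
    rw [L2.inner_def] at h1
    refine h1.symm.trans (integral_congr_ae (Eventually.of_forall fun x => ?_))
    simp [mul_comm]
  have hint : ∀ k : Lp ℝ 2 μ, (∀ᵐ x ∂μ, 0 ≤ k x) → |∫ x, u x * k x ∂μ| ≤ ∫ x, (C • w) x * k x ∂μ := by
    intro k hk
    rw [← hGu]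
    refine (hC k).trans_eq ?_
    rw [← integral_const_mul]
    apply integral_congr_ae
    filter_upwards [hk, Lp.coeFn_smul C w] with x h1 h2
    rw [abs_of_nonneg h1, h2, Pi.smul_apply, smul_eq_mul, mul_assoc]
  -- Testing against nonnegative `k` shows `|u| ≤ C w` almost everywhere, which makes `u / w`
  -- bounded.
  have hb1 := le_of_L2_integral_le (u := u) (v := C • w) fun k hk =>
    (le_abs_self _).trans (hint k hk)
  have hb2 := le_of_L2_integral_le (u := -u) (v := C • w) fun k hk => by
    refine le_trans (le_of_eq ?_) ((neg_le_abs _).trans (hint k hk))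
    rw [← integral_neg]
    apply integral_congr_ae
    filter_upwards [Lp.coeFn_neg u] with x hx
    rw [hx, Pi.neg_apply, neg_mul]
  obtain ⟨f, hf⟩ := exists_ae_eq (μ := μ) (f := fun x => u x / w x) (C := C)
    ((Lp.stronglyMeasurable u).measurable.div
      (Lp.stronglyMeasurable w).measurable).aestronglyMeasurable (by
      filter_upwards [hw, hb1, hb2, Lp.coeFn_smul C w, Lp.coeFn_neg u] with x h1 h2 h3 h4 h5
      rw [h4, Pi.smul_apply, smul_eq_mul] at h2 h3
      rw [h5, Pi.neg_apply] at h3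
      rw [abs_div, abs_of_pos h1, div_le_iff₀ h1]
      exact abs_le.mpr ⟨by linarith, h2⟩)
  refine ⟨f, fun h => ?_⟩
  have hfw : ∀ k : Lp ℝ 2 μ, F (w • k : Lp ℝ 1 μ) = pairing f (w • k : Lp ℝ 1 μ) := fun k => by
    rw [hGu]
    apply integral_congr_ae
    filter_upwards [hf, hw, Lp.coeFn_lpSMul (r := 1) w k] with x h1 h2 h3
    rw [h1, h3, Pi.smul_apply', smul_eq_mul, ← mul_assoc, div_mul_cancel₀ _ h2.ne']
  obtain ⟨k, hk⟩ := exists_seq_smul_tendsto hw h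
  have hd : ∀ n, |F h - pairing f h| ≤ (C + ‖f‖) * ‖h - (w • k n : Lp ℝ 1 μ)‖ := fun n => by
    have e : F h - pairing f h = F (h - (w • k n : Lp ℝ 1 μ))
        - pairing f (h - (w • k n : Lp ℝ 1 μ)) := by
      rw [map_sub, hfw]
      have : pairing f (h - (w • k n : Lp ℝ 1 μ)) = pairing f h - pairing f (w • k n) := by
        simp only [← pairingL_apply, map_sub, LinearMap.sub_apply]
      rw [this]; ring
    rw [e, add_mul]
    exact (abs_sub _ _).trans (add_le_add (hF _) (abs_pairing_le _ _))
  have h1 := ge_of_tendsto' (hk.const_mul (C + ‖f‖)) hd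
  rw [mul_zero] at h1
  exact sub_eq_zero.mp (abs_eq_zero.mp (le_antisymm h1 (abs_nonneg _)))

theorem exists_norm_le_one_pairing_eq (h : Lp ℝ 1 μ) :
    ∃ f : LInf μ, ‖f‖ ≤ 1 ∧ pairing f h = ‖h‖ := by
  have hm : Measurable h := (Lp.stronglyMeasurable h).measurable
  have hb : ∀ x, |if 0 ≤ h x then (1 : ℝ) else -1| ≤ 1 := fun x => by split_ifs <;> simp
  obtain ⟨f, hf⟩ := exists_ae_eq (μ := μ) (f := fun x => if 0 ≤ h x then (1 : ℝ) else -1) (C := 1)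
    (Measurable.ite (measurableSet_le measurable_const hm) measurable_const
      measurable_const).aestronglyMeasurable (Eventually.of_forall hb)
  refine ⟨f, norm_le_of_ae zero_le_one (by filter_upwards [hf] with x hx; rw [hx]; exact hb x), ?_⟩
  rw [L1.norm_eq_integral_norm]
  apply integral_congr_ae
  filter_upwards [hf] with x hx
  rw [hx, Real.norm_eq_abs]
  split_ifs with h0
  · rw [one_mul, abs_of_nonneg h0]
  · rw [abs_of_neg (not_le.mp h0)]; ring

/-- The embedding of `L^1` in the dual of `L^∞`. -/
def pairingIsometry (μ : Measure X) : Lp ℝ 1 μ →ₗᵢ[ℝ] StrongDual ℝ (LInf μ) where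
  toFun h := (pairingL μ h).mkContinuous ‖h‖ fun f => by
    rw [pairingL_apply, mul_comm]; exact abs_pairing_le f h
  map_add' h k := by ext f; simp
  map_smul' c h := by ext f; simp
  norm_map' h := by
    refine le_antisymm (LinearMap.mkContinuous_norm_le _ (norm_nonneg _) (fun f => by
      rw [pairingL_apply, mul_comm]; exact abs_pairing_le f h)) ?_
    obtain ⟨f, hf, e⟩ := exists_norm_le_one_pairing_eq h
    conv_lhs => rw [← e]
    refine ((le_abs_self _).trans (ContinuousLinearMap.le_opNorm ((pairingL μ h).mkContinuous ‖h‖ fun f => by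
      rw [pairingL_apply, mul_comm]; exact abs_pairing_le f h) f)).trans
      (mul_le_of_le_one_right (norm_nonneg _) hf)

/-- For `k ≥ 0` the right side is `C ∫ r k`, so both `u` and `-u` are at most `C r`. This turns an
`L^1` estimate into a pointwise one. -/
theorem mul_self_le_of_abs_pairing_le [SigmaFinite μ] {u r : LInf μ} (hr : 0 ≤ r) {C : ℝ}
    (h : ∀ k : Lp ℝ 1 μ, |pairing u k| ≤ C * ‖(r • k : Lp ℝ 1 μ)‖) :
    u * u ≤ C ^ 2 • (r * r) := by
  have h1 : u ≤ C • r := le_of_pairing_le fun k hk => by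
    rw [pairing_smul, ← norm_smul_L1_of_nonneg hr hk]
    exact (le_abs_self _).trans (h k)
  have h2 : -u ≤ C • r := le_of_pairing_le fun k hk => by
    rw [pairing_smul, pairing_neg, ← norm_smul_L1_of_nonneg hr hk]
    exact (neg_le_abs _).trans (h k)
  rw [le_iff] at h1 h2 ⊢
  filter_upwards [h1, h2, coeFn_neg u, coeFn_smul C r, coeFn_mul u u, coeFn_smul (C ^ 2) (r * r),
    coeFn_mul r r] with x a1 a2 a3 a4 a5 a6 a7
  rw [a4] at a1 a2
  rw [a3] at a2
  rw [a5, a6, a7]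
  have := abs_le_abs a1 a2
  rw [← sq_le_sq] at this
  calc u x * u x = u x ^ 2 := (sq _).symm
    _ ≤ (C * r x) ^ 2 := this
    _ = _ := by ring

end LInf

end

end Weaver

namespace Weaver
noncomputable section

variable {X : Type*} [MeasurableSpace X] {μ : Measure X}

/-! ### Banach space preliminaries on preduals -/

theorem eq_zero_or_one_of_mul_self {a : ℝ} (h : a = a * a) : a = 0 ∨ a = 1 := by
  have : a * (a - 1) = 0 := by linear_combination -h
  exact (mul_eq_zero.mp this).imp_right sub_eq_zero.mp

/-- Serves to extend the vanishing of a bounded functional on `P` from generators to their closed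
span. -/
theorem isClosed_map_ker {W : Type*} [NormedAddCommGroup W] [NormedSpace ℝ W] {P : Submodule ℝ W}
    (hP : IsClosed (P : Set W)) (η : P →ₗ[ℝ] ℝ) {C : ℝ} (hη : ∀ p : P, |η p| ≤ C * ‖(p : W)‖) :
    IsClosed ((LinearMap.ker η).map P.subtype : Set W) := by
  rw [Submodule.map_coe]
  exact hP.isClosedEmbedding_subtypeVal.isClosedMap _ (η.mkContinuous C hη).isClosed_ker

/-- The hypotheses make `V` isometric to the Banach dual of `P`, and a dual space is complete. -/
theorem completeSpace_of_predual {V W : Type*} [NormedAddCommGroup V] [NormedSpace ℝ V]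
    [NormedAddCommGroup W] [NormedSpace ℝ W] (P : Submodule ℝ W) (β : V →ₗ[ℝ] W →ₗ[ℝ] ℝ)
    (hβ : ∀ v p, |β v p| ≤ ‖v‖ * ‖p‖)
    (hnorm : ∀ (v : V) (C : ℝ), 0 ≤ C → (∀ p ∈ P, |β v p| ≤ C * ‖p‖) → ‖v‖ ≤ C)
    (hsurj : ∀ ξ : P →ₗ[ℝ] ℝ, (∃ C : ℝ, ∀ p : P, |ξ p| ≤ C * ‖(p : W)‖) →
      ∃ v : V, ∀ p : P, ξ p = β v p) : CompleteSpace V := by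
  have hle : ∀ v : V,
      ‖((β v).comp P.subtype).mkContinuous ‖v‖ fun p => hβ v p‖ ≤ ‖v‖ := fun v =>
    LinearMap.mkContinuous_norm_le _ (norm_nonneg v) _
  have hge : ∀ v : V, ‖v‖ ≤ ‖((β v).comp P.subtype).mkContinuous ‖v‖ fun p => hβ v p‖ :=
    fun v => hnorm v _ (ContinuousLinearMap.opNorm_nonneg _) fun p hp =>
      (((β v).comp P.subtype).mkContinuous ‖v‖ fun p => hβ v p).le_opNorm ⟨p, hp⟩
  let J : V →ₗᵢ[ℝ] StrongDual ℝ P :=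
    { toFun := fun v => ((β v).comp P.subtype).mkContinuous ‖v‖ fun p => hβ v p
      map_add' := fun v w => ContinuousLinearMap.ext fun p => LinearMap.map_add₂ β v w p
      map_smul' := fun c v => ContinuousLinearMap.ext fun p => LinearMap.map_smul₂ β c v p
      norm_map' := fun v => (hle v).antisymm (hge v) }
  have hs : Function.Surjective J := fun ξ => by
    obtain ⟨v, hv⟩ := hsurj ξ.toLinearMap ⟨‖ξ‖, fun p => ξ.le_opNorm p⟩
    exact ⟨v, ContinuousLinearMap.ext fun p => (hv p).symm⟩
  have e := (LinearIsometryEquiv.ofSurjective J hs).toIsometryEquiv.isometry.isUniformEmbedding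
  exact (completeSpace_congr (e := (LinearIsometryEquiv.ofSurjective J hs).toEquiv) e).mpr
    inferInstance

theorem continuous_predualTopology_iff {V Y : Type*} [NormedAddCommGroup V] [NormedSpace ℝ V]
    {P : Submodule ℝ (StrongDual ℝ V)} [TopologicalSpace Y] {g : Y → V} :
    @Continuous _ _ _ (predualTopology P) g ↔ ∀ p ∈ P, Continuous fun y => p (g y) := by
  rw [continuous_induced_rng, continuous_pi_iff]
  exact ⟨fun h p hp => h ⟨p, hp⟩, fun h p => h p p.2⟩

theorem continuous_apply_of_mem_predual {V : Type*} [NormedAddCommGroup V] [NormedSpace ℝ V]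
    {P : Submodule ℝ (StrongDual ℝ V)} {p : StrongDual ℝ V} (hp : p ∈ P) :
    @Continuous _ _ (predualTopology P) _ fun v => p v :=
  (@continuous_predualTopology_iff V V _ _ P (predualTopology P) id).mp
    (@continuous_id _ (predualTopology P)) p hp

namespace DiffusionForm

namespace E

variable {Γ : DiffusionForm μ}

theorem norm_smul_le (f : LInf μ) (Φ : Γ.E) : ‖f • Φ‖ ≤ ‖f‖ * ‖Φ‖ :=
  csInf_le ⟨0, fun _ h => h.1⟩
    ⟨by positivity, (norm_mem Γ Φ).2.smul Γ f⟩

theorem smul_comm_real (c : ℝ) (f : LInf μ) (Φ : Γ.E) : (c • f) • Φ = c • f • Φ :=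
  ext fun φ => smul_mul_assoc c f (Φ φ)

theorem isClosed_predual : IsClosed (predual Γ : Set (StrongDual ℝ Γ.E)) :=
  Submodule.isClosed_topologicalClosure _

variable [SigmaFinite μ]

/-! ### The predual of `E` -/

theorem norm_inner_le (Φ Ψ : Γ.E) : ‖inner Γ Φ Ψ‖ ≤ ‖Φ‖ * ‖Ψ‖ := by
  refine LInf.norm_le_of_ae (by positivity) ?_
  filter_upwards [LInf.le_iff.mp (inner_mul_self_le Φ Ψ), LInf.coeFn_mul (inner Γ Φ Ψ) (inner Γ Φ Ψ),
    LInf.coeFn_mul (normSq Φ) (normSq Ψ), LInf.ae_norm_le (normSq Φ), LInf.ae_norm_le (normSq Ψ),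
    LInf.nonneg_iff.mp (normSq_nonneg Ψ)] with x h1 h2 h3 h4 h5 h6
  rw [h2, h3] at h1
  rw [← norm_sq_eq] at h4 h5
  refine abs_le_of_sq_le_sq ?_ (by positivity)
  rw [sq, mul_pow]
  exact h1.trans (mul_le_mul ((le_abs_self _).trans h4) ((le_abs_self _).trans h5)
    h6 (sq_nonneg _))

/-- Cauchy–Schwarz keeping the pointwise length `r` of `Ψ` under the integral. The weaker bound by
`‖Ψ‖ * ‖h‖` would lose the local information needed for density and for `isBound_of_abs_pairing_le`.
-/
theorem abs_pairing_inner_le {r : LInf μ} (hr : 0 ≤ r) {Ψ : Γ.E} (hrΨ : r * r = normSq Ψ) (Φ : Γ.E)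
    (h : Lp ℝ 1 μ) : |LInf.pairing (inner Γ Φ Ψ) h| ≤ ‖(r • h : Lp ℝ 1 μ)‖ * ‖Φ‖ := by
  rw [LInf.norm_smul_L1, mul_comm, ← integral_const_mul]
  refine abs_integral_le_integral_abs.trans ?_
  refine integral_mono_ae (LInf.integrable_pairing _ h).abs ?_ ?_
  · refine Integrable.const_mul ?_ _
    refine (LInf.integrable_pairing r h).abs.congr (Eventually.of_forall fun x => abs_mul _ _)
  · filter_upwards [LInf.le_iff.mp (inner_mul_self_le Φ Ψ),
      LInf.coeFn_mul (inner Γ Φ Ψ) (inner Γ Φ Ψ), LInf.coeFn_mul (normSq Φ) (normSq Ψ),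
      LInf.ae_norm_le (normSq Φ), LInf.coeFn_mul r r, LInf.nonneg_iff.mp hr] with x h1 h2 h3 h4 h5 h6
    rw [h2, h3, ← hrΨ, h5] at h1
    rw [← norm_sq_eq] at h4
    rw [abs_mul, ← mul_assoc]
    refine mul_le_mul_of_nonneg_right ?_ (abs_nonneg _)
    refine abs_le_of_sq_le_sq ?_ (by positivity)
    rw [sq, mul_pow, sq_abs, sq (r x)]
    exact h1.trans (mul_le_mul_of_nonneg_right ((le_abs_self _).trans h4) (mul_self_nonneg _))

theorem inner_real_smul_left (c : ℝ) (Φ Ψ : Γ.E) : inner Γ (c • Φ) Ψ = c • inner Γ Φ Ψ := by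
  have : c • Φ = algebraMap ℝ (LInf μ) c • Φ :=
    ext fun φ => by rw [smul_apply, real_smul_apply, Algebra.smul_def]
  rw [this, map_smul, LinearMap.smul_apply, smul_eq_mul, Algebra.smul_def]

/-- The functional `Φ ↦ ∫ ⟨Φ, Ψ⟩ h dμ`. -/
def functional (Ψ : Γ.E) (h : Lp ℝ 1 μ) : StrongDual ℝ Γ.E :=
  LinearMap.mkContinuous
    { toFun := fun Φ => LInf.pairing (inner Γ Φ Ψ) h
      map_add' := fun Φ Φ' => by rw [LinearMap.map_add₂, LInf.pairing_add]
      map_smul' := fun c Φ => by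
        rw [inner_real_smul_left, LInf.pairing_smul]; rfl }
    (‖Ψ‖ * ‖h‖) fun Φ => by
      refine (LInf.abs_pairing_le _ h).trans ?_
      rw [mul_right_comm, mul_comm ‖Ψ‖]
      exact mul_le_mul_of_nonneg_right (norm_inner_le Φ Ψ) (norm_nonneg _)

theorem functional_apply (Ψ : Γ.E) (h : Lp ℝ 1 μ) (Φ : Γ.E) :
    functional Ψ h Φ = LInf.pairing (inner Γ Φ Ψ) h := rfl

theorem functional_embed_apply (φ : Γ.E₁) (h : Lp ℝ 1 μ) (Φ : Γ.E) :
    functional (Γ.embed φ) h Φ = LInf.pairing (Φ φ) h := by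
  rw [functional_apply, inner_symm, inner_embed]

theorem norm_functional_le {r : LInf μ} (hr : 0 ≤ r) {Ψ : Γ.E} (hrΨ : r * r = normSq Ψ)
    (h : Lp ℝ 1 μ) : ‖functional Ψ h‖ ≤ ‖(r • h : Lp ℝ 1 μ)‖ :=
  ContinuousLinearMap.opNorm_le_bound _ (norm_nonneg _) fun Φ => abs_pairing_inner_le hr hrΨ Φ h

theorem norm_functional_le' (Ψ : Γ.E) (h : Lp ℝ 1 μ) : ‖functional Ψ h‖ ≤ ‖Ψ‖ * ‖h‖ :=
  LinearMap.mkContinuous_norm_le _ (by positivity) _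

theorem functional_smul_left (f : LInf μ) (Ψ : Γ.E) (h : Lp ℝ 1 μ) :
    functional (f • Ψ) h = functional Ψ (f • h : Lp ℝ 1 μ) := by
  ext Φ
  rw [functional_apply, functional_apply, map_smul, smul_eq_mul, LInf.pairing_mul]

theorem functional_add_left (Ψ Ψ' : Γ.E) (h : Lp ℝ 1 μ) :
    functional (Ψ + Ψ') h = functional Ψ h + functional Ψ' h := by
  ext Φ
  rw [_root_.add_apply, functional_apply, map_add, LInf.pairing_add]; rfl

theorem functional_sub_left (Ψ Ψ' : Γ.E) (h : Lp ℝ 1 μ) :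
    functional (Ψ - Ψ') h = functional Ψ h - functional Ψ' h := by
  ext Φ
  rw [_root_.sub_apply, functional_apply, map_sub, LInf.pairing_sub]; rfl

theorem predual_le {S : Submodule ℝ (StrongDual ℝ Γ.E)} (hS : IsClosed (S : Set (StrongDual ℝ Γ.E)))
    (h : ∀ φ k, functional (Γ.embed φ) k ∈ S) : predual Γ ≤ S := by
  refine Submodule.topologicalClosure_minimal _ (Submodule.span_le.mpr ?_) hS
  rintro p ⟨φ, k, hp⟩
  have : p = functional (Γ.embed φ) k := by
    ext Φ; rw [hp, functional_embed_apply]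
  rw [this]; exact h φ k

theorem functional_embed_mem_predual (φ : Γ.E₁) (h : Lp ℝ 1 μ) :
    functional (Γ.embed φ) h ∈ predual Γ :=
  Submodule.le_topologicalClosure _ (Submodule.subset_span ⟨φ, h, functional_embed_apply φ h⟩)

/-- The generators involve only `E₁`. Coefficients in `L^∞` can be moved onto `h`, which covers the
span of `E₁`, and pointwise approximation of `Ψ` gives norm convergence of the functionals by
dominated convergence. -/
theorem functional_mem_predual (Ψ : Γ.E) (h : Lp ℝ 1 μ) : functional Ψ h ∈ predual Γ := by
  have hspan : ∀ Θ ∈ Submodule.span (LInf μ) (range Γ.embed), ∀ h, functional Θ h ∈ predual Γ := by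
    intro Θ hΘ
    induction hΘ using Submodule.span_induction with
    | mem Θ hΘ =>
      obtain ⟨φ, rfl⟩ := hΘ
      exact functional_embed_mem_predual φ
    | zero =>
      intro h
      have : functional (0 : Γ.E) h = 0 := by
        have := functional_sub_left (0 : Γ.E) 0 h
        rwa [sub_self, sub_self] at this
      rw [this]; exact zero_mem _
    | add Θ Θ' _ _ h1 h2 =>
      intro h; rw [functional_add_left]; exact add_mem (h1 h) (h2 h)
    | smul f Θ _ h1 => intro h; rw [functional_smul_left]; exact h1 _
  obtain ⟨Θ, hΘ, hle, hlim⟩ := exists_seq_span Ψ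
  choose r hr0 hr using fun n => LInf.exists_sqrt (normSq_nonneg (Ψ - Θ n))
  have hr' : Tendsto (fun n => ‖(r n • h : Lp ℝ 1 μ)‖) atTop (𝓝 0) := by
    simp only [LInf.norm_smul_L1]
    have h0 : (0 : ℝ) = ∫ _, (0 : ℝ) ∂μ := by simp
    rw [h0]
    have hr2 : ∀ n, ∀ᵐ x ∂μ, |r n x| = √(normSq (Ψ - Θ n) x) := fun n => by
      filter_upwards [LInf.coeFn_mul (r n) (r n)] with x hx
      rw [← hr, hx, Real.sqrt_mul_self_eq_abs]
    refine tendsto_integral_of_dominated_convergence (fun x => ‖Ψ‖ * |h x|)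
      (fun n => ?_) ((L1.integrable_coeFn h).abs.const_mul _) (fun n => ?_) ?_
    · exact ((r n).measurable.abs.mul
        (Lp.stronglyMeasurable h).measurable.abs).aestronglyMeasurable
    · filter_upwards [hr2 n, LInf.le_iff.mp (hle n), LInf.ae_norm_le (normSq Ψ)] with x h1 h2 h3
      rw [Real.norm_eq_abs, abs_mul, abs_abs, abs_abs, h1]
      refine mul_le_mul_of_nonneg_right ?_ (abs_nonneg _)
      rw [Real.sqrt_le_left (norm_nonneg _), norm_sq_eq]
      exact h2.trans ((le_abs_self _).trans h3)
    · filter_upwards [hlim, ae_all_iff.mpr hr2] with x h1 h2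
      simp only [h2]
      have h3 := ((Real.continuous_sqrt.tendsto 0).comp h1).mul_const |h x|
      rwa [Real.sqrt_zero, zero_mul] at h3
  refine isClosed_predual.mem_of_tendsto (f := fun n => functional (Θ n) h) (b := atTop) ?_
    (Eventually.of_forall fun n => hspan _ (hΘ n) h)
  rw [tendsto_iff_norm_sub_tendsto_zero]
  refine squeeze_zero (fun n => norm_nonneg _) (fun n => ?_) hr'
  rw [norm_sub_rev, ← functional_sub_left]
  exact norm_functional_le (hr0 n) (hr n) h

/-! ### `E` is an abelian W*-module -/

/-- The functional of `φ` and `k` has norm at most the `L^1` norm of `⟨φ, φ⟩^(1/2) k`; letting `k`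
vary turns the scalar bound into an almost everywhere one. -/
theorem isBound_of_abs_pairing_le {Φ : Γ.E₁ →ₗ[Γ.domain] LInf μ} {C : ℝ} (hC : 0 ≤ C)
    (h : ∀ φ k, |LInf.pairing (Φ φ) k| ≤ C * ‖functional (Γ.embed φ) k‖) : Γ.IsBound Φ C := by
  intro φ
  obtain ⟨r, hr0, hr⟩ := LInf.exists_sqrt (Γ.inner₁_self_nonneg φ)
  rw [← hr]
  refine LInf.mul_self_le_of_abs_pairing_le hr0 fun k => (h φ k).trans ?_
  refine mul_le_mul_of_nonneg_left (norm_functional_le hr0 ?_ k) hC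
  rw [hr, ← inner_self, inner_embed]; rfl

theorem norm_le_of_apply_le {Φ : Γ.E} {C : ℝ} (hC : 0 ≤ C)
    (h : ∀ p ∈ predual Γ, |p Φ| ≤ C * ‖p‖) : ‖Φ‖ ≤ C :=
  csInf_le ⟨0, fun _ h => h.1⟩ ⟨hC, isBound_of_abs_pairing_le hC fun φ k => by
    have h1 := h _ (functional_embed_mem_predual φ k)
    rwa [functional_embed_apply] at h1⟩

theorem isLUB_norm (Φ : Γ.E) : IsLUB {r : ℝ | ∃ p ∈ predual Γ, ‖p‖ ≤ 1 ∧ r = p Φ} ‖Φ‖ := by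
  refine ⟨?_, fun b hb => ?_⟩
  · rintro _ ⟨p, -, hp, rfl⟩
    exact (le_abs_self _).trans ((p.le_opNorm Φ).trans (mul_le_of_le_one_left (norm_nonneg _) hp))
  · have hb0 : 0 ≤ b := hb ⟨0, zero_mem _, by simp, by simp⟩
    have key : ∀ p ∈ predual Γ, p Φ ≤ b * ‖p‖ := fun p hp => by
      rcases eq_or_ne p 0 with rfl | hp0
      · simp
      · have h1 := hb ⟨‖p‖⁻¹ • p, (predual Γ).smul_mem _ hp, by
          rw [norm_smul, norm_inv, norm_norm, inv_mul_cancel₀ (norm_ne_zero_iff.mpr hp0)], rfl⟩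
        have hpos : 0 < ‖p‖ := norm_pos_iff.mpr hp0
        rw [_root_.smul_apply, smul_eq_mul, inv_mul_le_iff₀ hpos] at h1
        rwa [mul_comm]
    refine norm_le_of_apply_le hb0 fun p hp => abs_le'.mpr ⟨key p hp, ?_⟩
    have := key (-p) ((predual Γ).neg_mem hp)
    rwa [norm_neg] at this

/-- For fixed `φ`, the map `h ↦ ξ(Φ ↦ ∫ Φ(φ) h)` is bounded on `L^1`, hence given by some `u φ` in
`L^∞`. The assignment `φ ↦ u φ` is the required element of `E`. -/
theorem exists_apply_eq (ξ : predual Γ →ₗ[ℝ] ℝ) {C : ℝ}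
    (hξ : ∀ p : predual Γ, |ξ p| ≤ C * ‖(p : StrongDual ℝ Γ.E)‖) :
    ∃ Φ : Γ.E, ∀ p : predual Γ, ξ p = (p : StrongDual ℝ Γ.E) Φ := by
  have hξ' : ∀ p : predual Γ, |ξ p| ≤ |C| * ‖(p : StrongDual ℝ Γ.E)‖ := fun p =>
    (hξ p).trans (mul_le_mul_of_nonneg_right (le_abs_self C) (norm_nonneg _))
  have hadd : ∀ (φ : Γ.E₁) (h k : Lp ℝ 1 μ), functional (Γ.embed φ) (h + k)
      = functional (Γ.embed φ) h + functional (Γ.embed φ) k := fun φ h k => by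
    ext Φ
    simp only [_root_.add_apply, functional_apply, ← LInf.pairingL_apply, map_add,
      LinearMap.add_apply]
  have hsmul : ∀ (φ : Γ.E₁) (c : ℝ) (h : Lp ℝ 1 μ), functional (Γ.embed φ) (c • h)
      = c • functional (Γ.embed φ) h := fun φ c h => by
    ext Φ
    simp only [_root_.smul_apply, functional_apply, ← LInf.pairingL_apply, map_smul,
      LinearMap.smul_apply]
  let g : Γ.E₁ → Lp ℝ 1 μ → predual Γ := fun φ h => ⟨_, functional_embed_mem_predual φ h⟩
  have hrep : ∀ φ, ∃ u : LInf μ, ∀ h, ξ (g φ h) = LInf.pairing u h := fun φ => by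
    refine LInf.exists_eq_pairing (C := |C| * ‖Γ.embed φ‖)
      { toFun := fun h => ξ (g φ h)
        map_add' := fun h k => by
          rw [← map_add]; congr 1; exact Subtype.ext (hadd φ h k)
        map_smul' := fun c h => by
          rw [RingHom.id_apply, ← map_smul]; congr 1; exact Subtype.ext (hsmul φ c h) } fun h => ?_
    refine (hξ' _).trans ?_
    rw [mul_assoc]
    refine mul_le_mul_of_nonneg_left ?_ (abs_nonneg _)
    exact norm_functional_le' _ h
  choose u hu using hrep
  let Φ₀ : Γ.E₁ →ₗ[Γ.domain] LInf μ :=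
    { toFun := u
      map_add' := fun φ ψ => LInf.eq_of_pairing_eq fun h => by
        rw [LInf.pairing_add, ← hu, ← hu, ← hu, ← map_add]
        congr 1
        refine Subtype.ext ?_
        change functional _ _ = functional _ _ + functional _ _
        rw [embed_add, functional_add_left]
      map_smul' := fun a φ => LInf.eq_of_pairing_eq fun h => by
        change _ = LInf.pairing ((a : LInf μ) * u φ) h
        rw [LInf.pairing_mul, ← hu, ← hu]
        congr 1
        refine Subtype.ext ?_
        change functional _ _ = functional _ _
        rw [embed_smul, functional_smul_left] }
  let Φ : Γ.E := ⟨Φ₀, |C|, abs_nonneg C, isBound_of_abs_pairing_le (abs_nonneg C) fun φ k => by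
    change |LInf.pairing (u φ) k| ≤ _
    rw [← hu]; exact hξ' _⟩
  have hΦ : ∀ φ, Φ φ = u φ := fun φ => rfl
  refine ⟨Φ, fun p => ?_⟩
  let η : predual Γ →ₗ[ℝ] ℝ :=
    { toFun := fun p => ξ p - (p : StrongDual ℝ Γ.E) Φ
      map_add' := fun p q => by
        rw [map_add]
        change ξ p + ξ q - ((p : StrongDual ℝ Γ.E) Φ + (q : StrongDual ℝ Γ.E) Φ) = _
        ring
      map_smul' := fun c p => by
        rw [map_smul]
        change c * ξ p - c * (p : StrongDual ℝ Γ.E) Φ = c * _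
        ring }
  have hη : ∀ p, η p = ξ p - (p : StrongDual ℝ Γ.E) Φ := fun p => rfl
  -- Evaluation at `Φ` agrees with `ξ` on generators by construction; closedness of the kernel of
  -- the difference extends this to the whole predual.
  have hcl := isClosed_map_ker isClosed_predual η (C := |C| + ‖Φ‖) fun p => by
    rw [hη, add_mul, mul_comm ‖Φ‖]
    exact (abs_sub _ _).trans (add_le_add (hξ' p) ((p : StrongDual ℝ Γ.E).le_opNorm Φ))
  have hle := predual_le hcl fun φ k => ⟨g φ k, by
    change η (g φ k) = 0
    rw [hη, hu]
    change _ - functional (Γ.embed φ) k Φ = 0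
    rw [functional_embed_apply, hΦ, sub_self], rfl⟩
  obtain ⟨q, hq, e⟩ := hle p.2
  have hqp : q = p := Subtype.ext e
  rw [hqp] at hq
  exact sub_eq_zero.mp ((hη p).symm.trans hq)

theorem completeSpace (Γ : DiffusionForm μ) : CompleteSpace Γ.E :=
  completeSpace_of_predual (predual Γ)
    { toFun := fun Φ => { toFun := fun p => p Φ, map_add' := fun _ _ => rfl,
                          map_smul' := fun _ _ => rfl }
      map_add' := fun Φ Ψ => LinearMap.ext fun p => map_add p Φ Ψ
      map_smul' := fun c Φ => LinearMap.ext fun p => map_smul p c Φ }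
    (fun Φ p => by rw [mul_comm]; exact p.le_opNorm Φ) (fun _ _ hC h => norm_le_of_apply_le hC h)
    fun ξ ⟨_, hC⟩ => exists_apply_eq ξ hC

/-- An idempotent takes the values `0` and `1` almost everywhere, so at each point one of the two
parts has the full square norm. -/
theorem norm_projection {p : LInf μ} (hp : p * p = p) (Φ : Γ.E) :
    ‖Φ‖ = max ‖p • Φ‖ ‖(1 - p) • Φ‖ := by
  have hq : (1 - p) * (1 - p) = 1 - p := by linear_combination hp
  have hle : ∀ q : LInf μ, q * q = q → ‖q • Φ‖ ≤ ‖Φ‖ := fun q hq => by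
    refine (norm_smul_le q Φ).trans (mul_le_of_le_one_left (norm_nonneg _) ?_)
    refine LInf.norm_le_of_ae zero_le_one ?_
    filter_upwards [LInf.coeFn_mul q q] with x hx
    rw [hq] at hx
    rcases eq_zero_or_one_of_mul_self hx with h | h <;> simp [h]
  refine le_antisymm ?_ (max_le (hle p hp) (hle _ hq))
  rw [← abs_of_nonneg (norm_nonneg Φ), ← abs_of_nonneg (le_max_of_le_left (norm_nonneg (p • Φ))),
    ← sq_le_sq, norm_sq_eq]
  refine LInf.norm_le_of_ae (sq_nonneg _) ?_
  have h1 := norm_sq_eq (p • Φ)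
  have h2 := norm_sq_eq ((1 - p) • Φ)
  rw [normSq_smul, hp] at h1
  rw [normSq_smul, hq] at h2
  filter_upwards [LInf.ae_norm_le (p * normSq Φ), LInf.ae_norm_le ((1 - p) * normSq Φ),
    LInf.coeFn_mul p (normSq Φ), LInf.coeFn_mul (1 - p) (normSq Φ), LInf.coeFn_sub 1 p,
    LInf.coeFn_one (μ := μ), LInf.coeFn_mul p p] with x a1 a2 a3 a4 a5 a6 a7
  rw [a3, ← h1] at a1
  rw [a4, a5, a6, ← h2] at a2
  rw [hp] at a7
  rcases eq_zero_or_one_of_mul_self a7 with h | h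
  · rw [h, sub_zero, one_mul] at a2
    exact a2.trans (pow_le_pow_left₀ (norm_nonneg _) (le_max_right _ _) 2)
  · rw [h, one_mul] at a1
    exact a1.trans (pow_le_pow_left₀ (norm_nonneg _) (le_max_left _ _) 2)

/-- The map `f ↦ f • Φ`. -/
def smulRightL (Φ : Γ.E) : LInf μ →L[ℝ] Γ.E :=
  LinearMap.mkContinuous
    { toFun := fun f => f • Φ
      map_add' := fun f g => add_smul f g Φ
      map_smul' := fun c f => smul_comm_real c f Φ } ‖Φ‖ fun f => by
    rw [mul_comm]; exact norm_smul_le f Φ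

/-- The map `Φ ↦ f • Φ`. -/
def smulLeftL (Γ : DiffusionForm μ) (f : LInf μ) : Γ.E →L[ℝ] Γ.E :=
  LinearMap.mkContinuous
    { toFun := fun Φ => f • Φ
      map_add' := fun Φ Ψ => smul_add f Φ Ψ
      map_smul' := fun c Φ => ext fun φ => mul_smul_comm c f (Φ φ) } ‖f‖ fun Φ => norm_smul_le f Φ

/-- On generators, composing with multiplication by `f` replaces `k` by `f • k`; the closed span
follows by continuity. -/
theorem comp_smulLeftL_mem_predual (f : LInf μ) {p : StrongDual ℝ Γ.E} (hp : p ∈ predual Γ) :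
    p.comp (smulLeftL Γ f) ∈ predual Γ := by
  let R : StrongDual ℝ Γ.E →L[ℝ] StrongDual ℝ Γ.E :=
    (ContinuousLinearMap.compL ℝ Γ.E Γ.E ℝ).flip (smulLeftL Γ f)
  have h : predual Γ ≤ (predual Γ).comap R.toLinearMap := by
    refine predual_le (isClosed_predual.preimage R.continuous) fun φ k => ?_
    have e : R (functional (Γ.embed φ) k) = functional (Γ.embed φ) (f • k : Lp ℝ 1 μ) := by
      ext Φ
      change functional (Γ.embed φ) k (f • Φ) = _
      rw [functional_embed_apply, functional_embed_apply, smul_apply, LInf.pairing_mul]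
    change R (functional (Γ.embed φ) k) ∈ predual Γ
    rw [e]; exact functional_embed_mem_predual _ _
  exact h hp

/-- On generators the density is `Φ(φ) k`. The image of `L^1` in the dual of `L^∞` is closed, being
isometric to a complete space, so the property passes to the closed span. -/
theorem exists_apply_smul_eq_pairing (Φ : Γ.E) {p : StrongDual ℝ Γ.E} (hp : p ∈ predual Γ) :
    ∃ k : Lp ℝ 1 μ, ∀ f : LInf μ, p (f • Φ) = LInf.pairing f k := by
  let R : StrongDual ℝ Γ.E →L[ℝ] StrongDual ℝ (LInf μ) :=
    (ContinuousLinearMap.compL ℝ (LInf μ) Γ.E ℝ).flip (smulRightL Φ)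
  have hcl : IsClosed (LinearMap.range (LInf.pairingIsometry μ).toLinearMap :
      Set (StrongDual ℝ (LInf μ))) := by
    rw [LinearMap.coe_range]
    exact (LInf.pairingIsometry μ).isometry.isClosedEmbedding.isClosed_range
  have h : predual Γ ≤ (LinearMap.range (LInf.pairingIsometry μ).toLinearMap).comap
      R.toLinearMap := by
    refine predual_le (hcl.preimage R.continuous) fun φ k => ?_
    refine ⟨(Φ φ • k : Lp ℝ 1 μ), ?_⟩
    ext f
    change LInf.pairing f (Φ φ • k : Lp ℝ 1 μ) = functional (Γ.embed φ) k (f • Φ)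
    rw [functional_embed_apply, smul_apply, mul_comm, LInf.pairing_mul]
  obtain ⟨k, hk⟩ := h hp
  exact ⟨k, fun f => (DFunLike.congr_fun hk f).symm⟩

theorem isAbelianWStarModule (Γ : DiffusionForm μ) : IsAbelianWStarModule μ (predual Γ) where
  complete := completeSpace Γ
  norm_smul_le := norm_smul_le
  norm_projection _ hp := norm_projection hp
  predual_closed := isClosed_predual
  predual_norm := isLUB_norm
  predual_surjective ξ := fun ⟨_, hC⟩ => exists_apply_eq ξ hC
  continuous_smul_left Φ := by
    let _ := weakStar μ
    refine continuous_predualTopology_iff.mpr fun p hp => ?_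
    obtain ⟨k, hk⟩ := exists_apply_smul_eq_pairing Φ hp
    exact (LInf.continuous_pairing k).congr fun f => (hk f).symm
  continuous_smul_right f :=
    (@continuous_predualTopology_iff _ _ _ _ _ (predualTopology (predual Γ)) _).mpr fun _ hp =>
      continuous_apply_of_mem_predual (comp_smulLeftL_mem_predual f hp)

theorem isSelfDualHilbertModule (Γ : DiffusionForm μ) : IsSelfDualHilbertModule (inner Γ) where
  symm := inner_symm
  nonneg Φ := by rw [inner_self]; exact normSq_nonneg Φ
  definite Φ h := eq_zero_of_normSq_eq_zero (by rwa [← inner_self])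
  norm_sq Φ := by rw [inner_self]; exact norm_sq_eq Φ
  complete := completeSpace Γ
  self_dual F hF := by
    obtain ⟨Ψ, hΨ⟩ := self_dual hF
    exact ⟨Ψ, fun Φ => hΨ Φ⟩

end E

end DiffusionForm

end

end Weaver

namespace Weaver
noncomputable section

variable {X : Type*} [MeasurableSpace X] {μ : Measure X}

namespace DiffusionForm

variable {Γ : DiffusionForm μ}

/-! ### The derivation -/

/-- The part `f ⊗ 1` is invisible because `Γ` vanishes on constants. This formula reduces every
statement about `δ` to one about `Γ`. -/
theorem inner₀_tmul_delta (a b f : Γ.domain) :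
    Γ.inner₀ (a ⊗ₜ b) ((1 : Γ.domain) ⊗ₜ[ℝ] f - f ⊗ₜ[ℝ] (1 : Γ.domain))
      = (a : LInf μ) * Γ.form b f := by
  rw [map_sub, inner₀_tmul, inner₀_tmul, form_one_right, mul_zero, sub_zero]
  simp

/-- The value of `δ f` at the class of `φ`. -/
theorem inner₁_delta₁_eq {φ : Γ.E₁} {φ' : Γ.E₀} (h : (φ : Γ.E₀ ⧸ Γ.nullSubmodule)
    = Γ.nullSubmodule.mkQ φ') (f : Γ.domain) :
    Γ.inner₁ φ (Γ.delta₁ f)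
      = Γ.inner₀ φ' ((1 : Γ.domain) ⊗ₜ[ℝ] f - f ⊗ₜ[ℝ] (1 : Γ.domain)) := by
  obtain ⟨φ, hφ⟩ := φ
  subst h
  rfl

theorem exists_mkQ_eq (φ : Γ.E₁) :
    ∃ φ' : Γ.E₀, (φ : Γ.E₀ ⧸ Γ.nullSubmodule) = Γ.nullSubmodule.mkQ φ' := by
  obtain ⟨φ', h⟩ := Γ.nullSubmodule.mkQ_surjective φ
  exact ⟨φ', h.symm⟩

theorem delta_apply (φ : Γ.E₁) (f : Γ.domain) : Γ.delta f φ = Γ.inner₁ φ (Γ.delta₁ f) := rfl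

theorem delta_add (f g : Γ.domain) : Γ.delta (f + g) = Γ.delta f + Γ.delta g := by
  refine E.ext fun φ => ?_
  obtain ⟨φ', h⟩ := exists_mkQ_eq φ
  rw [E.add_apply]
  simp only [delta_apply, inner₁_delta₁_eq h]
  clear h
  induction φ' using TensorProduct.induction_on with
  | zero => simp
  | add a b ha hb => simp only [map_add, LinearMap.add_apply, ha, hb]; ring
  | tmul a b => simp only [inner₀_tmul_delta, map_add]; ring

theorem delta_smul (c : ℝ) (f : Γ.domain) : Γ.delta (c • f) = c • Γ.delta f := by
  refine E.ext fun φ => ?_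
  obtain ⟨φ', h⟩ := exists_mkQ_eq φ
  rw [E.real_smul_apply]
  simp only [delta_apply, inner₁_delta₁_eq h]
  clear h
  induction φ' using TensorProduct.induction_on with
  | zero => simp
  | add a b ha hb => rw [map_add, LinearMap.add_apply, LinearMap.add_apply, smul_add, ha, hb]
  | tmul a b => rw [inner₀_tmul_delta, inner₀_tmul_delta, map_smul, mul_smul_comm]

/-- The identity is checked by testing against elementary tensors, where it becomes the Leibniz rule
of `Γ`. -/
theorem delta_mul (f g : Γ.domain) :
    Γ.delta (f * g) = (f : LInf μ) • Γ.delta g + (g : LInf μ) • Γ.delta f := by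
  refine E.ext fun φ => ?_
  obtain ⟨φ', h⟩ := exists_mkQ_eq φ
  rw [E.add_apply, E.smul_apply, E.smul_apply]
  simp only [delta_apply, inner₁_delta₁_eq h]
  clear h
  induction φ' using TensorProduct.induction_on with
  | zero => simp
  | add a b ha hb => rw [map_add, LinearMap.add_apply, ha, hb]
                     simp only [LinearMap.add_apply]; ring
  | tmul a b =>
    simp only [inner₀_tmul_delta]
    rw [Γ.symm, Γ.leibniz, Γ.symm g, Γ.symm f]
    ring

theorem inner₁_delta₁_delta₁ (f g : Γ.domain) :
    Γ.inner₁ (Γ.delta₁ f) (Γ.delta₁ g) = Γ.form f g := by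
  rw [inner₁_delta₁_eq (φ := Γ.delta₁ f)
    (φ' := (1 : Γ.domain) ⊗ₜ[ℝ] f - f ⊗ₜ[ℝ] (1 : Γ.domain)) rfl, LinearMap.map_sub₂,
    inner₀_tmul_delta, inner₀_tmul_delta, form_one_left, mul_zero, sub_zero]
  simp

/-- On elementary tensors this is the closedness of `Γ`, with the first factor moved onto the test
function in `L^1`. -/
theorem tendsto_delta_apply (φ : Γ.E₁) {l : Filter Γ.domain} [l.NeBot] {C : ℝ} {f : Γ.domain}
    (hC : ∀ᶠ u in l, ‖Γ.form u u‖ ≤ C)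
    (hf : Tendsto (fun u : Γ.domain => (u : LInf μ)) l (@nhds _ (weakStar μ) f)) :
    Tendsto (fun u => Γ.delta u φ) l (@nhds _ (weakStar μ) (Γ.delta f φ)) := by
  obtain ⟨φ', h⟩ := exists_mkQ_eq φ
  simp only [delta_apply, inner₁_delta₁_eq h]
  clear h
  rw [LInf.tendsto_weakStar]
  intro k
  induction φ' using TensorProduct.induction_on with
  | zero => simpa only [map_zero, LinearMap.zero_apply] using tendsto_const_nhds
  | add a b ha hb =>
    simpa only [map_add, LinearMap.add_apply, LInf.pairing_add] using ha.add hb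
  | tmul a b =>
    obtain ⟨_, h⟩ := Γ.closed l C f hC hf
    have h1 := LInf.tendsto_weakStar.mp (h b) ((a : LInf μ) • k : Lp ℝ 1 μ)
    simp only [inner₀_tmul_delta, LInf.pairing_mul, Γ.symm b]
    exact h1

variable [SigmaFinite μ]

theorem inner_delta_delta (f g : Γ.domain) : E.inner Γ (Γ.delta f) (Γ.delta g) = Γ.form f g := by
  rw [delta, E.inner_embed, delta_apply, inner₁_delta₁_delta₁]

theorem norm_delta_sq (f : Γ.domain) : ‖Γ.delta f‖ ^ 2 = ‖Γ.form f f‖ := by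
  rw [E.norm_sq_eq, ← E.inner_self, inner_delta_delta]

theorem norm_delta (f : Γ.domain) : ‖Γ.delta f‖ = √‖Γ.form f f‖ := by
  rw [← norm_delta_sq, Real.sqrt_sq (norm_nonneg _)]

theorem ofReal_norm_delta (f : Γ.domain) :
    ENNReal.ofReal ‖Γ.delta f‖ = lipNumber Γ.metric f := by
  rw [lipNumber_eq, norm_delta]

theorem norm_delta_le (f : Γ.domain) : ‖Γ.delta f‖ ≤ lipNorm Γ.metric f := by
  rw [lipNorm, ← ofReal_norm_delta, ENNReal.toReal_ofReal (norm_nonneg _)]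
  exact le_max_left _ _

/-- An element of `Lip(M)` as an element of the domain. -/
def ofLip (f : lip Γ.metric) : Γ.domain := ⟨f, (mem_domain_iff_mem_lip _).mpr f.2⟩

/-- Since `‖δ f‖ ≤ 1` on the unit ball of `Lip(M)`, the good functionals form a norm-closed
subspace, by uniform limits; on generators `tendsto_delta_apply` applies. -/
theorem continuousOn_delta {p : StrongDual ℝ Γ.E} (hp : p ∈ E.predual Γ) :
    @ContinuousOn _ _ (TopologicalSpace.induced Subtype.val (weakStar μ)) _
      (fun f : lip Γ.metric => p (Γ.delta (ofLip f))) {f | lipNorm Γ.metric f ≤ 1} := by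
  let τ : TopologicalSpace (lip Γ.metric) := TopologicalSpace.induced Subtype.val (weakStar μ)
  let S : Submodule ℝ (StrongDual ℝ Γ.E) :=
    { carrier := {p | ContinuousOn (fun f : lip Γ.metric => p (Γ.delta (ofLip f)))
        {f | lipNorm Γ.metric f ≤ 1}}
      zero_mem' := continuousOn_const
      add_mem' := fun h1 h2 => h1.add h2
      smul_mem' := fun c _ h => h.const_smul c }
  have hcl : IsClosed (S : Set (StrongDual ℝ Γ.E)) := by
    refine isClosed_of_closure_subset fun p hp => ?_
    refine continuousOn_of_uniform_approx_of_continuousOn fun u hu => ?_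
    obtain ⟨ε, hε, hεu⟩ := Metric.mem_uniformity_dist.mp hu
    obtain ⟨q, hq, hpq⟩ := Metric.mem_closure_iff.mp hp ε hε
    refine ⟨_, hq, fun f hf => hεu ?_⟩
    rw [Real.dist_eq, ← _root_.sub_apply]
    refine (((p - q).le_opNorm _).trans (mul_le_of_le_one_right (norm_nonneg _) ?_)).trans_lt
      (by rwa [← dist_eq_norm])
    exact (norm_delta_le _).trans hf
  refine E.predual_le (S := S) hcl (fun φ k => ?_) hp
  intro f hf
  change Tendsto _ _ _
  have : (𝓝[{f | lipNorm Γ.metric f ≤ 1}] f).NeBot := mem_closure_iff_nhdsWithin_neBot.mp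
    (subset_closure hf)
  have h := tendsto_delta_apply (Γ := Γ) φ (l := map ofLip (𝓝[{f | lipNorm Γ.metric f ≤ 1}] f))
    (C := 1) (f := ofLip f) ?_ ?_
  · have h1 := LInf.tendsto_weakStar.mp h k
    rw [tendsto_map'_iff] at h1
    simp only [E.functional_embed_apply]
    exact h1
  · rw [eventually_map]
    filter_upwards [self_mem_nhdsWithin] with g hg
    rw [← norm_delta_sq]
    exact pow_le_one₀ (norm_nonneg _) ((norm_delta_le _).trans hg)
  · rw [tendsto_map'_iff]
    refine Tendsto.mono_left ?_ nhdsWithin_le_nhds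
    exact (@nhds_induced _ _ (weakStar μ) Subtype.val f).symm ▸ tendsto_comap

theorem isLipPredual_delta {p : StrongDual ℝ Γ.E} (hp : p ∈ E.predual Γ) :
    IsLipPredual Γ.metric fun f => p (Γ.delta (ofLip f)) where
  add f g h e := by
    rw [← map_add, ← delta_add]; congr 2; exact Subtype.ext e
  smul c f h e := by
    have h1 := p.map_smul c (Γ.delta (ofLip f))
    rw [← delta_smul] at h1
    refine Eq.trans ?_ h1
    congr 2; exact Subtype.ext e
  continuousOn_ball := continuousOn_delta hp

theorem continuous_delta (Γ : DiffusionForm μ) :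
    @Continuous _ _ (lipWeakStar Γ.metric) (predualTopology (E.predual Γ))
      fun f : lip Γ.metric => Γ.delta (ofLip f) := by
  refine (@continuous_predualTopology_iff _ _ _ _ _ (lipWeakStar Γ.metric) _).mpr fun p hp => ?_
  have h : @Continuous _ _ (lipWeakStar Γ.metric) _
      fun (f : lip Γ.metric) (F : {F // IsLipPredual Γ.metric F}) => F.1 f :=
    continuous_induced_dom
  exact (@continuous_pi_iff _ _ _ (lipWeakStar Γ.metric) _ _).mp h ⟨_, isLipPredual_delta hp⟩

theorem isMetricDerivation_delta (Γ : DiffusionForm μ) :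
    IsMetricDerivation Γ.metric (predualTopology (E.predual Γ))
      fun f => Γ.delta (ofLip f) where
  add f g h e := by
    rw [← delta_add]; congr 1; exact Subtype.ext e
  smul c f h e := by
    refine Eq.trans ?_ (delta_smul c (ofLip f))
    congr 1; exact Subtype.ext e
  leibniz f g h e := by
    refine Eq.trans ?_ (delta_mul (ofLip f) (ofLip g))
    congr 1; exact Subtype.ext e
  bounded := ⟨1, zero_le_one, fun f => by rw [one_mul]; exact norm_delta_le _⟩
  continuous := continuous_delta Γ

/-! ### Vector fields -/

/-- The metric derivation `f ↦ ⟨δ f, Φ⟩`. -/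
def toVectorField (Φ : Γ.E) : VectorField Γ.metric :=
  ⟨fun f => E.inner Γ (Γ.delta (ofLip f)) Φ,
   { add := fun f g h e => by
      rw [(isMetricDerivation_delta Γ).add f g h e, LinearMap.map_add₂]
     smul := fun c f h e => by
      rw [(isMetricDerivation_delta Γ).smul c f h e, E.inner_real_smul_left]
     leibniz := fun f g h e => by
      rw [(isMetricDerivation_delta Γ).leibniz f g h e, LinearMap.map_add₂, map_smul, map_smul]
      rfl
     bounded := ⟨‖Φ‖, norm_nonneg _, fun f => by
      refine (E.norm_inner_le _ _).trans ?_
      rw [mul_comm]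
      exact mul_le_mul_of_nonneg_left (norm_delta_le _) (norm_nonneg _)⟩
     continuous := by
      let τ := lipWeakStar Γ.metric
      refine continuous_induced_rng.mpr (continuous_pi fun k => ?_)
      -- Continuity for a general `Φ` uses that all functionals `∫ ⟨·, Φ⟩ k` lie in the predual, not
      -- only those with `Φ` in `E₁`.
      exact (@continuous_predualTopology_iff _ _ _ _ _ τ _).mp (continuous_delta Γ) _
        (E.functional_mem_predual Φ k) }⟩

/-- The map `T : E → 𝒳(M)`. -/
def toVectorFieldL (Γ : DiffusionForm μ) : Γ.E →ₗ[LInf μ] VectorField Γ.metric where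
  toFun := toVectorField
  map_add' Φ Ψ := Subtype.ext (funext fun _ => map_add (E.inner Γ _) Φ Ψ)
  map_smul' a Φ := Subtype.ext (funext fun _ => map_smul (E.inner Γ _) a Φ)

theorem norm_toVectorFieldL_le (Φ : Γ.E) : ‖toVectorFieldL Γ Φ‖ ≤ ‖Φ‖ :=
  csInf_le ⟨0, fun _ h => h.1⟩ ⟨norm_nonneg _, fun f => by
    refine (E.norm_inner_le _ _).trans ?_
    rw [mul_comm]
    exact mul_le_mul_of_nonneg_left (norm_delta_le _) (norm_nonneg _)⟩

/-- Self-duality represents the bounded module map `ω ∘ T` by an element of `E`. Nondegeneracy makes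
it unique, hence linear in `ω`. -/
theorem exists_adjoint (Γ : DiffusionForm μ) : ∃ Tstar : OneForm Γ.metric →ₗ[LInf μ] Γ.E,
    ∀ (ω : OneForm Γ.metric) (Φ : Γ.E), E.inner Γ (Tstar ω) Φ = ω.1 (toVectorFieldL Γ Φ) := by
  have h : ∀ ω : OneForm Γ.metric, ∃ w : Γ.E, ∀ Φ, E.inner Γ w Φ = ω.1 (toVectorFieldL Γ Φ) := by
    intro ω
    obtain ⟨C, hC⟩ := ω.2
    obtain ⟨w, hw⟩ := E.self_dual (F := ω.1.comp (toVectorFieldL Γ)) ⟨|C|, fun Φ => by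
      refine (hC _).trans ?_
      exact mul_le_mul (le_abs_self C) (norm_toVectorFieldL_le Φ) (norm_nonneg _) (abs_nonneg _)⟩
    exact ⟨w, fun Φ => by rw [E.inner_symm, ← hw]; rfl⟩
  choose w hw using h
  exact ⟨{ toFun := w
           map_add' := fun ω ω' => E.eq_of_inner_eq fun Φ => by
             rw [LinearMap.map_add₂, hw, hw, hw]; rfl
           map_smul' := fun a ω => E.eq_of_inner_eq fun Φ => by
             rw [RingHom.id_apply, map_smul, LinearMap.smul_apply, hw, hw]; rfl }, hw⟩

end DiffusionForm

end

end Weaver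

/-! ### Assembly of the theorem -/

theorem proposition54 {X : Type*} [MeasurableSpace X] (μ : Measure X) [SigmaFinite μ]
    (Γ : DiffusionForm μ) :
    IsMeasurableMetric Γ.metric ∧
    ∃ hD : ∀ f : LInf μ, f ∈ Γ.domain ↔ f ∈ lip Γ.metric,
    ∃ B : Γ.E →ₗ[LInf μ] Γ.E →ₗ[LInf μ] LInf μ,
      -- `E` is an abelian W*-module and a self-dual Hilbert module, with an inner product that
      -- extends the one of `E₁`
      IsAbelianWStarModule μ (DiffusionForm.E.predual Γ) ∧
      IsSelfDualHilbertModule B ∧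
      (∀ (φ : Γ.E₁) (Φ : Γ.E), B (Γ.embed φ) Φ = Φ φ) ∧
      (∀ f g : Γ.domain, Γ.form f g = B (Γ.delta f) (Γ.delta g)) ∧
      IsMetricDerivation Γ.metric (predualTopology (DiffusionForm.E.predual Γ))
        (fun f => Γ.delta ⟨f, (hD f).mpr f.2⟩) ∧
      (∀ f : Γ.domain, ENNReal.ofReal ‖Γ.delta f‖ = lipNumber Γ.metric f) ∧
      ∃ T : Γ.E →ₗ[LInf μ] VectorField Γ.metric,
        (∀ Φ, ‖T Φ‖ ≤ ‖Φ‖) ∧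
        ∃ Tstar : OneForm Γ.metric →ₗ[LInf μ] Γ.E,
          (∀ (ω : OneForm Γ.metric) (Φ : Γ.E), B (Tstar ω) Φ = ω.1 (T Φ)) ∧
          ∀ f : lip Γ.metric, Γ.delta ⟨f, (hD f).mpr f.2⟩ = Tstar (extDeriv Γ.metric f) := by
  obtain ⟨Tstar, hT⟩ := DiffusionForm.exists_adjoint Γ
  refine ⟨DiffusionForm.isMeasurableMetric_metric Γ, DiffusionForm.mem_domain_iff_mem_lip,
    DiffusionForm.E.inner Γ, DiffusionForm.E.isAbelianWStarModule Γ,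
    DiffusionForm.E.isSelfDualHilbertModule Γ, DiffusionForm.E.inner_embed,
    fun f g => (DiffusionForm.inner_delta_delta f g).symm,
    DiffusionForm.isMetricDerivation_delta Γ, DiffusionForm.ofReal_norm_delta,
    DiffusionForm.toVectorFieldL Γ, DiffusionForm.norm_toVectorFieldL_le, Tstar, hT,
    fun f => DiffusionForm.E.eq_of_inner_eq fun Φ => ?_⟩
  -- Both sides pair with `Φ` to `⟨δ f, Φ⟩`: by definition `(df)(T Φ) = (T Φ)(f)`.
  rw [hT]
  rfl
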